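/- Write $[n]=\{1,\dots,n\}$, $\mathbb{E}_{s\in S}g(s)=\frac1{|S|}\sum_{s\in S}g(s)$ for a finite nonempty set $S$, $\mathbb{T}=\mathbb{R}/\mathbb{Z}$, $e(\theta)=e^{2\pi i\theta}$, and let $\|\theta\|_{\mathbb{T}}$ be the distance from $\theta$ to the nearest integer. For a positive integer $N$ let $\mu_N(d)=\frac1N\max\{1-\frac{|d|}{N},0\}$ for $d\in\mathbb{Z}$, and for $f_0,f_1,f_2:\mathbb{Z}^2\to\mathbb{C}$ put $$\Lambda_N(f_0,f_1,f_2)=\mathbb{E}_{x\in[N]}\mathbb{E}_{y\in[N^2]}\sum_{d\in\mathbb{Z}}\mu_N(d)f_0(x,y)f_1(x+d,y)f_2(x,y+d^2).$$ **Theorem (Counting operator inverse theorem, II).** There is an absolute constant $C>0$ such that the following holds. Let $N$ be a positive integer, let $\delta>0$, and let $f_0,f_1,f_2:\mathbb{Z}^2\to\mathbb{C}$ satisfy $|f_i|\le 1$ everywhere. If $|\Lambda_N(f_0,f_1,f_2)|\ge\delta$, then either $N\le C\delta^{-C}$, or there exist $\alpha\in\mathbb{T}$ and a positive integer $q\le C\delta^{-C}$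 such that $\|q\alpha\|_{\mathbb{T}}\le C\delta^{-C}/N^2$ and $$\mathbb{E}_{x\in[N]}\Bigl|\mathbb{E}_{y\in[2N^2]}f_2(x,y)e(\alpha y)\Bigr|\ge C^{-1}\delta^{C}.$$ -/

import Mathlib

open scoped BigOperators

noncomputable section

namespace NonlinearRoth

/-- The discrete interval `[n] = {1, 2, …, n}` inside `ℤ`. -/
def interval (n : ℕ) : Finset ℤ := Finset.Icc 1 (n : ℤ)

/-- The additive character `e(θ) = exp(2πiθ)` on the torus `𝕋 = ℝ/ℤ`. -/
def e (θ : UnitAddCircle) : ℂ := (AddCircle.toCircle θ : ℂ)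

/-- The normalised Fejér kernel `μ_N(d) = (1/N) (1 - |d|/N)₊` on `ℤ`, for `N ≥ 1`. -/
def fejer (N : ℕ) (d : ℤ) : ℝ := (1 / (N : ℝ)) * max (1 - |(d : ℝ)| / (N : ℝ)) 0

/-- A complex-valued function is 1-bounded if its modulus never exceeds 1. -/
def OneBounded (f : ℤ × ℤ → ℂ) : Prop := ∀ p, ‖f p‖ ≤ 1

/-- The counting operator
`Λ_N(f₀, f₁, f₂) = 𝔼_{x ∈ [N]} 𝔼_{y ∈ [N²]} ∑_d μ_N(d) f₀(x, y) f₁(x + d, y) f₂(x, y + d²)`.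
The sum over `d ∈ ℤ` has finite support, since `μ_N(d) = 0` for `|d| ≥ N`. -/
def countingOp (N : ℕ) (f₀ f₁ f₂ : ℤ × ℤ → ℂ) : ℂ :=
  𝔼 x ∈ interval N, 𝔼 y ∈ interval (N ^ 2),
    ∑' d : ℤ, (fejer N d : ℂ) * f₀ (x, y) * f₁ (x + d, y) * f₂ (x, y + d ^ 2)

end NonlinearRoth

end

/-! The Fejér weight is the law of the difference of two uniform points of {0, …, N - 1}. After
fixing one shift, the operator becomes `cyclicCount`, the average of f₀(x, y) f₁(z, y) f₂(x, y + (z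
- x)²) over x, z and over y in ℤ/P with P = 8N², a modulus too large for wraparound. All losses are
powers of a parameter T ≥ 100 of size 1/δ, and numerical constants are absorbed into extra powers of
T.

The main work concerns the function F = `dual` f₀ f₁ against which f₂ is tested. Two Cauchy–Schwarz
steps and a common shift of z and w bound the count by three-dimensional box norms of F(x, ·), whose
directions are multiples of w - z, x - x' and their sum. Averaging over w, `concatenation` replaces
two of these directions by sums of two independent ones. Such sums are well spread in ℤ/P, because
the gcd of two independent integers is rarely large. Hence second differences of F(x, ·) have large
Fourier coefficients on average (`le_expect_fmax_der_der`).

Degree lowering then removes the differences. Since F is a dual function, a correlation of its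
second difference with a character of frequency φ(x, i, j) can be opened up, and Cauchy–Schwarz
leaves functions of (x, y) and of (z, y) against a quadratic phase whose frequency is an alternating
sum of values of φ. By `major_arc_lemma`, which is Weyl differencing in z followed by averaging in
x, many of these sums lie on major arcs. There are only T^O(1) such arcs, so by pigeonhole φ often
splits as a function of (x, i) plus a function of (x, j), and another Cauchy–Schwarz discards it.
What remains is governed by first differences; a second round reaches F itself. There the frequency
is major, and by pigeonhole it is independent of x (`exists_major_frequency`).

This is applied with f₁ replaced by the conjugate of `colAvg`, an average of f₀ f₂. It yields a
correlation of `colAvg` with an average of phases of one major arc frequency, which barely changes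
under z ↦ z + qt. Averaging over t, the phases and f₀ drop out, so f₂(x, ·) has large averages along
the shifts (z + qt - x)². Fourier expansion, Weyl's inequality and the count of major arcs then give
one major frequency at which f₂(x, ·) has large coefficients on average over x
(`exists_large_fourier`). -/

namespace NonlinearRoth
open Finset ComplexConjugate

/-! ### Averages and convexity inequalities -/

section Expect
variable {ι κ : Type*} [Fintype ι] [Fintype κ]

lemma norm_sq_le_one {z : ℂ} (h : ‖z‖ ≤ 1) : ‖z‖ ^ 2 ≤ 1 := pow_le_one₀ (norm_nonneg _) h

lemma sq_expect_le (f : ι → ℝ) : (𝔼 i, f i) ^ 2 ≤ 𝔼 i, f i ^ 2 := by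
  rcases isEmpty_or_nonempty ι with h | h
  · simp
  · have h0 : 0 ≤ 𝔼 i, (f i - 𝔼 j, f j) ^ 2 := expect_nonneg fun i _ => sq_nonneg _
    have h1 : 𝔼 i, (f i - 𝔼 j, f j) ^ 2 = 𝔼 i, f i ^ 2 - (𝔼 i, f i) ^ 2 := by
      simp only [sub_sq, expect_add_distrib, expect_sub_distrib, ← expect_mul, ← mul_expect,
        Fintype.expect_const]
      ring
    linarith

lemma norm_expect_le_expect (f : ι → ℂ) : ‖𝔼 i, f i‖ ≤ 𝔼 i, ‖f i‖ :=
  RCLike.norm_expect_le (K := ℂ)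

lemma norm_expect_sq_le (f : ι → ℂ) : ‖𝔼 i, f i‖ ^ 2 ≤ 𝔼 i, ‖f i‖ ^ 2 :=
  (pow_le_pow_left₀ (norm_nonneg _) (norm_expect_le_expect f) 2).trans (sq_expect_le _)

lemma pow_expect_le (f : ι → ℝ) (hf : ∀ i, 0 ≤ f i) (n : ℕ) :
    (𝔼 i, f i) ^ (2 ^ n) ≤ 𝔼 i, f i ^ (2 ^ n) := by
  induction n with
  | zero => simp
  | succ n ih =>
    rw [pow_succ, pow_mul]
    refine (pow_le_pow_left₀ (pow_nonneg (expect_nonneg fun i _ => hf i) _) ih 2).trans ?_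
    refine (sq_expect_le _).trans_eq ?_
    simp only [pow_mul]

lemma expect_le_of_le (f : ι → ℝ) {c : ℝ} (hc : 0 ≤ c) (h : ∀ i, f i ≤ c) : 𝔼 i, f i ≤ c := by
  rcases isEmpty_or_nonempty ι with h' | h'
  · simpa using hc
  · exact expect_le univ_nonempty fun i _ => h i

lemma norm_expect_le_one (f : ι → ℂ) (h : ∀ i, ‖f i‖ ≤ 1) : ‖𝔼 i, f i‖ ≤ 1 :=
  (norm_expect_le_expect f).trans (expect_le_of_le _ zero_le_one h)

lemma expect_mono {f g : ι → ℝ} (h : ∀ i, f i ≤ g i) : 𝔼 i, f i ≤ 𝔼 i, g i :=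
  expect_le_expect fun i _ => h i

lemma exists_le_of_le_expect [Nonempty ι] (f : ι → ℝ) {c : ℝ} (h : c ≤ 𝔼 i, f i) :
    ∃ i, c ≤ f i := by
  obtain ⟨i, -, hi⟩ := Finset.exists_le_of_le_expect univ_nonempty h
  exact ⟨i, hi⟩

lemma conj_expect (f : ι → ℂ) : conj (𝔼 i, f i) = 𝔼 i, conj (f i) :=
  map_expect (starRingEnd ℂ) f univ

lemma normSq_expect (f : ι → ℂ) :
    ((‖𝔼 i, f i‖ ^ 2 : ℝ) : ℂ) = 𝔼 i, 𝔼 j, f i * conj (f j) := by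
  rw [← expect_mul_expect, ← conj_expect, Complex.mul_conj, Complex.normSq_eq_norm_sq]

lemma ofReal_expect (f : ι → ℝ) : ((𝔼 i, f i : ℝ) : ℂ) = 𝔼 i, (f i : ℂ) :=
  map_expect Complex.ofRealHom f univ

lemma expect_translate {G : Type*} [AddCommGroup G] [Fintype G] {M : Type*} [AddCommMonoid M]
    [Module ℚ≥0 M] (f : G → M) (t : G) : 𝔼 y, f (y + t) = 𝔼 y, f y :=
  Fintype.expect_equiv (Equiv.addRight t) _ _ fun _ => rfl

lemma expect_prod {M : Type*} [AddCommMonoid M] [Module ℚ≥0 M] (f : ι → κ → M) :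
    𝔼 p : ι × κ, f p.1 p.2 = 𝔼 i, 𝔼 j, f i j := by
  rw [← univ_product_univ, expect_product]

/-- Markov-type extraction: a `[0,1]`-valued function of large mean is large on a large set. -/
lemma le_expect_ite {f : ι → ℝ} (hf : ∀ i, f i ≤ 1) {c : ℝ} (hc0 : 0 ≤ c) (hc : 2 * c ≤ 𝔼 i, f i) :
    c ≤ 𝔼 i, (if c ≤ f i then (1 : ℝ) else 0) := by
  have h : 𝔼 i, f i ≤ 𝔼 i, ((if c ≤ f i then (1 : ℝ) else 0) + c) := by
    refine expect_mono fun i => ?_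
    split_ifs with h
    · linarith [hf i]
    · linarith
  rw [expect_add_distrib] at h
  have : 𝔼 _i : ι, c ≤ c := expect_le_of_le _ hc0 fun _ => le_rfl
  linarith

end Expect

/-! ### Characters and distance to zero on the circle -/

section Circle

lemma e_add (a b : UnitAddCircle) : e (a + b) = e a * e b := by
  simp [e, AddCircle.toCircle_add]

@[simp] lemma e_zero : e 0 = 1 := by simp [e]

@[simp] lemma norm_e (a : UnitAddCircle) : ‖e a‖ = 1 := Circle.norm_coe _

lemma e_neg (a : UnitAddCircle) : e (-a) = conj (e a) := by
  rw [e, AddCircle.toCircle_neg, Circle.coe_inv_eq_conj, e]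

lemma e_coe (x : ℝ) : e (x : UnitAddCircle) = Complex.exp (Complex.I * (2 * Real.pi * x : ℝ)) := by
  simp [e, AddCircle.toCircle_apply_mk, Circle.coe_exp, mul_comm]

lemma exists_lift (θ : UnitAddCircle) : ∃ x : ℝ, (x : UnitAddCircle) = θ ∧ |x| = ‖θ‖ := by
  obtain ⟨y, rfl⟩ := QuotientAddGroup.mk_surjective θ
  refine ⟨y - round y, ?_, (UnitAddCircle.norm_eq).symm⟩
  have h : ((round y : ℝ) : UnitAddCircle) = 0 := by
    rw [AddCircle.coe_eq_zero_iff]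
    exact ⟨round y, by simp⟩
  rw [AddCircle.coe_sub, h, sub_zero]

lemma norm_circle_le_half (θ : UnitAddCircle) : ‖θ‖ ≤ 1 / 2 := by
  simpa using AddCircle.norm_le_half_period (1 : ℝ) (x := θ) one_ne_zero

lemma norm_e_sub_one_le (θ : UnitAddCircle) : ‖e θ - 1‖ ≤ 2 * Real.pi * ‖θ‖ := by
  obtain ⟨x, rfl, hx⟩ := exists_lift θ
  rw [e_coe, ← hx]
  refine (Real.norm_exp_I_mul_ofReal_sub_one_le).trans ?_
  rw [Real.norm_eq_abs, abs_mul, abs_of_pos Real.two_pi_pos]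

lemma le_norm_e_sub_one (θ : UnitAddCircle) : 4 * ‖θ‖ ≤ ‖e θ - 1‖ := by
  obtain ⟨x, rfl, hx⟩ := exists_lift θ
  have h2 := norm_circle_le_half (x : UnitAddCircle)
  rw [e_coe, Complex.norm_exp_I_mul_ofReal_sub_one, ← hx] at *
  have h3 : |Real.sin (Real.pi * x)| = Real.sin (Real.pi * |x|) := by
    rcases abs_cases x with ⟨h, h'⟩ | ⟨h, h'⟩
    · rw [h, abs_of_nonneg]
      exact Real.sin_nonneg_of_nonneg_of_le_pi (by positivity) (by nlinarith [Real.pi_pos])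
    · rw [h, mul_neg, Real.sin_neg, abs_of_nonpos]
      have := Real.sin_nonneg_of_nonneg_of_le_pi (x := Real.pi * |x|) (by positivity)
        (by nlinarith [Real.pi_pos])
      rw [h, mul_neg, Real.sin_neg] at this
      linarith
  have h4 := Real.mul_le_sin (x := Real.pi * |x|) (by positivity) (by nlinarith [Real.pi_pos])
  have h5 : 2 / Real.pi * (Real.pi * |x|) = 2 * |x| := by field_simp
  rw [norm_mul, Real.norm_eq_abs, Real.norm_eq_abs, show 2 * Real.pi * x / 2 = Real.pi * x by ring,
    h3, abs_of_pos (by norm_num : (0:ℝ) < 2)]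
  linarith

lemma norm_e_sub_e_le (a b : UnitAddCircle) : ‖e a - e b‖ ≤ 2 * Real.pi * ‖a - b‖ := by
  have : e a - e b = e b * (e (a - b) - 1) := by
    rw [mul_sub, ← e_add]; simp
  rw [this, norm_mul, norm_e, one_mul]
  exact norm_e_sub_one_le _

lemma norm_nsmul_circle_eq (n : ℕ) (θ : UnitAddCircle) (h : n * ‖θ‖ ≤ 1 / 2) :
    ‖n • θ‖ = n * ‖θ‖ := by
  obtain ⟨x, rfl, hx⟩ := exists_lift θ
  rw [← hx] at h ⊢
  have h1 : n • (x : UnitAddCircle) = ((n * x : ℝ) : UnitAddCircle) := by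
    rw [← nsmul_eq_mul, AddCircle.coe_nsmul]
  have h2 : |n * x| = n * |x| := by rw [abs_mul, Nat.abs_cast]
  rw [h1, (AddCircle.norm_coe_eq_abs_iff (1 : ℝ) one_ne_zero).2 (by rw [h2]; simpa using h), h2]

lemma norm_zsmul_circle_le (n : ℤ) (θ : UnitAddCircle) : ‖n • θ‖ ≤ |(n : ℝ)| * ‖θ‖ := by
  have := norm_zsmul_le n θ
  rwa [Int.norm_eq_abs] at this

/-- A long geometric average is large only if the frequency is close to zero. -/
lemma norm_le_of_le_norm_expect_geom {N : ℕ} (hN : 1 ≤ N) {κ : ℝ} (hκ : 0 < κ) (θ : UnitAddCircle)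
    (h : κ ≤ ‖𝔼 z : Fin N, e ((z : ℤ) • θ)‖) : ‖θ‖ ≤ 1 / (κ * N) := by
  have hN' : (0:ℝ) < N := by exact_mod_cast hN
  have hpow : ∀ z : ℕ, e ((z : ℤ) • θ) = e θ ^ z := by
    intro z
    induction z with
    | zero => simp
    | succ z ih => rw [pow_succ, ← ih, ← e_add]; congr 1; push_cast; rw [add_zsmul, one_zsmul]
  have h1 : (𝔼 z : Fin N, e ((z : ℤ) • θ)) * (e θ - 1) = (e θ ^ N - 1) / N := by
    simp only [hpow]
    rw [Fintype.expect_eq_sum_div_card, Fin.sum_univ_eq_sum_range (fun z => e θ ^ z) N,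
      div_mul_eq_mul_div, geom_sum_mul, Fintype.card_fin]
  have h2 : ‖(e θ ^ N - 1) / N‖ ≤ 2 / N := by
    rw [norm_div, Complex.norm_natCast]
    gcongr
    refine (norm_sub_le _ _).trans ?_
    rw [norm_pow, norm_e]; norm_num
  rw [← h1, norm_mul] at h2
  have h3 : κ * (4 * ‖θ‖) ≤ 2 / N := le_trans (by gcongr; exact le_norm_e_sub_one θ) h2
  rw [le_div_iff₀ hN'] at h3
  rw [le_div_iff₀ (by positivity)]
  nlinarith

end Circle

/-! ### Major arcs, recurrence and Weyl's inequality -/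

/-- `θ` lies on a major arc: some multiple `q θ` with `1 ≤ q ≤ K` is within `K / N ^ 2` of `0`. -/
def IsMaj (N : ℕ) (K : ℝ) (θ : UnitAddCircle) : Prop :=
  ∃ q : ℕ, 1 ≤ q ∧ (q : ℝ) ≤ K ∧ ‖q • θ‖ ≤ K / (N : ℝ) ^ 2

lemma IsMaj.mono {N : ℕ} {K K' : ℝ} {θ : UnitAddCircle} (h : IsMaj N K θ) (hK : K ≤ K') :
    IsMaj N K' θ := by
  obtain ⟨q, h1, h2, h3⟩ := h
  exact ⟨q, h1, h2.trans hK, h3.trans (by gcongr)⟩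

lemma IsMaj.of_nsmul {N : ℕ} {K : ℝ} {θ : UnitAddCircle} {m : ℕ} (hm : 1 ≤ m)
    (h : IsMaj N K (m • θ)) : IsMaj N (m * K) θ := by
  obtain ⟨q, h1, h2, h3⟩ := h
  have hm' : (1 : ℝ) ≤ m := by exact_mod_cast hm
  refine ⟨q * m, Nat.mul_pos h1 hm, by push_cast; nlinarith, ?_⟩
  rw [mul_smul]
  refine h3.trans ?_
  have : K ≤ m * K := by nlinarith [(Nat.cast_nonneg q : (0:ℝ) ≤ q)]
  gcongr

lemma IsMaj.of_le {N M : ℕ} {K c : ℝ} {θ : UnitAddCircle} (hN : 1 ≤ N) (hM : 1 ≤ M) (hc : 1 ≤ c)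
    (hMN : (N : ℝ) ≤ c * M) (h : IsMaj M K θ) : IsMaj N (c ^ 2 * K) θ := by
  obtain ⟨q, h1, h2, h3⟩ := h
  have hK : 0 ≤ K := (Nat.cast_nonneg q).trans h2
  have hM' : (0 : ℝ) < M := by exact_mod_cast hM
  refine ⟨q, h1, h2.trans (le_mul_of_one_le_left hK (one_le_pow₀ hc)), ?_⟩
  refine h3.trans ?_
  have hN' : (0 : ℝ) < N := by exact_mod_cast hN
  rw [div_le_div_iff₀ (by positivity) (by positivity)]
  have : (N : ℝ) ^ 2 ≤ (c * M) ^ 2 := by gcongr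
  nlinarith

/-- Cut the interval into N/L + 1 blocks of length L. By pigeonhole one block holds more than c
points of S; its extreme points are the required pair. -/
lemma exists_pair_of_card {N L c : ℕ} (hL : 0 < L) {a : ℤ} {S : Finset ℤ}
    (hS : S ⊆ Ico a (a + N)) (h : c * (N / L + 1) < #S) :
    ∃ m ∈ S, ∃ n ∈ S, (c : ℤ) ≤ m - n ∧ m - n < L := by
  have hL' : (0 : ℤ) < L := by exact_mod_cast hL
  have hmap : ∀ n ∈ S, (n - a) / (L : ℤ) ∈ Ico (0 : ℤ) ((N / L + 1 : ℕ) : ℤ) := by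
    intro n hn
    have h1 := mem_Ico.1 (hS hn)
    rw [mem_Ico]
    refine ⟨Int.ediv_nonneg (by linarith) hL'.le, ?_⟩
    push_cast
    rw [Int.lt_add_one_iff]
    exact Int.ediv_le_ediv hL' (by linarith)
  obtain ⟨y, -, hy⟩ := exists_lt_card_fiber_of_mul_lt_card_of_maps_to (n := c) hmap (by
    rw [Int.card_Ico, sub_zero, Int.toNat_natCast, mul_comm]
    exact h)
  set U := S.filter fun n => (n - a) / (L : ℤ) = y with hU
  have hne : U.Nonempty := card_pos.1 (by omega)
  have hmax := mem_filter.1 (U.max'_mem hne)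
  have hmin := mem_filter.1 (U.min'_mem hne)
  refine ⟨U.max' hne, hmax.1, U.min' hne, hmin.1, ?_, ?_⟩
  · have hsub : U ⊆ Icc (U.min' hne) (U.max' hne) := fun n hn =>
      mem_Icc.2 ⟨U.min'_le _ hn, U.le_max' _ hn⟩
    have h2 := card_le_card hsub
    rw [Int.card_Icc] at h2
    omega
  · have e1 := Int.mul_ediv_add_emod (U.max' hne - a) L
    have e2 := Int.mul_ediv_add_emod (U.min' hne - a) L
    rw [hmax.2] at e1
    rw [hmin.2] at e2
    have l1 := Int.emod_lt_of_pos (U.max' hne - a) hL'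
    have l2 := Int.emod_nonneg (U.min' hne - a) hL'.ne'
    linarith

/-- If many integers `n` in an interval of length `N` have `n β` within `T / N` of an integer, then
`β` lies on a major arc. -/
lemma isMaj_of_many {N : ℕ} {T : ℝ} (hT : 100 ≤ T) (hN : T ^ 4 ≤ N) {a : ℤ} {S : Finset ℤ}
    (hS : S ⊆ Ico a (a + N)) (hcard : (N : ℝ) ≤ T * #S) (β : UnitAddCircle)
    (hβ : ∀ n ∈ S, ‖n • β‖ ≤ T / N) : IsMaj N (T ^ 6) β := by
  have hT0 : (0 : ℝ) < T := by linarith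
  have hT4 : (100 : ℝ) ^ 3 * T ≤ T ^ 4 := by
    have : (100 : ℝ) ^ 3 ≤ T ^ 3 := by gcongr
    nlinarith
  have hT4' : (100 : ℝ) ^ 2 * T ^ 2 ≤ T ^ 4 := by
    have : (100 : ℝ) ^ 2 ≤ T ^ 2 := by gcongr
    nlinarith [sq_nonneg T]
  have hN0 : (0 : ℝ) < N := by nlinarith
  have hcard' : (N : ℝ) / T ≤ #S := by rw [div_le_iff₀ hT0]; linarith
  have pair : ∀ m ∈ S, ∀ n ∈ S, 0 ≤ m - n → ‖(m - n).toNat • β‖ ≤ 2 * T / N := by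
    intro m hm n hn hmn
    rw [← natCast_zsmul, Int.toNat_of_nonneg hmn, sub_zsmul, ← sub_eq_add_neg]
    refine (norm_sub_le (m • β) (n • β)).trans ?_
    have := hβ m hm; have := hβ n hn
    have : 2 * T / N = T / N + T / N := by ring
    linarith
  -- a small difference
  obtain ⟨m₁, hm₁, n₁, hn₁, h1, h1'⟩ := exists_pair_of_card (N := N) (L := ⌈3 * T⌉₊) (c := 1)
    (Nat.ceil_pos.2 (by positivity)) hS (by
      have : ((1 * (N / ⌈3 * T⌉₊ + 1) : ℕ) : ℝ) < #S := by
        push_cast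
        have h2 : ((N / ⌈3 * T⌉₊ : ℕ) : ℝ) ≤ N / (3 * T) :=
          Nat.cast_div_le.trans (by gcongr; exact Nat.le_ceil _)
        have h3 : (N : ℝ) / (3 * T) = N / T / 3 := by field_simp
        have h4 : 100 ≤ N / T := by rw [le_div_iff₀ hT0]; nlinarith
        linarith
      exact_mod_cast this)
  -- a large difference inside a short block
  set L := ⌊N / (8 * T)⌋₊ with hL
  have hLle : (L : ℝ) ≤ N / (8 * T) := Nat.floor_le (by positivity)
  have h8 : 100 ≤ N / (8 * T) := by rw [le_div_iff₀ (by positivity)]; nlinarith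
  have hLge : (N : ℝ) / (16 * T) ≤ L := by
    have h2 : N / (8 * T) < L + 1 := Nat.lt_floor_add_one _
    have h3 : N / (16 * T) = N / (8 * T) / 2 := by field_simp; norm_num
    linarith
  have hL0 : 0 < L := Nat.floor_pos.2 (by linarith)
  have hNL : ((N / L : ℕ) : ℝ) ≤ 16 * T := by
    refine Nat.cast_div_le.trans ?_
    rw [div_le_iff₀ (by exact_mod_cast hL0)]
    rw [div_le_iff₀ (by positivity)] at hLge
    linarith
  set c := ⌊N / (34 * T ^ 2)⌋₊ with hc
  have hcle : (c : ℝ) ≤ N / (34 * T ^ 2) := Nat.floor_le (by positivity)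
  have h34 : 100 ≤ N / (34 * T ^ 2) := by rw [le_div_iff₀ (by positivity)]; nlinarith
  have hcge : (N : ℝ) / (68 * T ^ 2) ≤ c := by
    have h2 : N / (34 * T ^ 2) < c + 1 := Nat.lt_floor_add_one _
    have h3 : N / (68 * T ^ 2) = N / (34 * T ^ 2) / 2 := by field_simp; norm_num
    linarith
  obtain ⟨m₂, hm₂, n₂, hn₂, h2, h2'⟩ := exists_pair_of_card (N := N) (L := L) (c := c) hL0 hS (by
      have : ((c * (N / L + 1) : ℕ) : ℝ) < #S := by
        push_cast
        have h3 : (c : ℝ) * ((N / L : ℕ) + 1) ≤ N / (34 * T ^ 2) * (17 * T) := by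
          gcongr; linarith
        have h4 : N / (34 * T ^ 2) * (17 * T) = N / T / 2 := by field_simp; norm_num
        have h5 : 0 < N / T := by positivity
        linarith
      exact_mod_cast this)
  set q := (m₁ - n₁).toNat with hq
  set n := (m₂ - n₂).toNat with hn
  have hqn : ‖q • β‖ ≤ 2 * T / N := pair _ hm₁ _ hn₁ (by omega)
  have hnn : ‖n • β‖ ≤ 2 * T / N := pair _ hm₂ _ hn₂ (by omega)
  have hq1 : 1 ≤ q := by omega
  have hqle : (q : ℝ) ≤ 4 * T := by
    have : (q : ℝ) ≤ ⌈3 * T⌉₊ := by exact_mod_cast (by omega : q ≤ ⌈3 * T⌉₊)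
    have := Nat.ceil_lt_add_one (by positivity : 0 ≤ 3 * T)
    linarith
  have hnc : (c : ℝ) ≤ n := by exact_mod_cast (by omega : c ≤ n)
  have hnL : (n : ℝ) ≤ L := by exact_mod_cast (by omega : n ≤ L)
  -- The short block keeps n ≤ N/(8T), so multiplying qβ by n does not wrap around the circle and
  -- n‖qβ‖ = ‖q(nβ)‖ ≤ q‖nβ‖. As n is at least of order N/T², this improves a bound of order 1/N to
  -- one of order 1/N².
  have hmul : n * ‖q • β‖ ≤ 1 / 2 := by
    have : (n : ℝ) * ‖q • β‖ ≤ N / (8 * T) * (2 * T / N) := by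
      gcongr
      exact hnL.trans hLle
    have h4 : N / (8 * T) * (2 * T / N) = 1 / 4 := by field_simp; norm_num
    linarith
  have key : n * ‖q • β‖ ≤ 4 * T * (2 * T / N) := by
    rw [← norm_nsmul_circle_eq n _ hmul, smul_comm]
    refine (norm_nsmul_le (n := q) (a := n • β)).trans ?_
    gcongr
  refine ⟨q, hq1, hqle.trans ?_, ?_⟩
  · have : (100 : ℝ) ^ 5 ≤ T ^ 5 := by gcongr
    nlinarith
  · have h5 : N / (68 * T ^ 2) * ‖q • β‖ ≤ 4 * T * (2 * T / N) :=
      le_trans (by gcongr; linarith) key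
    have h6 : ‖q • β‖ ≤ 544 * T ^ 4 / (N : ℝ) ^ 2 := by
      rw [le_div_iff₀ (by positivity)]
      have h7 : N / (68 * T ^ 2) * ‖q • β‖ * (68 * T ^ 2 * N) ≤
          4 * T * (2 * T / N) * (68 * T ^ 2 * N) := by gcongr
      have h8 : N / (68 * T ^ 2) * ‖q • β‖ * (68 * T ^ 2 * N) = ‖q • β‖ * (N : ℝ) ^ 2 := by
        field_simp
      have h9 : 4 * T * (2 * T / N) * (68 * T ^ 2 * N) = 544 * T ^ 4 := by
        field_simp; norm_num
      linarith
    refine h6.trans ?_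
    gcongr
    have : (100 : ℝ) ^ 2 ≤ T ^ 2 := by gcongr
    nlinarith [pow_pos hT0 4]

lemma expect_boole_eq {ι : Type*} [Fintype ι] (p : ι → Prop) [DecidablePred p] :
    𝔼 i, (if p i then (1 : ℝ) else 0) = #{i | p i} / Fintype.card ι := by
  rw [Fintype.expect_eq_sum_div_card, sum_boole]

/-- Moving the window by one step exchanges a single term at each end. -/
lemma norm_expect_sub_expect_shift_le {N : ℕ} (g : ℤ → ℂ) (hg : ∀ z, ‖g z‖ ≤ 1)
    (v : ℕ) : ‖𝔼 z : Fin N, g z - 𝔼 z : Fin N, g (z + v)‖ ≤ 2 * v / N := by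
  have hsum : ∀ v : ℕ, ‖∑ z ∈ range N, g z - ∑ z ∈ range N, g (z + v)‖ ≤ 2 * v := by
    intro v
    induction v with
    | zero => simp
    | succ v ih =>
      have h1 : ∑ z ∈ range N, g (z + v) - ∑ z ∈ range N, g (z + (v + 1 : ℕ)) =
          g v - g (N + v) := by
        have h2 := sum_range_succ (fun z : ℕ => g (z + v)) N
        have h3 := sum_range_succ' (fun z : ℕ => g (z + v)) N
        rw [h2] at h3
        have h4 : ∀ z : ℕ, g (((z + 1 : ℕ) : ℤ) + v) = g (z + (v + 1 : ℕ)) := fun z => by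
          congr 1; push_cast; ring
        simp only [h4] at h3
        push_cast at h3 ⊢
        rw [zero_add] at h3
        linear_combination h3
      calc ‖∑ z ∈ range N, g z - ∑ z ∈ range N, g (z + (v + 1 : ℕ))‖
          = ‖(∑ z ∈ range N, g z - ∑ z ∈ range N, g (z + v)) + (g v - g (N + v))‖ := by
            rw [← h1]; congr 1; ring
        _ ≤ 2 * v + (1 + 1) := (norm_add_le _ _).trans
            (add_le_add ih ((norm_sub_le _ _).trans (add_le_add (hg _) (hg _))))
        _ = 2 * (v + 1 : ℕ) := by push_cast; ring
  rw [Fintype.expect_eq_sum_div_card, Fintype.expect_eq_sum_div_card, Fintype.card_fin,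
    Fin.sum_univ_eq_sum_range (fun z => g z), Fin.sum_univ_eq_sum_range (fun z => g (z + v)),
    ← sub_div, norm_div, Complex.norm_natCast]
  gcongr
  exact hsum v

/-- If the averages over `z` of `e (z (v - v') θ)` are large for many pairs `v, v'`, then `θ` lies
on a major arc. -/
lemma isMaj_of_le_expect_geom {M N : ℕ} {T : ℝ} (hT : 100 ≤ T) (hM : T ^ 8 ≤ M) (hMN : M ≤ N)
    (θ : UnitAddCircle)
    (h : 1 / T ≤ 𝔼 v' : Fin M, 𝔼 v : Fin M, ‖𝔼 z : Fin N, e ((z : ℤ) • ((v - v' : ℤ) • θ))‖) :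
    IsMaj M (T ^ 12) θ := by
  have hT0 : (0 : ℝ) < T := by linarith
  have hM0 : (0 : ℝ) < M := lt_of_lt_of_le (by positivity) hM
  have hM1 : 0 < M := by exact_mod_cast hM0
  have hMN' : (M : ℝ) ≤ N := by exact_mod_cast hMN
  have : Nonempty (Fin M) := ⟨⟨0, hM1⟩⟩
  -- One v' is enough: the differences v - v' stay in an interval of length M, and each v with a
  -- large geometric average gives ‖(v - v')θ‖ ≤ 2T/N ≤ T²/M, which is the input of `isMaj_of_many`
  -- at T².
  obtain ⟨v', hv'⟩ := exists_le_of_le_expect _ h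
  have h2 := le_expect_ite (c := 1 / (2 * T)) (f := fun v : Fin M =>
    ‖𝔼 z : Fin N, e ((z : ℤ) • ((v - v' : ℤ) • θ))‖)
    (fun v => norm_expect_le_one _ fun z => (norm_e _).le) (by positivity) (by
      refine le_trans (le_of_eq ?_) hv'; field_simp)
  rw [expect_boole_eq, Fintype.card_fin] at h2
  set S₀ : Finset (Fin M) := {v | 1 / (2 * T) ≤ ‖𝔼 z : Fin N, e ((z : ℤ) • ((v - v' : ℤ) • θ))‖}
    with hS₀
  set S : Finset ℤ := S₀.image fun v : Fin M => ((v : ℤ) - v' : ℤ) with hS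
  have hcard : #S = #S₀ := card_image_of_injective _ fun v w hvw => by
    ext; have : (v : ℤ) - v' = (w : ℤ) - v' := hvw; omega
  have hTT : 2 * T ≤ T ^ 2 := by nlinarith
  have := isMaj_of_many (N := M) (T := T ^ 2) (by nlinarith) (by rw [← pow_mul]; exact hM)
    (a := -(v' : ℤ)) (S := S) ?_ ?_ θ ?_
  · rwa [← pow_mul] at this
  · intro n hn
    obtain ⟨v, -, rfl⟩ := mem_image.1 hn
    rw [mem_Ico]
    have := v.2
    omega
  · rw [hcard]
    rw [le_div_iff₀ hM0, div_mul_eq_mul_div, div_le_iff₀ (by positivity)] at h2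
    nlinarith [(Nat.cast_nonneg #S₀ : (0:ℝ) ≤ #S₀)]
  · intro n hn
    obtain ⟨v, hv, rfl⟩ := mem_image.1 hn
    have h3 := norm_le_of_le_norm_expect_geom (hM1.trans_le hMN) (by positivity) _
      (mem_filter.1 hv).2
    refine h3.trans ?_
    have h4 : 1 / (1 / (2 * T) * (N : ℝ)) = 2 * T / N := by field_simp
    rw [h4]
    gcongr

/-- Weyl's inequality in inverse form: a large quadratic exponential average has its leading
coefficient on a major arc. -/
lemma isMaj_of_le_norm_expect_quadratic {N : ℕ} {T : ℝ} (hT : 100 ≤ T) (hN : T ^ 26 ≤ N)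
    (α β : UnitAddCircle)
    (h : 1 / T ≤ ‖𝔼 z : Fin N, e ((z : ℤ) ^ 2 • α + (z : ℤ) • β)‖) : IsMaj N (T ^ 41) α := by
  have hT0 : (0 : ℝ) < T := by linarith
  have hN0 : (0 : ℝ) < N := lt_of_lt_of_le (by positivity) hN
  have hpow : (T : ℝ) ^ 26 = T ^ 24 * (T * T) := by ring
  have h24 : 1 ≤ T ^ 24 := one_le_pow₀ (by linarith)
  -- Averaging over shifts v < M moves the mean by at most 2M/N ≤ 1/(4T), so three quarters of the
  -- lower bound survive. Still M ≥ T²⁴, as `isMaj_of_le_expect_geom` will need at T³.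
  set M := ⌊N / (8 * T)⌋₊ with hMdef
  have hMle : (M : ℝ) ≤ N / (8 * T) := Nat.floor_le (by positivity)
  have hMge : (N : ℝ) / (16 * T) ≤ M := by
    have h2 : N / (8 * T) < M + 1 := Nat.lt_floor_add_one _
    have h3 : N / (16 * T) = N / (8 * T) / 2 := by field_simp; norm_num
    have : 2 ≤ N / (8 * T) := by rw [le_div_iff₀ (by positivity)]; nlinarith
    linarith
  have hM24 : T ^ 24 ≤ M := by
    refine le_trans ?_ hMge
    rw [le_div_iff₀ (by positivity)]
    nlinarith
  have hM0 : (0 : ℝ) < M := lt_of_lt_of_le (by positivity) hM24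
  have hM1 : 0 < M := by exact_mod_cast hM0
  have hMN : M ≤ N := by
    have : (M : ℝ) ≤ N := hMle.trans (div_le_self hN0.le (by linarith))
    exact_mod_cast this
  have : Nonempty (Fin M) := ⟨⟨0, hM1⟩⟩
  set φ : ℤ → ℂ := fun z => e (z ^ 2 • α + z • β) with hφ
  have h1 : ‖𝔼 z : Fin N, φ z - 𝔼 v : Fin M, 𝔼 z : Fin N, φ (z + (v : ℕ))‖ ≤ 1 / (4 * T) := by
    have : 𝔼 z : Fin N, φ z - 𝔼 v : Fin M, 𝔼 z : Fin N, φ (z + (v : ℕ)) =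
        𝔼 v : Fin M, (𝔼 z : Fin N, φ z - 𝔼 z : Fin N, φ (z + (v : ℕ))) := by
      rw [expect_sub_distrib, Fintype.expect_const]
    rw [this]
    refine (norm_expect_le_expect _).trans (expect_le_of_le _ (by positivity) fun v => ?_)
    refine (norm_expect_sub_expect_shift_le φ (fun z => (norm_e _).le) v).trans ?_
    have hv : (v : ℝ) ≤ N / (8 * T) := le_trans (by exact_mod_cast v.2.le) hMle
    rw [div_le_iff₀ hN0]
    have : 1 / (4 * T) * N = 2 * (N / (8 * T)) := by field_simp; norm_num
    linarith
  have h2 : 3 / (4 * T) ≤ ‖𝔼 z : Fin N, 𝔼 v : Fin M, φ (z + (v : ℕ))‖ := by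
    rw [expect_comm]
    have := norm_sub_norm_le (𝔼 z : Fin N, φ z) (𝔼 v : Fin M, 𝔼 z : Fin N, φ (z + (v : ℕ)))
    have h' : 1 / T = 3 / (4 * T) + 1 / (4 * T) := by field_simp; norm_num
    linarith
  have h3 : 1 / (2 * T ^ 2) ≤ 𝔼 z : Fin N, ‖𝔼 v : Fin M, φ (z + (v : ℕ))‖ ^ 2 := by
    refine le_trans ?_ (norm_expect_sq_le _)
    refine le_trans ?_ (pow_le_pow_left₀ (by positivity) h2 2)
    rw [div_pow, div_le_div_iff₀ (by positivity) (by positivity)]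
    nlinarith [pow_pos hT0 2]
  have h4 : ((𝔼 z : Fin N, ‖𝔼 v : Fin M, φ (z + (v : ℕ))‖ ^ 2 : ℝ) : ℂ) =
      𝔼 v' : Fin M, 𝔼 v : Fin M, 𝔼 z : Fin N, φ (z + (v : ℕ)) * conj (φ (z + (v' : ℕ))) := by
    simp only [ofReal_expect, normSq_expect]
    rw [expect_comm]
    simp only [expect_comm (univ : Finset (Fin N))]
    rw [expect_comm]
  -- In φ(z + v) times the conjugate of φ(z + v') the z² terms cancel. Up to a constant phase the
  -- average over z is geometric, with frequency (v - v')·2α.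
  have h5 : 𝔼 z : Fin N, ‖𝔼 v : Fin M, φ (z + (v : ℕ))‖ ^ 2 ≤
      𝔼 v' : Fin M, 𝔼 v : Fin M, ‖𝔼 z : Fin N, e ((z : ℤ) • ((v - v' : ℤ) • (2 • α)))‖ := by
    rw [← Complex.norm_of_nonneg (expect_nonneg fun i _ => sq_nonneg _ :
      0 ≤ 𝔼 z : Fin N, ‖𝔼 v : Fin M, φ (z + (v : ℕ))‖ ^ 2), h4]
    refine (norm_expect_le_expect _).trans (expect_mono fun v' => ?_)
    refine (norm_expect_le_expect _).trans (expect_mono fun v => le_of_eq ?_)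
    have : ∀ z : Fin N, φ (z + (v : ℕ)) * conj (φ (z + (v' : ℕ))) =
        e (((v : ℤ) ^ 2 - (v' : ℤ) ^ 2) • α + (v - v' : ℤ) • β) *
          e ((z : ℤ) • ((v - v' : ℤ) • (2 • α))) := by
      intro z
      rw [hφ]
      simp only
      rw [← e_neg, ← e_add, ← e_add]
      congr 1
      module
    simp only [this]
    rw [← mul_expect, norm_mul, norm_e, one_mul]
  have h6 := isMaj_of_le_expect_geom (T := T ^ 3) (by nlinarith [pow_le_pow_left₀ (by norm_num) hT 2])
    (by rw [← pow_mul]; exact hM24) hMN (2 • α) (by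
      refine le_trans ?_ (h3.trans h5)
      apply one_div_le_one_div_of_le (by positivity)
      nlinarith [pow_pos hT0 2])
  have h7 := h6.of_le (N := N) (c := 16 * T) (by exact_mod_cast (hM1.trans_le hMN)) hM1
    (by linarith) (by rw [div_le_iff₀ (by positivity)] at hMge; linarith)
  refine (IsMaj.of_nsmul one_le_two h7).mono ?_
  rw [← pow_mul, mul_pow]
  have h38 : 0 < T ^ 38 := by positivity
  have : T ^ 41 = T ^ 38 * T ^ 3 := by ring
  have h512 : (512 : ℝ) ≤ T ^ 3 := by nlinarith [pow_le_pow_left₀ (by norm_num) hT 3]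
  push_cast
  rw [this]
  calc 2 * (16 ^ 2 * T ^ 2 * T ^ (3 * 12)) = T ^ 38 * 512 := by ring
    _ ≤ T ^ 38 * T ^ 3 := by gcongr

/-! ### Fourier analysis on ℤ/P -/

section Fourier
variable {P : ℕ} [NeZero P]

/-- The standard additive character of `ℤ/P`. -/
noncomputable def chi (a : ZMod P) : ℂ := e (ZMod.toAddCircle a)

lemma chi_add (a b : ZMod P) : chi (a + b) = chi a * chi b := by
  rw [chi, map_add, e_add, chi, chi]

@[simp] lemma chi_zero : chi (0 : ZMod P) = 1 := by simp [chi]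

@[simp] lemma norm_chi (a : ZMod P) : ‖chi a‖ = 1 := norm_e _

lemma chi_neg (a : ZMod P) : chi (-a) = conj (chi a) := by rw [chi, map_neg, e_neg, chi]

lemma chi_mul_conj (a : ZMod P) : chi a * conj (chi a) = 1 := by
  rw [← chi_neg, ← chi_add, add_neg_cancel, chi_zero]

lemma sum_chi_mul (θ : ZMod P) : ∑ y, chi (θ * y) = if θ = 0 then (P : ℂ) else 0 := by
  have h := AddChar.sum_mulShift (R := ZMod P) θ (ZMod.isPrimitive_stdAddChar P)
  rw [ZMod.card] at h
  have h2 : ∀ y : ZMod P, ZMod.stdAddChar (y * θ) = chi (θ * y) := fun y => by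
    rw [mul_comm]; rfl
  simp only [h2] at h
  rw [h]; split_ifs <;> simp

/-- The normalised Fourier transform on `ℤ/P`. -/
noncomputable def fourier (f : ZMod P → ℂ) (ξ : ZMod P) : ℂ := 𝔼 y, f y * chi (ξ * y)

lemma norm_fourier_le_one {f : ZMod P → ℂ} (hf : ∀ y, ‖f y‖ ≤ 1) (ξ : ZMod P) :
    ‖fourier f ξ‖ ≤ 1 :=
  norm_expect_le_one _ fun y => by rw [norm_mul, norm_chi, mul_one]; exact hf y

lemma parseval (f g : ZMod P → ℂ) :
    ∑ ξ, fourier f ξ * conj (fourier g ξ) = 𝔼 y, f y * conj (g y) := by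
  have hP : (P : ℂ) ≠ 0 := NeZero.ne _
  simp only [fourier, conj_expect, expect_mul_expect]
  rw [← expect_sum_comm]
  refine expect_congr rfl fun y _ => ?_
  rw [← expect_sum_comm, Fintype.expect_eq_sum_div_card, ZMod.card]
  have : ∀ z, ∑ ξ : ZMod P, f y * chi (ξ * y) * conj (g z * chi (ξ * z)) =
      if z = y then f y * conj (g y) * P else 0 := by
    intro z
    have h1 : ∀ ξ : ZMod P, f y * chi (ξ * y) * conj (g z * chi (ξ * z)) =
        f y * conj (g z) * chi ((y - z) * ξ) := by
      intro ξ
      rw [map_mul, ← chi_neg, mul_mul_mul_comm, ← chi_add]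
      congr 2; ring
    simp only [h1]
    rw [← mul_sum, sum_chi_mul]
    by_cases h : z = y
    · subst h; simp
    · simp [h, sub_eq_zero, Ne.symm h]
  simp only [this]
  rw [sum_ite_eq' univ y, if_pos (mem_univ _), mul_div_cancel_right₀ _ hP]

lemma sum_norm_fourier_sq (f : ZMod P → ℂ) :
    ∑ ξ, ‖fourier f ξ‖ ^ 2 = 𝔼 y, ‖f y‖ ^ 2 := by
  have h := parseval f f
  simp only [Complex.mul_conj, Complex.normSq_eq_norm_sq] at h
  rw [← ofReal_expect, ← Complex.ofReal_sum] at h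
  exact_mod_cast h

lemma sum_norm_fourier_sq_le_one {f : ZMod P → ℂ} (hf : ∀ y, ‖f y‖ ≤ 1) :
    ∑ ξ, ‖fourier f ξ‖ ^ 2 ≤ 1 := by
  rw [sum_norm_fourier_sq]
  exact expect_le_of_le _ zero_le_one fun y => norm_sq_le_one (hf y)

lemma fourier_translate (f : ZMod P → ℂ) (a ξ : ZMod P) :
    fourier (fun y => f (y + a)) ξ = fourier f ξ * chi (-(ξ * a)) := by
  rw [fourier, fourier, expect_mul, ← expect_translate (fun y => f y * chi (ξ * y) * _) a]
  refine expect_congr rfl fun y _ => ?_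
  rw [mul_assoc, ← chi_add]
  congr 2; ring

variable {J : Type*} [Fintype J]

/-- Averaging translates is a convolution, which multiplies Fourier coefficients; the identity is
then Parseval. -/
lemma expect_norm_expect_translate_sq (f : ZMod P → ℂ) (A : J → ZMod P) :
    𝔼 y, ‖𝔼 a, f (y + A a)‖ ^ 2 = ∑ ξ, ‖fourier f ξ‖ ^ 2 * ‖𝔼 a, chi (ξ * A a)‖ ^ 2 := by
  rw [← sum_norm_fourier_sq]
  refine sum_congr rfl fun ξ _ => ?_
  have : fourier (fun y => 𝔼 a, f (y + A a)) ξ = fourier f ξ * conj (𝔼 a, chi (ξ * A a)) := by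
    have h1 : ∀ a, fourier f ξ * conj (chi (ξ * A a)) = fourier (fun y => f (y + A a)) ξ :=
      fun a => by rw [fourier_translate, chi_neg]
    rw [conj_expect, mul_expect]
    simp only [h1]
    simp only [fourier, expect_mul]
    rw [expect_comm]
  rw [this, norm_mul, mul_pow, RCLike.norm_conj]

lemma expect_translate_mul_conj (u v : ZMod P → ℂ) (a b : ZMod P) :
    𝔼 y, u (y + a) * conj (v (y + b)) =
      ∑ ξ, fourier u ξ * conj (fourier v ξ) * chi (ξ * (b - a)) := by
  rw [← parseval (fun y => u (y + a)) (fun y => v (y + b))]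
  refine sum_congr rfl fun ξ _ => ?_
  rw [fourier_translate, fourier_translate, map_mul, ← chi_neg, mul_mul_mul_comm, ← chi_add]
  congr 2; ring

/-- The correlation is a Fourier series in m j' - m j with coefficients û(ξ) conj v̂(ξ). Squaring it
pairs frequencies ξ and ξ - σ, and averaging over j and j' turns the characters into the squared
average along `m`. -/
lemma expect_expect_norm_sq_le (u v : ZMod P → ℂ) (m : J → ZMod P) :
    𝔼 j, 𝔼 j', ‖𝔼 y, u (y + m j) * conj (v (y + m j'))‖ ^ 2 ≤
      ∑ ξ, ∑ σ, (‖fourier u ξ‖ * ‖fourier v ξ‖) * (‖fourier u (ξ - σ)‖ * ‖fourier v (ξ - σ)‖) *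
        ‖𝔼 j, chi (σ * m j)‖ ^ 2 := by
  set c : ZMod P → ℂ := fun ξ => fourier u ξ * conj (fourier v ξ) with hc
  have hcn : ∀ ξ, ‖c ξ‖ = ‖fourier u ξ‖ * ‖fourier v ξ‖ := fun ξ => by
    rw [hc]; simp only; rw [norm_mul, RCLike.norm_conj]
  have h1 : ∀ j j', ((‖𝔼 y, u (y + m j) * conj (v (y + m j'))‖ ^ 2 : ℝ) : ℂ) =
      ∑ ξ, ∑ σ, c ξ * conj (c (ξ - σ)) * (chi (σ * m j') * conj (chi (σ * m j))) := by
    intro j j'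
    rw [expect_translate_mul_conj, ← Complex.normSq_eq_norm_sq, ← Complex.mul_conj, map_sum,
      sum_mul_sum]
    refine sum_congr rfl fun ξ _ => ?_
    rw [← Equiv.sum_comp (Equiv.subLeft ξ)]
    refine sum_congr rfl fun σ _ => ?_
    rw [Equiv.subLeft_apply, map_mul, ← chi_neg, ← chi_neg, mul_mul_mul_comm, ← chi_add, ← chi_add]
    congr 2; ring
  have h2 : ((𝔼 j, 𝔼 j', ‖𝔼 y, u (y + m j) * conj (v (y + m j'))‖ ^ 2 : ℝ) : ℂ) =
      ∑ ξ, ∑ σ, c ξ * conj (c (ξ - σ)) * ((‖𝔼 j, chi (σ * m j)‖ ^ 2 : ℝ) : ℂ) := by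
    simp only [ofReal_expect, h1, normSq_expect]
    simp only [expect_sum_comm, mul_expect]
    refine sum_congr rfl fun ξ _ => sum_congr rfl fun σ _ => ?_
    rw [expect_comm]
  have h3 : 0 ≤ 𝔼 j, 𝔼 j', ‖𝔼 y, u (y + m j) * conj (v (y + m j'))‖ ^ 2 :=
    expect_nonneg fun _ _ => expect_nonneg fun _ _ => sq_nonneg _
  rw [← Complex.norm_of_nonneg h3, h2]
  refine (norm_sum_le _ _).trans (sum_le_sum fun ξ _ => ?_)
  refine (norm_sum_le _ _).trans (sum_le_sum fun σ _ => le_of_eq ?_)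
  rw [norm_mul, norm_mul, RCLike.norm_conj, hcn, hcn, Complex.norm_of_nonneg (sq_nonneg _)]

lemma sum_norm_mul_norm_le_one {u v : ZMod P → ℂ} (hu : ∀ y, ‖u y‖ ≤ 1) (hv : ∀ y, ‖v y‖ ≤ 1) :
    ∑ ξ, ‖fourier u ξ‖ * ‖fourier v ξ‖ ≤ 1 := by
  have h : ∑ ξ, ‖fourier u ξ‖ * ‖fourier v ξ‖ ≤
      ∑ ξ, (‖fourier u ξ‖ ^ 2 + ‖fourier v ξ‖ ^ 2) / 2 :=
    sum_le_sum fun ξ _ => by nlinarith [sq_nonneg (‖fourier u ξ‖ - ‖fourier v ξ‖)]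
  rw [← sum_div, sum_add_distrib] at h
  have := sum_norm_fourier_sq_le_one hu
  have := sum_norm_fourier_sq_le_one hv
  linarith

/-- If the correlations of `u` and `v` along the shifts `m j` are large on average, and the
character averages along `m` are small off `S`, then `u` has a large Fourier coefficient. -/
lemma expect_expect_norm_sq_le_of_small {u v : ZMod P → ℂ} (hu : ∀ y, ‖u y‖ ≤ 1)
    (hv : ∀ y, ‖v y‖ ≤ 1) (m : J → ZMod P) {s κ : ℝ} (hs : ∀ ξ, ‖fourier u ξ‖ ^ 2 ≤ s)
    (hs' : ∀ ξ, ‖fourier v ξ‖ ^ 2 ≤ s)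
    (S : Finset (ZMod P)) (hS : ∀ σ ∉ S, ‖𝔼 j, chi (σ * m j)‖ ^ 2 ≤ κ) :
    𝔼 j, 𝔼 j', ‖𝔼 y, u (y + m j) * conj (v (y + m j'))‖ ^ 2 ≤
      κ ⊔ 0 + s * ∑ σ ∈ S, ‖𝔼 j, chi (σ * m j)‖ ^ 2 := by
  have hs0 : 0 ≤ s := (sq_nonneg _).trans (hs 0)
  refine (expect_expect_norm_sq_le u v m).trans ?_
  set W : ZMod P → ℝ := fun ξ => ‖fourier u ξ‖ * ‖fourier v ξ‖ with hW
  have hW0 : ∀ ξ, 0 ≤ W ξ := fun ξ => by positivity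
  have hW1 : ∑ ξ, W ξ ≤ 1 := sum_norm_mul_norm_le_one hu hv
  have hWs : ∀ ξ, W ξ ≤ s := fun ξ => by
    have := hs ξ; have := hs' ξ
    nlinarith [sq_nonneg (‖fourier u ξ‖ - ‖fourier v ξ‖)]
  set k : ZMod P → ℝ := fun σ => ‖𝔼 j, chi (σ * m j)‖ ^ 2 with hk
  have hk0 : ∀ σ, 0 ≤ k σ := fun σ => sq_nonneg _
  -- Off S the kernel is at most κ and the weights W sum to at most 1; on S the weight W(ξ - σ) is
  -- at most s. The maximum with 0 is there because κ carries no sign condition.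
  have key : ∀ ξ, ∑ σ, W ξ * W (ξ - σ) * k σ ≤ W ξ * (κ ⊔ 0 + s * ∑ σ ∈ S, k σ) := by
    intro ξ
    have h1 : ∀ σ, W ξ * W (ξ - σ) * k σ ≤
        W ξ * (W (ξ - σ) * (κ ⊔ 0) + if σ ∈ S then s * k σ else 0) := by
      intro σ
      rw [mul_assoc]
      refine mul_le_mul_of_nonneg_left ?_ (hW0 ξ)
      split_ifs with hσ
      · have := mul_le_mul_of_nonneg_right (hWs (ξ - σ)) (hk0 σ)
        have : 0 ≤ W (ξ - σ) * (κ ⊔ 0) := mul_nonneg (hW0 _) le_sup_right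
        linarith
      · rw [add_zero]
        exact mul_le_mul_of_nonneg_left ((hS σ hσ).trans le_sup_left) (hW0 _)
    refine (sum_le_sum fun σ _ => h1 σ).trans ?_
    rw [← mul_sum, sum_add_distrib, ← sum_mul, sum_ite_mem, univ_inter, ← mul_sum]
    refine mul_le_mul_of_nonneg_left ?_ (hW0 ξ)
    gcongr
    have h2 : ∑ σ, W (ξ - σ) ≤ 1 := by
      have := Equiv.sum_comp (Equiv.subLeft ξ) W
      simp only [Equiv.subLeft_apply] at this
      rw [this]; exact hW1
    nlinarith [(le_sup_right : (0:ℝ) ≤ κ ⊔ 0)]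
  refine (sum_le_sum fun ξ _ => key ξ).trans ?_
  rw [← sum_mul]
  have h4 : 0 ≤ κ ⊔ 0 + s * ∑ σ ∈ S, k σ :=
    add_nonneg le_sup_right (mul_nonneg hs0 (sum_nonneg fun σ _ => hk0 σ))
  nlinarith

end Fourier

/-! ### The number of major arc frequencies -/

section Major
variable {P : ℕ} [NeZero P]

open Classical in
/-- The frequencies of `ℤ/P` lying on a major arc. -/
noncomputable def majSet (P N : ℕ) [NeZero P] (K : ℝ) : Finset (ZMod P) :=
  {ξ | IsMaj N K (ZMod.toAddCircle ξ)}

lemma mem_majSet {N : ℕ} {K : ℝ} {ξ : ZMod P} :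
    ξ ∈ majSet P N K ↔ IsMaj N K (ZMod.toAddCircle ξ) := by simp [majSet]

/-- A major ξ satisfies q ξ = aP + r with 1 ≤ q ≤ K, 0 ≤ a ≤ K and |r| ≤ 8K, the 8 being P/N². The
triple (q, a, r) determines ξ, which leaves at most 34K³ ≤ K⁴ choices. -/
lemma card_majSet_le {N : ℕ} (hN : 1 ≤ N) (hP : P = 8 * N ^ 2) {K : ℝ} (hK : 100 ≤ K) :
    (#(majSet P N K) : ℝ) ≤ K ^ 4 := by
  have hN0 : (0 : ℝ) < N := by exact_mod_cast hN
  have hP' : (P : ℝ) = 8 * (N : ℝ) ^ 2 := by exact_mod_cast hP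
  have hP0 : (0 : ℝ) < P := by rw [hP']; positivity
  have hex : ∀ ξ ∈ majSet P N K, ∃ t : ℤ × ℤ × ℤ,
      t ∈ Icc (1 : ℤ) ⌊K⌋ ×ˢ Icc (0 : ℤ) ⌊K⌋ ×ˢ Icc (-⌊8 * K⌋) ⌊8 * K⌋ ∧
        t.1 * ξ.val = t.2.1 * P + t.2.2 := by
    intro ξ hξ
    obtain ⟨q, h1, h2, h3⟩ := mem_majSet.1 hξ
    have hv : (ξ.val : ℝ) < P := by exact_mod_cast ξ.val_lt
    have hq : q • (ZMod.toAddCircle ξ) = ((q * ξ.val / P : ℝ) : UnitAddCircle) := by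
      rw [ZMod.toAddCircle_apply, ← AddCircle.coe_nsmul, nsmul_eq_mul, mul_div_assoc]
    rw [hq, UnitAddCircle.norm_eq] at h3
    set a := round (q * ξ.val / P : ℝ) with ha
    have hr : |((q * ξ.val - a * P : ℤ) : ℝ)| ≤ 8 * K := by
      have : ((q * ξ.val - a * P : ℤ) : ℝ) = (q * ξ.val / P - a) * P := by
        push_cast; field_simp
      rw [this, abs_mul, abs_of_pos hP0]
      calc |(q * ξ.val / P : ℝ) - a| * P ≤ K / (N : ℝ) ^ 2 * P := by gcongr
        _ = 8 * K := by rw [hP']; field_simp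
    have ha0 : 0 ≤ a := by
      have : (0 : ℝ) ≤ q * ξ.val / P := by positivity
      rw [ha, round_eq]
      exact Int.floor_nonneg.2 (by linarith)
    have haq : a ≤ q := by
      have h4 : (q * ξ.val / P : ℝ) ≤ q := by
        rw [div_le_iff₀ hP0]; gcongr
      rw [ha, round_eq, ← Int.lt_add_one_iff]
      refine Int.floor_lt.2 ?_
      push_cast
      linarith
    have hqK : (q : ℤ) ≤ ⌊K⌋ := Int.le_floor.2 (by exact_mod_cast h2)
    refine ⟨(q, a, q * ξ.val - a * P), ?_, by ring⟩
    simp only [mem_product, mem_Icc]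
    rw [abs_le] at hr
    refine ⟨⟨by exact_mod_cast h1, hqK⟩, ⟨ha0, haq.trans hqK⟩, ?_, Int.le_floor.2 hr.2⟩
    have := Int.le_floor.2 (show ((-(q * ξ.val - a * P) : ℤ) : ℝ) ≤ 8 * K by
      push_cast at hr ⊢; linarith)
    linarith
  choose! t ht ht' using hex
  have hle := card_le_card_of_injOn t (fun ξ hξ => ht ξ hξ) (by
    intro ξ hξ ξ' hξ' heq
    have e1 := ht' ξ hξ
    have e2 := ht' ξ' hξ'
    rw [heq] at e1
    rw [← e1] at e2
    have hpos : (t ξ').1 ≠ 0 := by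
      have := (mem_Icc.1 (mem_product.1 (ht ξ' hξ')).1).1
      omega
    have := mul_left_cancel₀ hpos e2
    exact (ZMod.val_injective P (by exact_mod_cast this)).symm)
  rw [card_product, card_product, Int.card_Icc, Int.card_Icc, Int.card_Icc] at hle
  have f1 : (0 : ℤ) ≤ ⌊K⌋ := Int.floor_nonneg.2 (by linarith)
  have f2 : (0 : ℤ) ≤ ⌊8 * K⌋ := Int.floor_nonneg.2 (by linarith)
  have g1 : ((⌊K⌋ : ℤ) : ℝ) ≤ K := Int.floor_le K
  have g2 : ((⌊8 * K⌋ : ℤ) : ℝ) ≤ 8 * K := Int.floor_le _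
  have c1 : ((⌊K⌋ + 1 - 1).toNat : ℝ) ≤ K := by
    have : (((⌊K⌋ + 1 - 1).toNat : ℤ) : ℝ) = (⌊K⌋ : ℝ) := by
      rw [Int.toNat_of_nonneg (by omega)]; push_cast; ring
    rw [← Int.cast_natCast, this]; exact g1
  have c2 : ((⌊K⌋ + 1 - 0).toNat : ℝ) ≤ 2 * K := by
    have : (((⌊K⌋ + 1 - 0).toNat : ℤ) : ℝ) = (⌊K⌋ : ℝ) + 1 := by
      rw [Int.toNat_of_nonneg (by omega)]; push_cast; ring
    rw [← Int.cast_natCast, this]; linarith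
  have c3 : ((⌊8 * K⌋ + 1 - -⌊8 * K⌋).toNat : ℝ) ≤ 17 * K := by
    have : (((⌊8 * K⌋ + 1 - -⌊8 * K⌋).toNat : ℤ) : ℝ) = 2 * (⌊8 * K⌋ : ℝ) + 1 := by
      rw [Int.toNat_of_nonneg (by omega)]; push_cast; ring
    rw [← Int.cast_natCast, this]; linarith
  calc (#(majSet P N K) : ℝ) ≤ K * (2 * K * (17 * K)) := by
        refine (Nat.cast_le.2 hle).trans ?_
        push_cast
        gcongr
    _ = 34 * K ^ 3 := by ring
    _ ≤ K * K ^ 3 := by gcongr; linarith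
    _ = K ^ 4 := by ring

end Major

/-! ### Cauchy–Schwarz in two variables -/

section CauchySchwarz
variable {S I J : Type*} [Fintype S] [Fintype I] [Fintype J]

/-- Cauchy-Schwarz: an outer bounded weight is removed. -/
lemma norm_expect_mul_sq_le (b : S → ℂ) (hb : ∀ s, ‖b s‖ ≤ 1) (X : S → ℂ) :
    ‖𝔼 s, b s * X s‖ ^ 2 ≤ 𝔼 s, ‖X s‖ ^ 2 := by
  refine (norm_expect_sq_le _).trans (expect_mono fun s => ?_)
  rw [norm_mul]
  have := hb s
  gcongr
  nlinarith [norm_nonneg (X s), norm_nonneg (b s)]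

/-- Gowers-Cauchy-Schwarz in two variables. -/
lemma gowers_cauchySchwarz_two (X : S → I → J → ℂ) (b : S → J → ℂ) (c : S → I → ℂ)
    (hb : ∀ s j, ‖b s j‖ ≤ 1) (hc : ∀ s i, ‖c s i‖ ≤ 1) :
    ‖𝔼 s, 𝔼 i, 𝔼 j, b s j * c s i * X s i j‖ ^ 4 ≤
      𝔼 s, 𝔼 j, 𝔼 j', ‖𝔼 i, X s i j * conj (X s i j')‖ ^ 2 := by
  have h1 : ‖𝔼 s, 𝔼 i, 𝔼 j, b s j * c s i * X s i j‖ ^ 2 ≤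
      𝔼 s, 𝔼 i, ‖𝔼 j, b s j * X s i j‖ ^ 2 := by
    refine (norm_expect_sq_le _).trans (expect_mono fun s => ?_)
    have : ∀ i, 𝔼 j, b s j * c s i * X s i j = c s i * 𝔼 j, b s j * X s i j := fun i => by
      rw [mul_expect]; exact expect_congr rfl fun j _ => by ring
    simp only [this]
    exact norm_expect_mul_sq_le _ (hc s) _
  have h2 : ((𝔼 s, 𝔼 i, ‖𝔼 j, b s j * X s i j‖ ^ 2 : ℝ) : ℂ) =
      𝔼 s, 𝔼 j, 𝔼 j', (b s j * conj (b s j')) * 𝔼 i, X s i j * conj (X s i j') := by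
    simp only [ofReal_expect, normSq_expect, mul_expect]
    refine expect_congr rfl fun s _ => ?_
    rw [expect_comm]
    refine expect_congr rfl fun j _ => ?_
    rw [expect_comm]
    refine expect_congr rfl fun j' _ => expect_congr rfl fun i _ => ?_
    rw [map_mul]; ring
  have h0 : 0 ≤ 𝔼 s, 𝔼 i, ‖𝔼 j, b s j * X s i j‖ ^ 2 :=
    expect_nonneg fun _ _ => expect_nonneg fun _ _ => sq_nonneg _
  have h3 : (𝔼 s, 𝔼 i, ‖𝔼 j, b s j * X s i j‖ ^ 2) ^ 2 ≤
      𝔼 s, 𝔼 j, 𝔼 j', ‖𝔼 i, X s i j * conj (X s i j')‖ ^ 2 := by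
    rw [← Complex.norm_of_nonneg h0, h2]
    refine (norm_expect_sq_le _).trans (expect_mono fun s => ?_)
    refine (norm_expect_sq_le _).trans (expect_mono fun j => ?_)
    refine norm_expect_mul_sq_le _ (fun j' => ?_) _
    rw [norm_mul, RCLike.norm_conj]
    exact mul_le_one₀ (hb s j) (norm_nonneg _) (hb s j')
  calc ‖𝔼 s, 𝔼 i, 𝔼 j, b s j * c s i * X s i j‖ ^ 4
      = (‖𝔼 s, 𝔼 i, 𝔼 j, b s j * c s i * X s i j‖ ^ 2) ^ 2 := by ring
    _ ≤ (𝔼 s, 𝔼 i, ‖𝔼 j, b s j * X s i j‖ ^ 2) ^ 2 := by gcongr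
    _ ≤ _ := h3

end CauchySchwarz

/-! ### Box norms and Cauchy–Schwarz in three variables -/

section Box
variable {P : ℕ} [NeZero P] {α β γ : Type*} [Fintype α] [Fintype β] [Fintype γ]

/-- The two-dimensional box norm (to the fourth power) of `g` along `A` and `B`. -/
noncomputable def box4 (A : α → ZMod P) (B : β → ZMod P) (g : ZMod P → ℂ) : ℝ :=
  𝔼 y, 𝔼 b, 𝔼 b', ‖𝔼 a, g (y + A a + B b) * conj (g (y + A a + B b'))‖ ^ 2

/-- The multiplicative derivative of `F` between the shifts `u` and `v`. -/
noncomputable def der (F : ZMod P → ℂ) (u v : ZMod P) (y : ZMod P) : ℂ :=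
  F (y + u) * conj (F (y + v))

/-- The three-dimensional box norm (to the eighth power) of `F` along `A`, `B` and `C`. -/
noncomputable def box8 (A : α → ZMod P) (B : β → ZMod P) (C : γ → ZMod P) (F : ZMod P → ℂ) : ℝ :=
  𝔼 c, 𝔼 c', box4 A B (der F (C c) (C c'))

lemma norm_der_le_one {P : ℕ} {F : ZMod P → ℂ} (hF : ∀ y, ‖F y‖ ≤ 1) (u v y : ZMod P) :
    ‖der F u v y‖ ≤ 1 := by
  rw [der, norm_mul, RCLike.norm_conj]
  exact mul_le_one₀ (hF _) (norm_nonneg _) (hF _)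

lemma box4_nonneg (A : α → ZMod P) (B : β → ZMod P) (g : ZMod P → ℂ) : 0 ≤ box4 A B g :=
  expect_nonneg fun _ _ => expect_nonneg fun _ _ => expect_nonneg fun _ _ => sq_nonneg _

lemma box4_le_one (A : α → ZMod P) (B : β → ZMod P) {g : ZMod P → ℂ} (hg : ∀ y, ‖g y‖ ≤ 1) :
    box4 A B g ≤ 1 := by
  refine expect_le_of_le _ zero_le_one fun y => expect_le_of_le _ zero_le_one fun b =>
    expect_le_of_le _ zero_le_one fun b' => norm_sq_le_one (norm_expect_le_one _ fun a => ?_)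
  rw [norm_mul, RCLike.norm_conj]
  exact mul_le_one₀ (hg _) (norm_nonneg _) (hg _)

lemma box8_nonneg (A : α → ZMod P) (B : β → ZMod P) (C : γ → ZMod P) (F : ZMod P → ℂ) :
    0 ≤ box8 A B C F :=
  expect_nonneg fun _ _ => expect_nonneg fun _ _ => box4_nonneg _ _ _

lemma box8_le_one (A : α → ZMod P) (B : β → ZMod P) (C : γ → ZMod P) {F : ZMod P → ℂ}
    (hF : ∀ y, ‖F y‖ ≤ 1) : box8 A B C F ≤ 1 :=
  expect_le_of_le _ zero_le_one fun _ => expect_le_of_le _ zero_le_one fun _ =>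
    box4_le_one _ _ (norm_der_le_one hF _ _)

/-- Gowers-Cauchy-Schwarz in three variables. -/
lemma gowers_cauchySchwarz_three (A : α → ZMod P) (B : β → ZMod P) (C : γ → ZMod P)
    (F : ZMod P → ℂ) (p : ZMod P → β → γ → ℂ) (q : ZMod P → α → γ → ℂ) (r : ZMod P → α → β → ℂ)
    (hp : ∀ y b c, ‖p y b c‖ ≤ 1) (hq : ∀ y a c, ‖q y a c‖ ≤ 1) (hr : ∀ y a b, ‖r y a b‖ ≤ 1) :
    ‖𝔼 y, 𝔼 a, 𝔼 b, 𝔼 c, F (y + A a + B b + C c) * (p y b c * q y a c * r y a b)‖ ^ 8 ≤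
      box8 A B C F := by
  have h1 : ‖𝔼 y, 𝔼 a, 𝔼 b, 𝔼 c, F (y + A a + B b + C c) * (p y b c * q y a c * r y a b)‖ ^ 2 ≤
      𝔼 y, 𝔼 a, 𝔼 b, ‖𝔼 c, F (y + A a + B b + C c) * (p y b c * q y a c)‖ ^ 2 := by
    refine (norm_expect_sq_le _).trans (expect_mono fun y => ?_)
    refine (norm_expect_sq_le _).trans (expect_mono fun a => ?_)
    have : ∀ b, 𝔼 c, F (y + A a + B b + C c) * (p y b c * q y a c * r y a b) =
        r y a b * 𝔼 c, F (y + A a + B b + C c) * (p y b c * q y a c) := fun b => by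
      rw [mul_expect]; exact expect_congr rfl fun c _ => by ring
    simp only [this]
    exact norm_expect_mul_sq_le _ (hr y a) _
  have h2 : ((𝔼 y, 𝔼 a, 𝔼 b, ‖𝔼 c, F (y + A a + B b + C c) * (p y b c * q y a c)‖ ^ 2 : ℝ) : ℂ) =
      𝔼 c, 𝔼 c', 𝔼 y, 𝔼 a, 𝔼 b, (p y b c * conj (p y b c')) * (q y a c * conj (q y a c')) *
        der F (C c) (C c') (y + A a + B b) := by
    simp only [ofReal_expect, normSq_expect]
    simp only [expect_comm (univ : Finset β) (univ : Finset γ)]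
    simp only [expect_comm (univ : Finset α) (univ : Finset γ)]
    simp only [expect_comm (univ : Finset (ZMod P)) (univ : Finset γ)]
    refine expect_congr rfl fun c _ => expect_congr rfl fun c' _ => expect_congr rfl fun y _ =>
      expect_congr rfl fun a _ => expect_congr rfl fun b _ => ?_
    rw [der]; simp only [map_mul]; ring
  have h0 : 0 ≤ 𝔼 y, 𝔼 a, 𝔼 b, ‖𝔼 c, F (y + A a + B b + C c) * (p y b c * q y a c)‖ ^ 2 :=
    expect_nonneg fun _ _ => expect_nonneg fun _ _ => expect_nonneg fun _ _ => sq_nonneg _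
  have h3 : (𝔼 y, 𝔼 a, 𝔼 b, ‖𝔼 c, F (y + A a + B b + C c) * (p y b c * q y a c)‖ ^ 2) ^ 4 ≤
      box8 A B C F := by
    rw [← Complex.norm_of_nonneg h0, h2]
    have hj : ‖𝔼 c, 𝔼 c', 𝔼 y, 𝔼 a, 𝔼 b, (p y b c * conj (p y b c')) *
        (q y a c * conj (q y a c')) * der F (C c) (C c') (y + A a + B b)‖ ^ 4 ≤
        𝔼 c, 𝔼 c', ‖𝔼 y, 𝔼 a, 𝔼 b, (p y b c * conj (p y b c')) *
        (q y a c * conj (q y a c')) * der F (C c) (C c') (y + A a + B b)‖ ^ 4 := by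
      refine (pow_le_pow_left₀ (norm_nonneg _) (norm_expect_le_expect _) 4).trans ?_
      refine (pow_expect_le _ (fun _ => norm_nonneg _) 2).trans (expect_mono fun c => ?_)
      refine (pow_le_pow_left₀ (norm_nonneg _) (norm_expect_le_expect _) 4).trans ?_
      exact pow_expect_le _ (fun _ => norm_nonneg _) 2
    -- With c and c' fixed, the surviving weights depend on (y, b) and on (y, a) only, so the
    -- two-variable inequality applies to the derivative in direction C.
    refine hj.trans (expect_mono fun c => expect_mono fun c' => ?_)
    refine gowers_cauchySchwarz_two (fun y a b => der F (C c) (C c') (y + A a + B b))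
      (fun y b => p y b c * conj (p y b c')) (fun y a => q y a c * conj (q y a c')) ?_ ?_
    · intro y b
      rw [norm_mul, RCLike.norm_conj]
      exact mul_le_one₀ (hp _ _ _) (norm_nonneg _) (hp _ _ _)
    · intro y a
      rw [norm_mul, RCLike.norm_conj]
      exact mul_le_one₀ (hq _ _ _) (norm_nonneg _) (hq _ _ _)
  calc _ = (‖𝔼 y, 𝔼 a, 𝔼 b, 𝔼 c, F (y + A a + B b + C c) *
        (p y b c * q y a c * r y a b)‖ ^ 2) ^ 4 := by ring
    _ ≤ _ := by gcongr
    _ ≤ _ := h3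

end Box

/-! ### Concatenation of box norms -/

section Concat
variable {P : ℕ} [NeZero P] {H α β : Type*} [Fintype H] [Fintype α] [Fintype β]

lemma expect_prod' {ι κ M : Type*} [Fintype ι] [Fintype κ] [AddCommMonoid M] [Module ℚ≥0 M]
    (f : ι × κ → M) : 𝔼 p, f p = 𝔼 i, 𝔼 j, f (i, j) :=
  expect_prod fun i j => f (i, j)

/-- The dual function of the two-dimensional box norm; `w = (b, b', a, a')`. -/
noncomputable def boxTerm (A : α → ZMod P) (B : β → ZMod P) (g : ZMod P → ℂ)
    (w : (β × β) × (α × α)) (y : ZMod P) : ℂ :=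
  conj (g (y + (B w.1.2 - B w.1.1))) * conj (g (y + (A w.2.2 - A w.2.1))) *
    g (y + (A w.2.2 - A w.2.1) + (B w.1.2 - B w.1.1))

/-- Expand both squares and translate y so that one of the four factors becomes g(y); the other
three form the dual function. -/
lemma box4_eq (A : α → ZMod P) (B : β → ZMod P) (g : ZMod P → ℂ) :
    (box4 A B g : ℂ) = 𝔼 y, g y * 𝔼 w, boxTerm A B g w y := by
  have h1 : (box4 A B g : ℂ) = 𝔼 b, 𝔼 b', 𝔼 a, 𝔼 a', 𝔼 y,
      g (y + A a + B b) * conj (g (y + A a + B b')) *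
        conj (g (y + A a' + B b) * conj (g (y + A a' + B b'))) := by
    simp only [box4, ofReal_expect, normSq_expect]
    rw [expect_comm]; refine expect_congr rfl fun b _ => ?_
    rw [expect_comm]; refine expect_congr rfl fun b' _ => ?_
    rw [expect_comm]; refine expect_congr rfl fun a _ => ?_
    rw [expect_comm]
  simp only [mul_expect]
  rw [h1]
  symm
  rw [expect_comm, expect_prod', expect_prod']
  refine expect_congr rfl fun b _ => expect_congr rfl fun b' _ => ?_
  rw [expect_prod']
  refine expect_congr rfl fun a _ => expect_congr rfl fun a' _ => ?_
  rw [← expect_translate (fun y => g y * _) (A a + B b)]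
  refine expect_congr rfl fun y _ => ?_
  simp only [boxTerm, map_mul, Complex.conj_conj]
  rw [show y + (A a + B b) + (B b' - B b) = y + A a + B b' by ring,
    show y + (A a + B b) + (A a' - A a) = y + A a' + B b by ring,
    show y + A a' + B b + (B b' - B b) = y + A a' + B b' by ring,
    show y + (A a + B b) = y + A a + B b by ring]
  ring

/-- The rearrangement of variables used for the concatenation of two box norms. -/
def concatEquiv (α β : Type*) : ((β × β) × (α × α)) × ((β × β) × (α × α)) ≃
    (α × β × β) × ((α × α) × (β × α) × β) where
  toFun w := ((w.1.2.2, w.1.1.2, w.2.1.2), ((w.1.2.1, w.2.2.1), (w.1.1.1, w.2.2.2), w.2.1.1))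
  invFun t := (((t.2.2.1.1, t.1.2.1), (t.2.1.1, t.1.1)), ((t.2.2.2, t.1.2.2), (t.2.1.2, t.2.2.1.2)))
  left_inv _ := rfl
  right_inv _ := rfl

/-- The choice of frozen variables is what matters: `u` keeps a' and b' of the first box and b' of
the second, while the other five are grouped into the three directions of the new box norm. -/
lemma expect_concat (X : (β × β) × (α × α) → (β × β) × (α × α) → ℂ) :
    𝔼 w, 𝔼 w', X w w' = 𝔼 u : α × β × β, 𝔼 a : α × α, 𝔼 b : β × α, 𝔼 c : β,
      X ((b.1, u.2.1), (a.1, u.1)) ((c, u.2.2), (a.2, b.2)) := by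
  rw [← expect_prod X, Fintype.expect_equiv (concatEquiv α β) (fun p => X p.1 p.2)
    (fun t => X ((t.2.2.1.1, t.1.2.1), (t.2.1.1, t.1.1))
      ((t.2.2.2, t.1.2.2), (t.2.1.2, t.2.2.1.2))) (fun _ => rfl), expect_prod']
  refine expect_congr rfl fun u _ => ?_
  rw [expect_prod']
  refine expect_congr rfl fun a _ => ?_
  rw [expect_prod']

/-- After translating y by A a₁ + B b₁ + B' c, exactly one of the six factors depends on all of a, b
and c. Each of the other five misses at least one of them, so the three-variable Cauchy–Schwarz
inequality removes it. -/
lemma norm_boxTerm_correlation_le (A A' : α → ZMod P) (B B' : β → ZMod P) {g : ZMod P → ℂ}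
    (hg : ∀ y, ‖g y‖ ≤ 1) :
    ‖𝔼 y, (𝔼 w, boxTerm A B g w y) * conj (𝔼 w, boxTerm A' B' g w y)‖ ^ 8 ≤
      box8 (fun p : α × α => A p.1 - A' p.2) (fun p : β × α => B p.1 + A' p.2) B' g := by
  have h1 : 𝔼 y, (𝔼 w, boxTerm A B g w y) * conj (𝔼 w, boxTerm A' B' g w y) =
      𝔼 u : α × β × β, 𝔼 y, 𝔼 a : α × α, 𝔼 b : β × α, 𝔼 c : β,
        g (y + (A a.1 - A' a.2) + (B b.1 + A' b.2) + B' c) *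
        ((conj (g (y + A u.1 + B b.1 + B' c)) * g (y + A u.1 + B u.2.1 + B' c)) *
          conj (g (y + A a.1 + B u.2.1 + B' c)) *
          (g (y + A a.1 + B b.1 + B' u.2.2) *
            conj (g (y + A a.1 + B b.1 + (A' b.2 - A' a.2) + B' u.2.2)))) := by
    simp only [conj_expect, expect_mul_expect]
    rw [expect_comm]
    simp only [expect_comm (univ : Finset (ZMod P)) (univ : Finset ((β × β) × (α × α)))]
    rw [expect_concat]
    symm
    refine expect_congr rfl fun u _ => ?_
    rw [expect_comm]
    refine expect_congr rfl fun a _ => ?_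
    rw [expect_comm]
    refine expect_congr rfl fun b _ => ?_
    rw [expect_comm]
    refine expect_congr rfl fun c _ => ?_
    symm
    rw [← expect_translate (fun y => boxTerm A B g _ y * _) (A a.1 + B b.1 + B' c)]
    refine expect_congr rfl fun y _ => ?_
    simp only [boxTerm, map_mul, Complex.conj_conj]
    rw [show y + (A a.1 + B b.1 + B' c) + (B u.2.1 - B b.1) = y + A a.1 + B u.2.1 + B' c by ring,
      show y + (A a.1 + B b.1 + B' c) + (A u.1 - A a.1) = y + A u.1 + B b.1 + B' c by ring,
      show y + A u.1 + B b.1 + B' c + (B u.2.1 - B b.1) = y + A u.1 + B u.2.1 + B' c by ring,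
      show y + (A a.1 + B b.1 + B' c) + (B' u.2.2 - B' c) = y + A a.1 + B b.1 + B' u.2.2 by ring,
      show y + (A a.1 + B b.1 + B' c) + (A' b.2 - A' a.2) =
        y + (A a.1 - A' a.2) + (B b.1 + A' b.2) + B' c by ring,
      show y + (A a.1 - A' a.2) + (B b.1 + A' b.2) + B' c + (B' u.2.2 - B' c) =
        y + A a.1 + B b.1 + (A' b.2 - A' a.2) + B' u.2.2 by ring]
    ring
  rw [h1]
  refine (pow_le_pow_left₀ (norm_nonneg _) (norm_expect_le_expect _) 8).trans ?_
  refine (pow_expect_le _ (fun _ => norm_nonneg _) 3).trans ?_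
  refine expect_le_of_le _ (box8_nonneg _ _ _ _) fun u => ?_
  have hg' : ∀ y, ‖conj (g y)‖ ≤ 1 := fun y => by rw [RCLike.norm_conj]; exact hg y
  refine gowers_cauchySchwarz_three (fun p : α × α => A p.1 - A' p.2)
    (fun p : β × α => B p.1 + A' p.2) B' g
    (fun y b c => conj (g (y + A u.1 + B b.1 + B' c)) * g (y + A u.1 + B u.2.1 + B' c))
    (fun y a c => conj (g (y + A a.1 + B u.2.1 + B' c)))
    (fun y a b => g (y + A a.1 + B b.1 + B' u.2.2) *
            conj (g (y + A a.1 + B b.1 + (A' b.2 - A' a.2) + B' u.2.2))) ?_ ?_ ?_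
  · intro y b c
    rw [norm_mul]; exact mul_le_one₀ (hg' _) (norm_nonneg _) (hg _)
  · intro y a c
    exact hg' _
  · intro y b c
    rw [norm_mul]; exact mul_le_one₀ (hg _) (norm_nonneg _) (hg' _)

/-- Concatenation: an average of two-dimensional box norms along directions `A h`, `B h` is
controlled by three-dimensional box norms along sums of independent directions. -/
lemma concatenation (A : H → α → ZMod P) (B : H → β → ZMod P) {g : ZMod P → ℂ}
    (hg : ∀ y, ‖g y‖ ≤ 1) :
    (𝔼 h, box4 (A h) (B h) g) ^ 16 ≤
      𝔼 h, 𝔼 h', box8 (fun p : α × α => A h p.1 - A h' p.2)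
        (fun p : β × α => B h p.1 + A h' p.2) (B h') g := by
  have h0 : 0 ≤ 𝔼 h, box4 (A h) (B h) g := expect_nonneg fun _ _ => box4_nonneg _ _ _
  have h1 : ((𝔼 h, box4 (A h) (B h) g : ℝ) : ℂ) = 𝔼 y, g y * 𝔼 h, 𝔼 w, boxTerm (A h) (B h) g w y := by
    simp only [ofReal_expect, box4_eq]
    rw [expect_comm]
    simp only [mul_expect]
  have h2 : (𝔼 h, box4 (A h) (B h) g) ^ 2 ≤ 𝔼 y, ‖𝔼 h, 𝔼 w, boxTerm (A h) (B h) g w y‖ ^ 2 := by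
    rw [← Complex.norm_of_nonneg h0, h1]
    exact norm_expect_mul_sq_le _ hg _
  have h3 : ((𝔼 y, ‖𝔼 h, 𝔼 w, boxTerm (A h) (B h) g w y‖ ^ 2 : ℝ) : ℂ) =
      𝔼 h, 𝔼 h', 𝔼 y, (𝔼 w, boxTerm (A h) (B h) g w y) *
        conj (𝔼 w, boxTerm (A h') (B h') g w y) := by
    simp only [ofReal_expect, normSq_expect]
    rw [expect_comm]
    refine expect_congr rfl fun h _ => ?_
    rw [expect_comm]
  have h4 : 0 ≤ 𝔼 y, ‖𝔼 h, 𝔼 w, boxTerm (A h) (B h) g w y‖ ^ 2 :=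
    expect_nonneg fun _ _ => sq_nonneg _
  calc (𝔼 h, box4 (A h) (B h) g) ^ 16 = ((𝔼 h, box4 (A h) (B h) g) ^ 2) ^ 8 := by ring
    _ ≤ (𝔼 y, ‖𝔼 h, 𝔼 w, boxTerm (A h) (B h) g w y‖ ^ 2) ^ 8 := by gcongr
    _ ≤ _ := by
      rw [← Complex.norm_of_nonneg h4, h3]
      refine (pow_le_pow_left₀ (norm_nonneg _) (norm_expect_le_expect _) 8).trans ?_
      refine (pow_expect_le _ (fun _ => norm_nonneg _) 3).trans (expect_mono fun h => ?_)
      refine (pow_le_pow_left₀ (norm_nonneg _) (norm_expect_le_expect _) 8).trans ?_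
      refine (pow_expect_le _ (fun _ => norm_nonneg _) 3).trans (expect_mono fun h' => ?_)
      exact norm_boxTerm_correlation_le _ _ _ _ hg

/-- The number of coincidences of `A`, suitably normalised. -/
noncomputable def coincidence (A : α → ZMod P) : ℝ :=
  ∑ θ : ZMod P, ‖𝔼 a, chi (θ * A a)‖ ^ 2

lemma coincidence_nonneg (A : α → ZMod P) : 0 ≤ coincidence A := sum_nonneg fun _ _ => sq_nonneg _

lemma coincidence_eq (A : α → ZMod P) :
    coincidence A = P * 𝔼 a, 𝔼 a', (if A a = A a' then (1 : ℝ) else 0) := by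
  have : ((coincidence A : ℝ) : ℂ) = ((P * 𝔼 a, 𝔼 a', (if A a = A a' then (1 : ℝ) else 0) : ℝ) : ℂ) := by
    rw [coincidence, Complex.ofReal_sum]
    simp only [normSq_expect]
    rw [← expect_sum_comm, Complex.ofReal_mul, Complex.ofReal_natCast, ofReal_expect, mul_expect]
    refine expect_congr rfl fun a _ => ?_
    rw [← expect_sum_comm, ofReal_expect, mul_expect]
    refine expect_congr rfl fun a' _ => ?_
    have : ∀ θ : ZMod P, chi (θ * A a) * conj (chi (θ * A a')) = chi ((A a - A a') * θ) := fun θ => by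
      rw [← chi_neg, ← chi_add]; congr 1; ring
    simp only [this]
    rw [sum_chi_mul]
    by_cases h : A a = A a'
    · simp [h]
    · simp [h, sub_eq_zero]
  exact_mod_cast this

/-- A box norm along spread-out directions is controlled by the largest Fourier coefficient. -/
lemma box4_le_fourier (A : α → ZMod P) (B : β → ZMod P) {g : ZMod P → ℂ} (hg : ∀ y, ‖g y‖ ≤ 1)
    {s : ℝ} (hs : ∀ ξ, ‖fourier g ξ‖ ^ 2 ≤ s) :
    box4 A B g ≤ coincidence A * coincidence B * s := by
  have h1 : box4 A B g = ∑ θ, (𝔼 b, 𝔼 b', ‖fourier (fun y => g (y + B b) * conj (g (y + B b'))) θ‖ ^ 2) *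
      ‖𝔼 a, chi (θ * A a)‖ ^ 2 := by
    have h2 : ∀ b b', 𝔼 y, ‖𝔼 a, g (y + A a + B b) * conj (g (y + A a + B b'))‖ ^ 2 =
        ∑ θ, ‖fourier (fun y => g (y + B b) * conj (g (y + B b'))) θ‖ ^ 2 *
          ‖𝔼 a, chi (θ * A a)‖ ^ 2 := fun b b' =>
      expect_norm_expect_translate_sq (fun y => g (y + B b) * conj (g (y + B b'))) A
    rw [box4, expect_comm]
    simp only [expect_comm (univ : Finset (ZMod P)) (univ : Finset β), h2, expect_sum_comm, expect_mul]
  rw [h1, coincidence, sum_mul, sum_mul]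
  refine sum_le_sum fun θ _ => ?_
  rw [mul_comm, mul_assoc]
  refine mul_le_mul_of_nonneg_left ?_ (sq_nonneg _)
  -- Modulating the second copy of g by θ turns the θ-th Fourier coefficient into a plain
  -- correlation of g with v, and only permutes the Fourier coefficients.
  set v : ZMod P → ℂ := fun y => g y * conj (chi (θ * y)) with hv
  have hv1 : ∀ y, ‖v y‖ ≤ 1 := fun y => by
    rw [hv]; simp only; rw [norm_mul, RCLike.norm_conj, norm_chi, mul_one]; exact hg y
  have hvs : ∀ ξ, ‖fourier v ξ‖ ^ 2 ≤ s := fun ξ => by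
    have : fourier v ξ = fourier g (ξ - θ) := by
      refine expect_congr rfl fun y _ => ?_
      rw [hv]; simp only
      rw [← chi_neg, mul_assoc, ← chi_add]; congr 2; ring
    rw [this]; exact hs _
  have h3 : ∀ b b', ‖fourier (fun y => g (y + B b) * conj (g (y + B b'))) θ‖ ^ 2 =
      ‖𝔼 y, g (y + B b) * conj (v (y + B b'))‖ ^ 2 := by
    intro b b'
    have : 𝔼 y, g (y + B b) * conj (v (y + B b')) =
        chi (θ * B b') * fourier (fun y => g (y + B b) * conj (g (y + B b'))) θ := by
      rw [fourier, mul_expect]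
      refine expect_congr rfl fun y _ => ?_
      rw [hv]; simp only
      rw [map_mul, Complex.conj_conj, mul_add θ, chi_add]; ring
    rw [this, norm_mul, norm_chi, one_mul]
  simp only [h3]
  -- With S everything there is no off-S term, and the kernel sum is exactly the coincidence count
  -- of B.
  refine (expect_expect_norm_sq_le_of_small hg hv1 B hs hvs univ (κ := 0) (by simp)).trans ?_
  rw [max_self, zero_add, mul_comm]
  rfl

end Concat

/-! ### Cauchy–Schwarz and linearisation of the quadratic shifts -/

section PET
variable {P N M : ℕ} [NeZero P]

/-- The class of `(z - x) ^ 2` modulo `P`. -/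
def sqDiff (P : ℕ) (z x : ℤ) : ZMod P := (((z - x) ^ 2 : ℤ) : ZMod P)

/-- The cyclic model of the counting operator. -/
noncomputable def cyclicCount (f₀ f₁ f₂ : Fin N → ZMod P → ℂ) : ℂ :=
  𝔼 x, 𝔼 z, 𝔼 y, f₀ x y * f₁ z y * f₂ x (y + sqDiff P (z : ℕ) (x : ℕ))

/-- The linear map `v ↦ a v` from `{0, …, M - 1}` to `ℤ/P`. -/
def lin (P M : ℕ) (a : ℤ) (v : Fin M) : ZMod P := ((a * (v : ℕ) : ℤ) : ZMod P)

/-- The correlation of `F` and `F'` at the four points attached to `x, x', z, w`. -/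
noncomputable def rectCorr (F F' : ZMod P → ℂ) (x x' z w : ℤ) : ℂ :=
  𝔼 y, F (y + sqDiff P z x) * conj (F' (y + sqDiff P z x')) *
    conj (F (y + sqDiff P w x) * conj (F' (y + sqDiff P w x')))

lemma norm_rectCorr_le_one {F F' : ZMod P → ℂ} (hF : ∀ y, ‖F y‖ ≤ 1) (hF' : ∀ y, ‖F' y‖ ≤ 1)
    (x x' z w : ℤ) : ‖rectCorr F F' x x' z w‖ ≤ 1 := by
  refine norm_expect_le_one _ fun y => ?_
  simp only [norm_mul, RCLike.norm_conj]
  exact mul_le_one₀ (mul_le_one₀ (hF _) (norm_nonneg _) (hF' _)) (by positivity)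
    (mul_le_one₀ (hF _) (norm_nonneg _) (hF' _))

/-- f₀ does not see z and f₁ does not see x, so two applications of Cauchy–Schwarz remove them at
the price of doubling x and z. -/
lemma norm_cyclicCount_pow_four_le {f₀ f₁ F : Fin N → ZMod P → ℂ} (h₀ : ∀ x y, ‖f₀ x y‖ ≤ 1)
    (h₁ : ∀ x y, ‖f₁ x y‖ ≤ 1) :
    ‖cyclicCount f₀ f₁ F‖ ^ 4 ≤
      𝔼 x : Fin N, 𝔼 x' : Fin N, ‖𝔼 z : Fin N, 𝔼 w : Fin N,
        rectCorr (F x) (F x') (x : ℕ) (x' : ℕ) (z : ℕ) (w : ℕ)‖ := by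
  have h1 : cyclicCount f₀ f₁ F = 𝔼 y, 𝔼 z : Fin N, 𝔼 x : Fin N,
      f₀ x y * f₁ z y * F x (y + sqDiff P (z : ℕ) (x : ℕ)) := by
    rw [cyclicCount, expect_comm]
    simp only [expect_comm (univ : Finset (Fin N)) (univ : Finset (ZMod P))]
  rw [h1]
  refine (gowers_cauchySchwarz_two (fun y (z x : Fin N) => F x (y + sqDiff P (z : ℕ) (x : ℕ)))
    (fun y x => f₀ x y) (fun y z => f₁ z y) (fun y x => h₀ x y) (fun y z => h₁ z y)).trans ?_
  rw [expect_comm]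
  simp only [expect_comm (univ : Finset (ZMod P)) (univ : Finset (Fin N))]
  refine expect_mono fun x => expect_mono fun x' => ?_
  rw [← Complex.norm_of_nonneg (expect_nonneg fun i _ => sq_nonneg _ : (0:ℝ) ≤ 𝔼 y,
    ‖𝔼 z : Fin N, F x (y + sqDiff P (z : ℕ) (x : ℕ)) *
      conj (F x' (y + sqDiff P (z : ℕ) (x' : ℕ)))‖ ^ 2)]
  refine le_of_eq (congrArg _ ?_)
  simp only [ofReal_expect, normSq_expect, rectCorr]
  rw [expect_comm]
  simp only [expect_comm (univ : Finset (ZMod P)) (univ : Finset (Fin N))]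

/-- Relative to the corner at (x, z), the other three corners move linearly in the common shift a +
b + c, with slopes 2(w - z), 2(w - z + x - x') and 2(x - x'). Moving y by these slopes times a, b
and c respectively makes each of the three factors independent of one variable. -/
lemma norm_expect_rectCorr_pow_le {F F' : ZMod P → ℂ} (hF : ∀ y, ‖F y‖ ≤ 1)
    (hF' : ∀ y, ‖F' y‖ ≤ 1) (x x' z w : ℤ) :
    ‖𝔼 a : Fin M, 𝔼 b : Fin M, 𝔼 c : Fin M, rectCorr F F' x x'
      (z + (a + b + c : ℕ)) (w + (a + b + c : ℕ))‖ ^ 8 ≤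
      box8 (lin P M (-2 * (w - z))) (lin P M (-2 * (w - z + (x - x'))))
        (lin P M (-2 * (x - x'))) F := by
  have h1 : 𝔼 a : Fin M, 𝔼 b : Fin M, 𝔼 c : Fin M, rectCorr F F' x x'
      (z + (a + b + c : ℕ)) (w + (a + b + c : ℕ)) =
      𝔼 y, 𝔼 a, 𝔼 b, 𝔼 c, F (y + lin P M (-2 * (w - z)) a + lin P M (-2 * (w - z + (x - x'))) b +
        lin P M (-2 * (x - x')) c) *
        (conj (F (y + ((-2 * (x - x') * b + (w - z) * (2 * c + w + z - 2 * x) -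
            2 * (x - x') * c : ℤ) : ZMod P))) *
          F' (y + ((-2 * (w - z) * a + (w - z + (x - x')) * (2 * a + 2 * c + z + w - x - x') -
            2 * (x - x') * c : ℤ) : ZMod P)) *
          conj (F' (y + ((-2 * (w - z) * a - 2 * (w - z + (x - x')) * b +
            (x - x') * (2 * z + 2 * a + 2 * b - x - x') : ℤ) : ZMod P)))) := by
    symm
    rw [expect_comm]
    refine expect_congr rfl fun a _ => ?_
    rw [expect_comm]
    refine expect_congr rfl fun b _ => ?_
    rw [expect_comm]
    refine expect_congr rfl fun c _ => ?_
    rw [rectCorr, ← expect_translate _ (((2 * (w - z) * a + 2 * (w - z + (x - x')) * b +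
      2 * (x - x') * c + (z + (a + b + c : ℕ) - x) ^ 2 : ℤ) : ZMod P))]
    refine expect_congr rfl fun y _ => ?_
    simp only [map_mul, Complex.conj_conj, sqDiff, lin]
    push_cast
    ring_nf
  rw [h1]
  refine gowers_cauchySchwarz_three _ _ _ F _ _ _ ?_ ?_ ?_
  · intro y b c; rw [RCLike.norm_conj]; exact hF _
  · intro y a c; exact hF' _
  · intro y a b; rw [RCLike.norm_conj]; exact hF' _

/-- The first outcome of the van der Corput scheme: control by averaged box norms. -/
lemma le_expect_box8 (hM : 1 ≤ M) {f₀ f₁ F : Fin N → ZMod P → ℂ} (h₀ : ∀ x y, ‖f₀ x y‖ ≤ 1)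
    (h₁ : ∀ x y, ‖f₁ x y‖ ≤ 1) (hF : ∀ x y, ‖F x y‖ ≤ 1) {ε : ℝ} (hε : 0 ≤ ε)
    (h : ε + 12 * M / N ≤ ‖cyclicCount f₀ f₁ F‖ ^ 4) :
    ε ^ 8 ≤ 𝔼 x : Fin N, 𝔼 x' : Fin N, 𝔼 z : Fin N, 𝔼 w : Fin N,
      box8 (lin P M (-2 * ((w : ℕ) - (z : ℕ) : ℤ)))
        (lin P M (-2 * ((w : ℕ) - (z : ℕ) + ((x : ℕ) - (x' : ℕ)) : ℤ)))
        (lin P M (-2 * ((x : ℕ) - (x' : ℕ) : ℤ))) (F x) := by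
  have : Nonempty (Fin M) := ⟨⟨0, hM⟩⟩
  set t : Fin N → Fin N → Fin N → Fin N → ℝ := fun x x' z w =>
    ‖𝔼 a : Fin M, 𝔼 b : Fin M, 𝔼 c : Fin M, rectCorr (F x) (F x') (x : ℕ) (x' : ℕ)
      ((z : ℕ) + (a + b + c : ℕ)) ((w : ℕ) + (a + b + c : ℕ))‖ with ht
  have ht0 : ∀ x x' z w, 0 ≤ t x x' z w := fun _ _ _ _ => norm_nonneg _
  have hshift : ∀ x x' : Fin N, ‖𝔼 z : Fin N, 𝔼 w : Fin N,
      rectCorr (F x) (F x') (x : ℕ) (x' : ℕ) (z : ℕ) (w : ℕ)‖ ≤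
      12 * M / N + 𝔼 z, 𝔼 w, t x x' z w := by
    intro x x'
    set Ψ : ℤ → ℤ → ℂ := rectCorr (F x) (F x') (x : ℕ) (x' : ℕ) with hΨ
    have hΨ1 : ∀ z w, ‖Ψ z w‖ ≤ 1 := norm_rectCorr_le_one (hF x) (hF x') _ _
    -- Shifting z and w by v costs 2v/N each; as a + b + c ≤ 3M, the total cost is 12M/N.
    have hv : ∀ v : ℕ, ‖𝔼 z : Fin N, 𝔼 w : Fin N, Ψ (z : ℕ) (w : ℕ) -
        𝔼 z : Fin N, 𝔼 w : Fin N, Ψ ((z : ℕ) + v) ((w : ℕ) + v)‖ ≤ 4 * v / N := by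
      intro v
      have a1 := norm_expect_sub_expect_shift_le (N := N) (fun z => 𝔼 w : Fin N, Ψ z (w : ℕ))
        (fun z => norm_expect_le_one _ fun w => hΨ1 _ _) v
      have a2 : ‖𝔼 z : Fin N, 𝔼 w : Fin N, Ψ ((z : ℕ) + v) (w : ℕ) -
          𝔼 z : Fin N, 𝔼 w : Fin N, Ψ ((z : ℕ) + v) ((w : ℕ) + v)‖ ≤ 2 * v / N := by
        rw [← expect_sub_distrib]
        refine (norm_expect_le_expect _).trans (expect_le_of_le _ (by positivity) fun z => ?_)
        exact norm_expect_sub_expect_shift_le (N := N) (fun w => Ψ ((z : ℕ) + v) w)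
          (fun w => hΨ1 _ _) v
      have a3 := norm_add_le_of_le a1 a2
      rw [sub_add_sub_cancel] at a3
      refine a3.trans (le_of_eq ?_)
      ring
    have hv2 : ‖𝔼 z : Fin N, 𝔼 w : Fin N, Ψ (z : ℕ) (w : ℕ) -
        𝔼 a : Fin M, 𝔼 b : Fin M, 𝔼 c : Fin M, 𝔼 z : Fin N, 𝔼 w : Fin N,
          Ψ ((z : ℕ) + (a + b + c : ℕ)) ((w : ℕ) + (a + b + c : ℕ))‖ ≤ 12 * M / N := by
      have e : 𝔼 z : Fin N, 𝔼 w : Fin N, Ψ (z : ℕ) (w : ℕ) = 𝔼 a : Fin M, 𝔼 b : Fin M,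
          𝔼 c : Fin M, 𝔼 z : Fin N, 𝔼 w : Fin N, Ψ (z : ℕ) (w : ℕ) := by
        simp only [Fintype.expect_const]
      rw [e]
      simp only [← expect_sub_distrib]
      refine (norm_expect_le_expect _).trans (expect_le_of_le _ (by positivity) fun a => ?_)
      refine (norm_expect_le_expect _).trans (expect_le_of_le _ (by positivity) fun b => ?_)
      refine (norm_expect_le_expect _).trans (expect_le_of_le _ (by positivity) fun c => ?_)
      simp only [expect_sub_distrib]
      refine (hv (a + b + c)).trans ?_
      have : ((a + b + c : ℕ) : ℝ) ≤ 3 * M := by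
        have := a.2; have := b.2; have := c.2
        exact_mod_cast (by omega : (a + b + c : ℕ) ≤ 3 * M)
      rw [show (12 * M : ℝ) = 4 * (3 * M) by ring]
      gcongr
    have hv3 : ‖𝔼 a : Fin M, 𝔼 b : Fin M, 𝔼 c : Fin M, 𝔼 z : Fin N, 𝔼 w : Fin N,
          Ψ ((z : ℕ) + (a + b + c : ℕ)) ((w : ℕ) + (a + b + c : ℕ))‖ ≤ 𝔼 z, 𝔼 w, t x x' z w := by
      simp only [expect_comm (univ : Finset (Fin M)) (univ : Finset (Fin N))]
      refine (norm_expect_le_expect _).trans (expect_mono fun z => ?_)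
      exact norm_expect_le_expect _
    have := norm_le_norm_add_norm_sub' (𝔼 z : Fin N, 𝔼 w : Fin N, Ψ (z : ℕ) (w : ℕ))
      (𝔼 a : Fin M, 𝔼 b : Fin M, 𝔼 c : Fin M, 𝔼 z : Fin N, 𝔼 w : Fin N,
          Ψ ((z : ℕ) + (a + b + c : ℕ)) ((w : ℕ) + (a + b + c : ℕ)))
    linarith
  have h2 : ε ≤ 𝔼 x, 𝔼 x', 𝔼 z, 𝔼 w, t x x' z w := by
    have h3 := (norm_cyclicCount_pow_four_le (F := F) h₀ h₁).trans
      (expect_mono fun x => expect_mono fun x' => hshift x x')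
    simp only [expect_add_distrib] at h3
    have h4 : 𝔼 _x : Fin N, 𝔼 _x' : Fin N, (12 * M / N : ℝ) ≤ 12 * M / N :=
      expect_le_of_le _ (by positivity) fun _ => expect_le_of_le _ (by positivity) fun _ => le_rfl
    linarith
  refine (pow_le_pow_left₀ hε h2 8).trans ?_
  refine (pow_expect_le _ (fun x => expect_nonneg fun _ _ => expect_nonneg fun _ _ =>
    expect_nonneg fun _ _ => ht0 _ _ _ _) 3).trans (expect_mono fun x => ?_)
  refine (pow_expect_le _ (fun x' => expect_nonneg fun _ _ =>
    expect_nonneg fun _ _ => ht0 _ _ _ _) 3).trans (expect_mono fun x' => ?_)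
  refine (pow_expect_le _ (fun z => expect_nonneg fun _ _ => ht0 _ _ _ _) 3).trans
    (expect_mono fun z => ?_)
  refine (pow_expect_le _ (fun w => ht0 _ _ _ _) 3).trans (expect_mono fun w => ?_)
  exact norm_expect_rectCorr_pow_le (hF x) (hF x') _ _ _ _

end PET

/-! ### Coincidences of linear forms and rarity of large gcds -/

section Counting
variable {P N M : ℕ} [NeZero P]

lemma card_dvd_add_le (m : ℕ) (s : ℤ) :
    #{w : Fin N | (m : ℤ) ∣ (w : ℕ) + s} ≤ N / m + 1 := by
  rw [← card_range (N / m + 1)]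
  refine card_le_card_of_injOn (fun w => (w : ℕ) / m) ?_ ?_
  · intro w _
    exact mem_coe.2 (mem_range.2 (Nat.lt_succ_of_le (Nat.div_le_div_right w.2.le)))
  · intro w hw w' hw' h
    have h1 := (mem_filter.1 (mem_coe.1 hw)).2
    have h2 := (mem_filter.1 (mem_coe.1 hw')).2
    have h3 : (m : ℤ) ∣ (w : ℕ) - (w' : ℕ) := by
      have := dvd_sub h1 h2
      rwa [add_sub_add_right_eq_sub] at this
    have h4 : (w' : ℕ) ≡ w [MOD m] := (Nat.modEq_iff_dvd).2 h3
    have h5 := Nat.div_add_mod (w : ℕ) m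
    have h6 := Nat.div_add_mod (w' : ℕ) m
    simp only at h
    unfold Nat.ModEq at h4
    ext
    rw [← h5, ← h6, h, h4]

lemma dvd_of_mul_eq_mul {a b c d : ℤ} (hb : b ≠ 0) (h : a * c = b * d) :
    ((b.natAbs / a.natAbs.gcd b.natAbs : ℕ) : ℤ) ∣ c := by
  rw [Int.natCast_dvd]
  have hg : 0 < a.natAbs.gcd b.natAbs := Nat.gcd_pos_of_pos_right _ (Int.natAbs_pos.2 hb)
  have h1 : b.natAbs ∣ a.natAbs * c.natAbs := by
    rw [← Int.natAbs_mul, h, Int.natAbs_mul]; exact dvd_mul_right _ _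
  have hcop := (Nat.coprime_div_gcd_div_gcd hg).symm
  refine hcop.dvd_of_dvd_mul_left ?_
  refine Nat.dvd_of_mul_dvd_mul_right hg ?_
  rw [Nat.div_mul_cancel (Nat.gcd_dvd_right _ _), mul_right_comm,
    Nat.div_mul_cancel (Nat.gcd_dvd_left _ _)]
  exact h1

/-- The size condition lifts a coincidence modulo P to an equation a(p₁' - p₁) = b(p₂ - p₂') in ℤ.
Hence p₁' lies in one residue class modulo b/gcd(a, b), and it determines p₂'. -/
lemma coincidence_lin_le {a b : ℤ} (hb : b ≠ 0) (hab : (|a| + |b|) * M < P) :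
    coincidence (fun p : Fin M × Fin M => lin P M a p.1 + lin P M b p.2) ≤
      P * (((M / (b.natAbs / a.natAbs.gcd b.natAbs) : ℕ) + 1) / (M : ℝ) ^ 2) := by
  set m := b.natAbs / a.natAbs.gcd b.natAbs with hm
  have hg : 0 < a.natAbs.gcd b.natAbs := Nat.gcd_pos_of_pos_right _ (Int.natAbs_pos.2 hb)
  have hm1 : 1 ≤ m := Nat.div_pos (Nat.le_of_dvd (Int.natAbs_pos.2 hb) (Nat.gcd_dvd_right _ _)) hg
  rw [coincidence_eq]
  refine mul_le_mul_of_nonneg_left ?_ (Nat.cast_nonneg _)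
  refine expect_le_of_le _ (by positivity) fun p => ?_
  rw [expect_boole_eq, Fintype.card_prod, Fintype.card_fin]
  have hcast : ((M * M : ℕ) : ℝ) = (M : ℝ) ^ 2 := by push_cast; ring
  rw [hcast]
  gcongr
  have key : ∀ p' : Fin M × Fin M, lin P M a p.1 + lin P M b p.2 = lin P M a p'.1 + lin P M b p'.2 →
      a * ((p'.1 : ℕ) + -(p.1 : ℕ)) = b * ((p.2 : ℕ) - (p'.2 : ℕ)) := by
    intro p' h
    have h1 : (((a * ((p'.1 : ℕ) - (p.1 : ℕ)) + b * ((p'.2 : ℕ) - (p.2 : ℕ)) : ℤ)) : ZMod P) = 0 := by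
      simp only [lin] at h
      push_cast at h ⊢
      linear_combination -h
    rw [ZMod.intCast_zmod_eq_zero_iff_dvd] at h1
    have h2 : |a * ((p'.1 : ℕ) - (p.1 : ℕ) : ℤ) + b * ((p'.2 : ℕ) - (p.2 : ℕ))| < P := by
      refine lt_of_le_of_lt ?_ hab
      refine (abs_add_le _ _).trans ?_
      rw [abs_mul, abs_mul, add_mul]
      have := p.1.2; have := p.2.2; have := p'.1.2; have := p'.2.2
      gcongr <;> rw [abs_le] <;> constructor <;> omega
    have h3 := Int.eq_zero_of_abs_lt_dvd h1 h2
    linear_combination h3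
  have hle : #{p' : Fin M × Fin M | lin P M a p.1 + lin P M b p.2 = lin P M a p'.1 + lin P M b p'.2} ≤
      #{w : Fin M | (m : ℤ) ∣ (w : ℕ) + -(p.1 : ℕ)} := by
    refine card_le_card_of_injOn Prod.fst ?_ ?_
    · intro p' hp'
      have h1 := key p' (mem_filter.1 (mem_coe.1 hp')).2
      exact mem_coe.2 (mem_filter.2 ⟨mem_univ _, dvd_of_mul_eq_mul hb h1⟩)
    · intro p' hp' p'' hp'' h
      have h1 := key p' (mem_filter.1 (mem_coe.1 hp')).2
      have h2 := key p'' (mem_filter.1 (mem_coe.1 hp'')).2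
      rw [h, h2] at h1
      have h3 := mul_left_cancel₀ hb h1
      refine Prod.ext h ?_
      ext
      omega
  exact_mod_cast hle.trans (card_dvd_add_le m _)

lemma expect_dvd_add_le {g : ℕ} (hg : 1 ≤ g) (hgN : g ≤ N) (s : ℤ) :
    𝔼 w : Fin N, (if (g : ℤ) ∣ (w : ℕ) + s then (1 : ℝ) else 0) ≤ 2 / g := by
  have hg0 : (0 : ℝ) < g := by exact_mod_cast hg
  have hN0 : (0 : ℝ) < N := by exact_mod_cast hg.trans hgN
  have hgN' : (g : ℝ) ≤ N := by exact_mod_cast hgN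
  rw [expect_boole_eq, Fintype.card_fin, div_le_div_iff₀ hN0 hg0]
  have h1 : ((N / g : ℕ) : ℝ) ≤ N / g := Nat.cast_div_le
  have h2 : (#{w : Fin N | (g : ℤ) ∣ (w : ℕ) + s} : ℝ) ≤ (N / g : ℕ) + 1 := by
    exact_mod_cast card_dvd_add_le g s
  calc (#{w : Fin N | (g : ℤ) ∣ (w : ℕ) + s} : ℝ) * g ≤ (N / g + 1) * g := by gcongr; linarith
    _ = N + g := by field_simp
    _ ≤ 2 * N := by linarith

/-- For each g > L, the probability that g divides both integers is at most 4/g²; the tail of this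
series is at most 4/L. The condition w' ≠ z bounds the gcd by N. -/
lemma expect_gcd_large_le {L : ℕ} (hL : 1 ≤ L) (s : ℤ) (z : Fin N) :
    𝔼 w : Fin N, 𝔼 w' : Fin N, (if w' ≠ z ∧
      L < ((w : ℕ) + s : ℤ).natAbs.gcd ((w' : ℕ) - (z : ℕ) : ℤ).natAbs then (1 : ℝ) else 0) ≤
        4 / L := by
  have h1 : ∀ w w' : Fin N, (if w' ≠ z ∧
      L < ((w : ℕ) + s : ℤ).natAbs.gcd ((w' : ℕ) - (z : ℕ) : ℤ).natAbs then (1 : ℝ) else 0) ≤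
      ∑ g ∈ Ioc L N, (if (g : ℤ) ∣ (w : ℕ) + s then (1 : ℝ) else 0) *
        (if (g : ℤ) ∣ (w' : ℕ) + -(z : ℕ) then (1 : ℝ) else 0) := by
    intro w w'
    have hnn : ∀ g ∈ Ioc L N, (0 : ℝ) ≤ (if (g : ℤ) ∣ (w : ℕ) + s then (1 : ℝ) else 0) *
        (if (g : ℤ) ∣ (w' : ℕ) + -(z : ℕ) then (1 : ℝ) else 0) := fun g _ => by
      split_ifs <;> norm_num
    split_ifs with h
    · set g := ((w : ℕ) + s : ℤ).natAbs.gcd ((w' : ℕ) - (z : ℕ) : ℤ).natAbs with hg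
      have hgL := h.2
      have hne : ((w' : ℕ) - (z : ℕ) : ℤ).natAbs ≠ 0 := by
        have : (w' : ℕ) ≠ (z : ℕ) := fun h' => h.1 (Fin.ext h')
        omega
      have hgN : g ≤ N := by
        refine (Nat.le_of_dvd (Nat.pos_of_ne_zero hne) (Nat.gcd_dvd_right _ _)).trans ?_
        have := w'.2; have := z.2
        omega
      refine le_trans (le_of_eq ?_) (single_le_sum hnn (mem_Ioc.2 ⟨hgL, hgN⟩))
      have d1 : (g : ℤ) ∣ (w : ℕ) + s := Int.natCast_dvd.2 (Nat.gcd_dvd_left _ _)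
      have d2 : (g : ℤ) ∣ (w' : ℕ) + -(z : ℕ) := Int.natCast_dvd.2 (Nat.gcd_dvd_right _ _)
      rw [if_pos d1, if_pos d2, one_mul]
    · exact sum_nonneg hnn
  refine (expect_mono fun w => expect_mono fun w' => h1 w w').trans ?_
  simp only [expect_sum_comm]
  have h2 : ∀ g ∈ Ioc L N, 𝔼 w : Fin N, 𝔼 w' : Fin N,
      (if (g : ℤ) ∣ (w : ℕ) + s then (1 : ℝ) else 0) *
        (if (g : ℤ) ∣ (w' : ℕ) + -(z : ℕ) then (1 : ℝ) else 0) ≤ 4 * ((g : ℝ) ^ 2)⁻¹ := by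
    intro g hg
    obtain ⟨g1, g2⟩ := mem_Ioc.1 hg
    rw [← expect_mul_expect]
    have a1 := expect_dvd_add_le (by omega : 1 ≤ g) g2 s
    have a2 := expect_dvd_add_le (by omega : 1 ≤ g) g2 (-(z : ℕ))
    have a0 : (0 : ℝ) ≤ 𝔼 w : Fin N, (if (g : ℤ) ∣ (w : ℕ) + -(z : ℕ) then (1 : ℝ) else 0) :=
      expect_nonneg fun _ _ => by split_ifs <;> norm_num
    refine (mul_le_mul a1 a2 a0 (by positivity)).trans (le_of_eq ?_)
    field_simp; norm_num
  refine (sum_le_sum h2).trans ?_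
  rw [← mul_sum]
  rcases le_or_gt L N with hLN | hLN
  · have h3 := sum_Ioc_inv_sq_le_sub (α := ℝ) (k := L) (n := N) (by omega) hLN
    have : (0 : ℝ) ≤ (N : ℝ)⁻¹ := by positivity
    rw [div_eq_mul_inv]
    nlinarith
  · rw [Ioc_eq_empty (by omega), sum_empty, mul_zero]; positivity

lemma expect_close_le {L : ℕ} (hL : 1 ≤ L) (hLN : L ≤ N) (z : Fin N) :
    𝔼 w' : Fin N, (if ((w' : ℕ) - (z : ℕ) : ℤ).natAbs * L < N then (1 : ℝ) else 0) ≤ 3 / L := by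
  have hL0 : (0 : ℝ) < L := by exact_mod_cast hL
  have hN0 : (0 : ℝ) < N := by exact_mod_cast hL.trans hLN
  rw [expect_boole_eq, Fintype.card_fin, div_le_div_iff₀ hN0 hL0]
  have h1 : #{w' : Fin N | ((w' : ℕ) - (z : ℕ) : ℤ).natAbs * L < N} ≤ 2 * (N / L) + 1 := by
    have : #(Icc ((z : ℕ) - (N / L : ℕ) : ℤ) ((z : ℕ) + (N / L : ℕ))) = 2 * (N / L) + 1 := by
      rw [Int.card_Icc]; omega
    rw [← this]
    refine card_le_card_of_injOn (fun w => ((w : ℕ) : ℤ)) ?_ ?_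
    · intro w hw
      have h2 := (mem_filter.1 (mem_coe.1 hw)).2
      have h3 : ((w : ℕ) - (z : ℕ) : ℤ).natAbs ≤ N / L := (Nat.le_div_iff_mul_le hL).2 h2.le
      refine mem_coe.2 (mem_Icc.2 ⟨?_, ?_⟩) <;> simp only <;> omega
    · intro w _ w' _ h
      ext; simpa using h
  have h2 : ((N / L : ℕ) : ℝ) ≤ N / L := Nat.cast_div_le
  have h3 : (#{w' : Fin N | ((w' : ℕ) - (z : ℕ) : ℤ).natAbs * L < N} : ℝ) ≤ 2 * (N / L) + 1 := by
    have : (#{w' : Fin N | ((w' : ℕ) - (z : ℕ) : ℤ).natAbs * L < N} : ℝ) ≤ 2 * (N / L : ℕ) + 1 := by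
      exact_mod_cast h1
    linarith
  have hLN' : (L : ℝ) ≤ N := by exact_mod_cast hLN
  calc _ ≤ (2 * (N / L : ℝ) + 1) * L := by gcongr
    _ = 2 * N + L := by field_simp
    _ ≤ 3 * N := by linarith

end Counting

/-! ### Largest Fourier coefficients of multiplicative derivatives -/

section FourierMax
variable {P : ℕ} [NeZero P]

/-- The largest squared Fourier coefficient of `g`. -/
noncomputable def fmax (g : ZMod P → ℂ) : ℝ :=
  univ.sup' univ_nonempty fun ξ => ‖fourier g ξ‖ ^ 2

lemma le_fmax (g : ZMod P → ℂ) (ξ : ZMod P) : ‖fourier g ξ‖ ^ 2 ≤ fmax g :=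
  le_sup' (fun ξ => ‖fourier g ξ‖ ^ 2) (mem_univ ξ)

lemma exists_fmax_eq (g : ZMod P → ℂ) : ∃ ξ, fmax g = ‖fourier g ξ‖ ^ 2 := by
  obtain ⟨ξ, -, h⟩ := exists_mem_eq_sup' (univ_nonempty (α := ZMod P)) fun ξ => ‖fourier g ξ‖ ^ 2
  exact ⟨ξ, h⟩

lemma fmax_nonneg (g : ZMod P → ℂ) : 0 ≤ fmax g := (sq_nonneg _).trans (le_fmax g 0)

lemma fmax_translate (g : ZMod P → ℂ) (t : ZMod P) : fmax (fun y => g (y + t)) = fmax g := by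
  unfold fmax
  congr 1
  ext ξ
  rw [fourier_translate, norm_mul, norm_chi, mul_one]

/-- Translations do not change Fourier moduli, so only the differences of the shifts matter. -/
lemma fmax_der_der (F : ZMod P → ℂ) (u v s t : ZMod P) :
    fmax (der (der F u v) s t) = fmax (der (der F 0 (v - u)) 0 (t - s)) := by
  rw [← fmax_translate _ (-(u + s))]
  congr 1
  ext y
  simp only [der, map_mul, Complex.conj_conj]
  congr 3 <;> ring_nf

end FourierMax

/-! ### From averaged box norms to Fourier coefficients of second differences -/

section PETFinal
variable {P N M : ℕ} [NeZero P]

/-- Since |b| ≥ N/L and the gcd is at most L, the modulus b/gcd is at least N/L² ≥ M. A residue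
class then meets a window of length M at most twice, and 16 = 2·8 with 8 = P/N². -/
lemma coincidence_lin_le_of_gcd_le (hN : 1 ≤ N) (hP : P = 8 * N ^ 2) {L : ℕ} (hM : 1 ≤ M) (hL : 2 ≤ L)
    (hML : M * L ^ 2 ≤ N) {a b : ℤ} (ha : |a| ≤ 2 * N) (hb : |b| ≤ N) (hbL : N ≤ b.natAbs * L)
    (hg : a.natAbs.gcd b.natAbs ≤ L) :
    coincidence (fun p : Fin M × Fin M => lin P M (-2 * a) p.1 + lin P M (2 * b) p.2) ≤
      16 * (N / M : ℝ) ^ 2 := by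
  have hb0 : b ≠ 0 := by rintro rfl; simp at hbL; omega
  have hM2 : 4 * M ≤ N := by
    have : 2 ^ 2 ≤ L ^ 2 := Nat.pow_le_pow_left hL 2
    nlinarith
  have h1 := coincidence_lin_le (P := P) (M := M) (a := -2 * a) (b := 2 * b) (by omega) (by
    rw [abs_mul, abs_mul, hP]
    push_cast
    norm_num
    have h4 : (4 * M : ℤ) ≤ N := by exact_mod_cast hM2
    have h5 : (1 : ℤ) ≤ N := by exact_mod_cast hN
    have h6 : (1 : ℤ) ≤ M := by exact_mod_cast hM
    nlinarith [mul_le_mul_of_nonneg_right (by linarith : 2 * |a| + 2 * |b| ≤ 6 * (N : ℤ))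
      (by linarith : (0 : ℤ) ≤ M)])
  refine h1.trans ?_
  set q := (2 * b).natAbs / (-2 * a).natAbs.gcd (2 * b).natAbs with hq
  have hqe : q = b.natAbs / a.natAbs.gcd b.natAbs := by
    rw [hq, Int.natAbs_mul, Int.natAbs_mul]
    norm_num
    rw [Nat.gcd_mul_left, Nat.mul_div_mul_left _ _ (by norm_num)]
  have hdvd : a.natAbs.gcd b.natAbs ∣ b.natAbs := Nat.gcd_dvd_right _ _
  have hqm : q * a.natAbs.gcd b.natAbs = b.natAbs := by rw [hqe]; exact Nat.div_mul_cancel hdvd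
  have hMq : M ≤ q := by
    have h3 : b.natAbs ≤ q * L := by rw [← hqm]; gcongr
    have h4 : M * L ^ 2 ≤ q * L ^ 2 := by nlinarith
    exact Nat.le_of_mul_le_mul_right h4 (by positivity)
  have h5 : M / q ≤ 1 := by
    rw [Nat.div_le_iff_le_mul_add_pred (by omega)]; omega
  have h6 : ((M / q : ℕ) : ℝ) ≤ 1 := by exact_mod_cast h5
  have hP' : (P : ℝ) = 8 * (N : ℝ) ^ 2 := by exact_mod_cast hP
  have hM0 : (0 : ℝ) < M := by exact_mod_cast hM
  rw [hP']
  calc 8 * (N : ℝ) ^ 2 * (((M / q : ℕ) + 1) / (M : ℝ) ^ 2) ≤ 8 * (N : ℝ) ^ 2 * ((1 + 1) / (M : ℝ) ^ 2) := by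
        gcongr
    _ = _ := by ring

/-- The products `2 (k - 2N) (c - c')`, the differencing parameters of the PET scheme. -/
def shiftParam (P N M : ℕ) (i : Fin (4 * N) × Fin M × Fin M) : ZMod P :=
  ((-2 * ((i.1 : ℕ) - 2 * N) * ((i.2.2 : ℕ) - (i.2.1 : ℕ)) : ℤ) : ZMod P)

/-- For fixed x and z, the pair (x - x', w - z + x - x') determines (x', w) and lies in a box of
side 4N. By positivity the average grows by at most the ratio of volumes, 16. -/
lemma expect_le_sixteen_mul (φ : ℤ → ℤ → ℝ) (hφ : ∀ a b, 0 ≤ φ a b) (x z : Fin N) :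
    𝔼 x' : Fin N, 𝔼 w : Fin N, φ ((x : ℕ) - (x' : ℕ)) ((w : ℕ) - (z : ℕ) + ((x : ℕ) - (x' : ℕ))) ≤
      16 * 𝔼 i : Fin (4 * N), 𝔼 j : Fin (4 * N), φ ((i : ℕ) - 2 * N) ((j : ℕ) - 2 * N) := by
  have hN : 0 < N := x.pos
  have hN0 : (0 : ℝ) < N := by exact_mod_cast hN
  rw [← expect_prod (fun x' w : Fin N => φ ((x : ℕ) - (x' : ℕ)) ((w : ℕ) - (z : ℕ) + ((x : ℕ) - (x' : ℕ)))),
    ← expect_prod (fun i j : Fin (4 * N) => φ ((i : ℕ) - 2 * N) ((j : ℕ) - 2 * N)),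
    Fintype.expect_eq_sum_div_card, Fintype.expect_eq_sum_div_card]
  simp only [Fintype.card_prod, Fintype.card_fin]
  set S := ∑ p : Fin N × Fin N, φ ((x : ℕ) - (p.1 : ℕ)) ((p.2 : ℕ) - (z : ℕ) + ((x : ℕ) - (p.1 : ℕ))) with hS
  set S' := ∑ p : Fin (4 * N) × Fin (4 * N), φ ((p.1 : ℕ) - 2 * N) ((p.2 : ℕ) - 2 * N) with hS'
  have key : S ≤ S' := by
    let J : Fin N × Fin N → Fin (4 * N) × Fin (4 * N) := fun p =>
      (⟨(x : ℕ) + 2 * N - (p.1 : ℕ), by omega⟩, ⟨(p.2 : ℕ) + (x : ℕ) + 2 * N - (z : ℕ) - (p.1 : ℕ), by omega⟩)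
    have hJ : Function.Injective J := by
      rintro ⟨a, b⟩ ⟨c, d⟩ h
      simp only [J, Prod.mk.injEq, Fin.mk.injEq] at h
      ext <;> simp only <;> omega
    calc S = ∑ p, (fun p : Fin (4 * N) × Fin (4 * N) => φ ((p.1 : ℕ) - 2 * N) ((p.2 : ℕ) - 2 * N)) (J p) := by
          refine sum_congr rfl fun p _ => ?_
          simp only [J]
          congr 1 <;> omega
      _ = ∑ q ∈ univ.map ⟨J, hJ⟩, φ ((q.1 : ℕ) - 2 * N) ((q.2 : ℕ) - 2 * N) := by rw [sum_map]; rfl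
      _ ≤ S' := sum_le_univ_sum_of_nonneg fun _ => hφ _ _
  push_cast
  have : 16 * (S' / (4 * N * (4 * N))) = S' / (N * N) := by field_simp; ring
  rw [this]
  gcongr

/-- A union bound, 3/L + 4/L + 4/L. The case w' = z, excluded from the gcd estimates, is absorbed by
closeness. -/
lemma expect_bad_le {L : ℕ} (hL : 1 ≤ L) (hLN : L ≤ N) (x x' z : Fin N) :
    𝔼 w : Fin N, 𝔼 w' : Fin N, (if (((w' : ℕ) - (z : ℕ) : ℤ).natAbs * L < N ∨
      L < ((w : ℕ) - (z : ℕ) : ℤ).natAbs.gcd ((w' : ℕ) - (z : ℕ) : ℤ).natAbs ∨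
      L < ((w : ℕ) - (z : ℕ) + ((x : ℕ) - (x' : ℕ)) : ℤ).natAbs.gcd
        ((w' : ℕ) - (z : ℕ) : ℤ).natAbs) then (1 : ℝ) else 0) ≤ 11 / L := by
  have a1 := expect_close_le hL hLN z
  have a2 := expect_gcd_large_le (N := N) hL (-(z : ℕ)) z
  have a3 := expect_gcd_large_le (N := N) hL (-(z : ℕ) + ((x : ℕ) - (x' : ℕ))) z
  have : Nonempty (Fin N) := ⟨x⟩
  have key : ∀ w w' : Fin N, (if (((w' : ℕ) - (z : ℕ) : ℤ).natAbs * L < N ∨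
      L < ((w : ℕ) - (z : ℕ) : ℤ).natAbs.gcd ((w' : ℕ) - (z : ℕ) : ℤ).natAbs ∨
      L < ((w : ℕ) - (z : ℕ) + ((x : ℕ) - (x' : ℕ)) : ℤ).natAbs.gcd
        ((w' : ℕ) - (z : ℕ) : ℤ).natAbs) then (1 : ℝ) else 0) ≤
      (if ((w' : ℕ) - (z : ℕ) : ℤ).natAbs * L < N then (1 : ℝ) else 0) +
      (if w' ≠ z ∧ L < ((w : ℕ) + -(z : ℕ) : ℤ).natAbs.gcd ((w' : ℕ) - (z : ℕ) : ℤ).natAbs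
        then (1 : ℝ) else 0) +
      (if w' ≠ z ∧ L < ((w : ℕ) + (-(z : ℕ) + ((x : ℕ) - (x' : ℕ))) : ℤ).natAbs.gcd
        ((w' : ℕ) - (z : ℕ) : ℤ).natAbs then (1 : ℝ) else 0) := by
    intro w w'
    rw [← add_assoc, ← sub_eq_add_neg]
    by_cases hwz : w' = z
    · have : ((w' : ℕ) - (z : ℕ) : ℤ).natAbs * L < N := by rw [hwz]; simp; exact x.pos
      simp only [this, if_true, true_or]
      have : ∀ p : Prop, [Decidable p] → (0 : ℝ) ≤ if p then 1 else 0 := fun p _ => by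
        split_ifs <;> norm_num
      linarith [this (w' ≠ z ∧ L < ((w : ℕ) - (z : ℕ) : ℤ).natAbs.gcd ((w' : ℕ) - (z : ℕ) : ℤ).natAbs),
        this (w' ≠ z ∧ L < ((w : ℕ) - (z : ℕ) + ((x : ℕ) - (x' : ℕ)) : ℤ).natAbs.gcd
        ((w' : ℕ) - (z : ℕ) : ℤ).natAbs)]
    · simp only [ne_eq, hwz, not_false_eq_true, true_and]
      split_ifs <;> first | tauto | norm_num
  refine (expect_mono fun w => expect_mono fun w' => key w w').trans ?_
  simp only [expect_add_distrib]
  have a0 : 𝔼 _w : Fin N, 𝔼 w' : Fin N, (if ((w' : ℕ) - (z : ℕ) : ℤ).natAbs * L < N then (1 : ℝ) else 0)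
    ≤ 3 / L := by rw [Fintype.expect_const]; exact a1
  have : (11 / L : ℝ) = 3 / L + 4 / L + 4 / L := by ring
  rw [this]
  linarith

/-- The direction C does not depend on w, so it is fixed as a derivative while the other two
directions are concatenated over w. For a typical pair (w, w') the new directions are well spread,
so `box4_le_fourier` bounds the inner box norm by a Fourier coefficient. -/
lemma expect_box8_pow_le (hN : 1 ≤ N) (hP : P = 8 * N ^ 2) {L : ℕ} (hM : 1 ≤ M) (hL : 2 ≤ L)
    (hML : M * L ^ 2 ≤ N) {F : ZMod P → ℂ} (hF : ∀ y, ‖F y‖ ≤ 1) (x x' z : Fin N) :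
    (𝔼 w : Fin N, box8 (lin P M (-2 * ((w : ℕ) - (z : ℕ) : ℤ)))
        (lin P M (-2 * ((w : ℕ) - (z : ℕ) + ((x : ℕ) - (x' : ℕ)) : ℤ)))
        (lin P M (-2 * ((x : ℕ) - (x' : ℕ) : ℤ))) F) ^ 16 ≤
      11 / L + (16 * (N / M : ℝ) ^ 2) ^ 2 *
        𝔼 w : Fin N, 𝔼 c : Fin M × Fin M, 𝔼 d : Fin M × Fin M,
          fmax (der (der F 0 ((-2 * ((x : ℕ) - (x' : ℕ)) * ((c.2 : ℕ) - (c.1 : ℕ)) : ℤ) : ZMod P)) 0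
            ((-2 * ((w : ℕ) - (z : ℕ) + ((x : ℕ) - (x' : ℕ))) * ((d.2 : ℕ) - (d.1 : ℕ)) : ℤ) : ZMod P)) := by
  have : Nonempty (Fin N) := ⟨⟨0, hN⟩⟩
  have : Nonempty (Fin M) := ⟨⟨0, hM⟩⟩
  have hLN : L ≤ N := by nlinarith
  set R : ℝ := 16 * (N / M : ℝ) ^ 2 with hR
  have hR0 : 0 ≤ R := by positivity
  set C := lin P M (-2 * ((x : ℕ) - (x' : ℕ) : ℤ)) with hC
  set A : Fin N → Fin M → ZMod P := fun w => lin P M (-2 * ((w : ℕ) - (z : ℕ) : ℤ)) with hA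
  set B : Fin N → Fin M → ZMod P := fun w =>
    lin P M (-2 * ((w : ℕ) - (z : ℕ) + ((x : ℕ) - (x' : ℕ)) : ℤ)) with hB
  have h1 : 𝔼 w : Fin N, box8 (A w) (B w) C F =
      𝔼 c : Fin M, 𝔼 c' : Fin M, 𝔼 w : Fin N, box4 (A w) (B w) (der F (C c) (C c')) := by
    simp only [box8]
    rw [expect_comm]
    refine expect_congr rfl fun c _ => ?_
    rw [expect_comm]
  change (𝔼 w : Fin N, box8 (A w) (B w) C F) ^ 16 ≤ _
  have hb4 : ∀ c c', 0 ≤ 𝔼 w : Fin N, box4 (A w) (B w) (der F (C c) (C c')) := fun c c' =>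
    expect_nonneg fun _ _ => box4_nonneg _ _ _
  have h2 : (𝔼 w : Fin N, box8 (A w) (B w) C F) ^ 16 ≤ 𝔼 c : Fin M, 𝔼 c' : Fin M,
      (𝔼 w : Fin N, box4 (A w) (B w) (der F (C c) (C c'))) ^ 16 := by
    rw [h1]
    refine (pow_expect_le _ (fun c => expect_nonneg fun c' _ => hb4 c c') 4).trans
      (expect_mono fun c => ?_)
    exact pow_expect_le _ (fun c' => hb4 c c') 4
  refine h2.trans ?_
  set bad : Fin N → Fin N → Prop := fun w w' => (((w' : ℕ) - (z : ℕ) : ℤ).natAbs * L < N ∨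
      L < ((w : ℕ) - (z : ℕ) : ℤ).natAbs.gcd ((w' : ℕ) - (z : ℕ) : ℤ).natAbs ∨
      L < ((w : ℕ) - (z : ℕ) + ((x : ℕ) - (x' : ℕ)) : ℤ).natAbs.gcd
        ((w' : ℕ) - (z : ℕ) : ℤ).natAbs) with hbad
  classical
  -- Bad pairs are charged the trivial bound 1. For good pairs both concatenated directions have
  -- coincidence count at most R, and B w' remains as the second derivative.
  have h3 : ∀ (c c' : Fin M) (w w' : Fin N),
      box8 (fun p : Fin M × Fin M => A w p.1 - A w' p.2) (fun p : Fin M × Fin M => B w p.1 + A w' p.2)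
        (B w') (der F (C c) (C c')) ≤ (if bad w w' then (1 : ℝ) else 0) +
        R ^ 2 * 𝔼 d : Fin M, 𝔼 d' : Fin M, fmax (der (der F (C c) (C c')) (B w' d) (B w' d')) := by
    intro c c' w w'
    have hD : ∀ y, ‖der F (C c) (C c') y‖ ≤ 1 := norm_der_le_one hF _ _
    have hnn : 0 ≤ 𝔼 d : Fin M, 𝔼 d' : Fin M, fmax (der (der F (C c) (C c')) (B w' d) (B w' d')) :=
      expect_nonneg fun _ _ => expect_nonneg fun _ _ => fmax_nonneg _
    split_ifs with h
    · have := box8_le_one (fun p : Fin M × Fin M => A w p.1 - A w' p.2)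
        (fun p : Fin M × Fin M => B w p.1 + A w' p.2) (B w') hD
      have : 0 ≤ R ^ 2 * 𝔼 d : Fin M, 𝔼 d' : Fin M,
        fmax (der (der F (C c) (C c')) (B w' d) (B w' d')) := by positivity
      linarith
    · rw [zero_add, box8]
      simp only [hbad, not_or, not_lt] at h
      obtain ⟨g1, g2, g3⟩ := h
      have x2 := x.2; have x'2 := x'.2; have z2 := z.2; have w2 := w.2; have w'2 := w'.2
      have hA' : coincidence (fun p : Fin M × Fin M => A w p.1 - A w' p.2) ≤ R := by
        have := coincidence_lin_le_of_gcd_le (P := P) hN hP hM hL hML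
          (a := (w : ℕ) - (z : ℕ)) (b := (w' : ℕ) - (z : ℕ)) (by rw [abs_le]; omega)
          (by rw [abs_le]; omega) g1 g2
        convert this using 2
        ext p
        simp only [hA, lin]
        push_cast
        ring
      have hB' : coincidence (fun p : Fin M × Fin M => B w p.1 + A w' p.2) ≤ R := by
        have := coincidence_lin_le_of_gcd_le (P := P) hN hP hM hL hML
          (a := (w : ℕ) - (z : ℕ) + ((x : ℕ) - (x' : ℕ))) (b := -((w' : ℕ) - (z : ℕ)))
          (by rw [abs_le]; omega) (by rw [abs_le]; omega) (by rwa [Int.natAbs_neg])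
          (by rwa [Int.natAbs_neg])
        convert this using 2
        ext p
        simp only [hA, hB, lin]
        push_cast
        ring
      simp only [mul_expect]
      refine expect_mono fun d => expect_mono fun d' => ?_
      refine (box4_le_fourier _ _ (norm_der_le_one hD _ _) (le_fmax _)).trans ?_
      refine mul_le_mul_of_nonneg_right ?_ (fmax_nonneg _)
      rw [sq]
      exact mul_le_mul hA' hB' (coincidence_nonneg _) hR0
  have h4 : ∀ c c' : Fin M, (𝔼 w : Fin N, box4 (A w) (B w) (der F (C c) (C c'))) ^ 16 ≤
      11 / L + R ^ 2 * 𝔼 w' : Fin N, 𝔼 d : Fin M, 𝔼 d' : Fin M,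
        fmax (der (der F (C c) (C c')) (B w' d) (B w' d')) := by
    intro c c'
    refine (concatenation A B (norm_der_le_one hF (C c) (C c'))).trans ?_
    refine (expect_mono fun w => expect_mono fun w' => h3 c c' w w').trans ?_
    simp only [expect_add_distrib, ← mul_expect, Fintype.expect_const]
    gcongr
    exact expect_bad_le (by omega) hLN x x' z
  refine (expect_mono fun c => expect_mono fun c' => h4 c c').trans (le_of_eq ?_)
  simp only [expect_add_distrib, ← mul_expect, Fintype.expect_const]
  congr 2
  symm
  rw [expect_comm, expect_prod']
  refine expect_congr rfl fun c _ => expect_congr rfl fun c' _ => expect_congr rfl fun w _ => ?_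
  rw [expect_prod']
  refine expect_congr rfl fun d _ => expect_congr rfl fun d' _ => ?_
  rw [fmax_der_der F (C c) (C c')]
  simp only [hC, hB, lin]
  congr 3
  all_goals push_cast; ring

/-- The conclusion of PET induction and concatenation. -/
lemma le_expect_fmax_der_der (hN : 1 ≤ N) (hP : P = 8 * N ^ 2) {L : ℕ} (hM : 1 ≤ M) (hL : 2 ≤ L)
    (hML : M * L ^ 2 ≤ N) {f₀ f₁ F : Fin N → ZMod P → ℂ} (h₀ : ∀ x y, ‖f₀ x y‖ ≤ 1)
    (h₁ : ∀ x y, ‖f₁ x y‖ ≤ 1) (hF : ∀ x y, ‖F x y‖ ≤ 1) {ε : ℝ} (hε : 0 ≤ ε)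
    (h : ε + 12 * M / N ≤ ‖cyclicCount f₀ f₁ F‖ ^ 4) :
    ε ^ 128 ≤ 11 / L + 4096 * (N / M : ℝ) ^ 4 * 𝔼 x, 𝔼 i, 𝔼 j,
      fmax (der (der (F x) 0 (shiftParam P N M i)) 0 (shiftParam P N M j)) := by
  have : Nonempty (Fin N) := ⟨⟨0, hN⟩⟩
  have h1 := le_expect_box8 hM h₀ h₁ hF hε h
  have hnn : ∀ x x' z : Fin N, 0 ≤ 𝔼 w : Fin N, box8 (lin P M (-2 * ((w : ℕ) - (z : ℕ) : ℤ)))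
        (lin P M (-2 * ((w : ℕ) - (z : ℕ) + ((x : ℕ) - (x' : ℕ)) : ℤ)))
        (lin P M (-2 * ((x : ℕ) - (x' : ℕ) : ℤ))) (F x) := fun x x' z =>
    expect_nonneg fun _ _ => box8_nonneg _ _ _ _
  calc ε ^ 128 = (ε ^ 8) ^ 16 := by ring
    _ ≤ _ := pow_le_pow_left₀ (by positivity) h1 16
    _ ≤ _ := pow_expect_le _ (fun x => expect_nonneg fun x' _ => expect_nonneg fun z _ => hnn x x' z) 4
    _ ≤ 11 / L + 4096 * (N / M : ℝ) ^ 4 * 𝔼 x, 𝔼 i, 𝔼 j,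
      fmax (der (der (F x) 0 (shiftParam P N M i)) 0 (shiftParam P N M j)) := ?_
  rw [mul_expect]
  have hc : (11 / L : ℝ) = 𝔼 _x : Fin N, (11 / L : ℝ) := by rw [Fintype.expect_const]
  rw [hc, ← expect_add_distrib]
  refine expect_mono fun x => ?_
  refine (pow_expect_le _ (fun x' => expect_nonneg fun z _ => hnn x x' z) 4).trans ?_
  refine (expect_mono fun x' => pow_expect_le _ (fun z => hnn x x' z) 4).trans ?_
  refine (expect_mono fun x' => expect_mono fun z =>
    expect_box8_pow_le hN hP hM hL hML (hF x) x x' z).trans ?_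
  simp only [expect_add_distrib, ← mul_expect, Fintype.expect_const]
  refine add_le_add le_rfl ?_
  -- The extra factor 16 pays for enlarging the range of directions in `expect_le_sixteen_mul`.
  rw [show 4096 * (N / M : ℝ) ^ 4 = (16 * (N / M : ℝ) ^ 2) ^ 2 * 16 by ring, mul_assoc]
  refine mul_le_mul_of_nonneg_left ?_ (by positivity)
  rw [expect_comm]
  refine expect_le_of_le _ (mul_nonneg (by norm_num) (expect_nonneg fun _ _ => expect_nonneg fun _ _ =>
    fmax_nonneg _)) fun z => ?_
  refine (expect_le_sixteen_mul (fun k u => 𝔼 c : Fin M × Fin M, 𝔼 d : Fin M × Fin M,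
      fmax (der (der (F x) 0 ((-2 * k * ((c.2 : ℕ) - (c.1 : ℕ)) : ℤ) : ZMod P)) 0
      ((-2 * u * ((d.2 : ℕ) - (d.1 : ℕ)) : ℤ) : ZMod P)))
      (fun _ _ => expect_nonneg fun _ _ => expect_nonneg fun _ _ => fmax_nonneg _) x z).trans
    (le_of_eq ?_)
  congr 1
  symm
  rw [expect_prod']
  refine expect_congr rfl fun i _ => ?_
  symm
  rw [expect_comm]
  refine expect_congr rfl fun c _ => ?_
  rw [expect_prod']
  rfl

end PETFinal

/-! ### Quadratic phases with varying frequency -/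

section MajorArc
variable {P N : ℕ} [NeZero P]

/-- Pigeonhole: a large set whose elements have boundedly many labels has a large label class. -/
lemma exists_large_fiber {ι κ : Type*} [Fintype ι] [DecidableEq κ] (S : Finset κ) (f : ι → κ)
    (p : ι → Prop) [DecidablePred p] (hp : ∀ i, p i → f i ∈ S) {ρ K : ℝ} (hρ : 0 < ρ) (hK : 0 < K)
    (hS : (#S : ℝ) ≤ K) (h : ρ ≤ 𝔼 i, (if p i then (1 : ℝ) else 0)) :
    ∃ s ∈ S, ρ / K ≤ 𝔼 i, (if p i ∧ f i = s then (1 : ℝ) else 0) := by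
  by_contra! hcon
  have h1 : 𝔼 i, (if p i then (1 : ℝ) else 0) = ∑ s ∈ S, 𝔼 i, (if p i ∧ f i = s then (1 : ℝ) else 0) := by
    rw [← expect_sum_comm]
    refine expect_congr rfl fun i _ => ?_
    split_ifs with hi
    · simp [hi, hp i hi]
    · simp [hi]
  rcases S.eq_empty_or_nonempty with rfl | hne
  · rw [h1, sum_empty] at h; linarith
  · have h2 := sum_lt_sum_of_nonempty hne hcon
    rw [← h1, sum_const, nsmul_eq_mul] at h2
    have h3 : (#S : ℝ) * (ρ / K) ≤ K * (ρ / K) := by gcongr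
    rw [mul_div_cancel₀ _ hK.ne'] at h3
    linarith

lemma ite_one_zero_le_ite {p q : Prop} [Decidable p] [Decidable q] (h : p → q) :
    (if p then (1 : ℝ) else 0) ≤ if q then 1 else 0 := by
  by_cases hp : p
  · simp [hp, h hp]
  · simp only [hp, if_false]; split_ifs <;> norm_num

lemma chi_mul_intCast (ξ : ZMod P) (n : ℤ) : chi (ξ * (n : ZMod P)) = e (n • ZMod.toAddCircle ξ) := by
  rw [chi, ← map_zsmul, zsmul_eq_mul, mul_comm]

/-- One extra power of T ≥ 100 absorbs the numerical constant. -/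
lemma inv_pow_le_of_mul_le {T a : ℝ} {m n : ℕ} (hT : 100 ≤ T) (h : 1 / T ^ m ≤ 100 * T ^ n * a) :
    1 / T ^ (m + n + 1) ≤ a := by
  have hT0 : 0 < T := by linarith
  have ha : 0 ≤ a := by
    by_contra! ha
    have : 100 * T ^ n * a ≤ 0 := mul_nonpos_of_nonneg_of_nonpos (by positivity) ha.le
    have : 0 < 1 / T ^ m := by positivity
    linarith
  rw [div_le_iff₀ (by positivity)]
  rw [div_le_iff₀ (by positivity)] at h
  have : 100 * T ^ n * a * T ^ m ≤ T * T ^ n * a * T ^ m := by gcongr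
  calc 1 ≤ T * T ^ n * a * T ^ m := h.trans this
    _ = a * T ^ (m + n + 1) := by ring

/-- Cauchy–Schwarz over (z, y) removes g and doubles x. In the expanded square the z-average does
not involve y, so everything depending on y is bounded by 1. -/
lemma sq_norm_expect_phase_le {a g : Fin N → ZMod P → ℂ} (ψ : Fin N → ZMod P) {A : Fin N → Prop}
    [DecidablePred A] (ha : ∀ x y, ‖a x y‖ ≤ 1) (hg : ∀ z y, ‖g z y‖ ≤ 1)
    (hA : ∀ x y, ¬ A x → a x y = 0) :
    ‖𝔼 x, 𝔼 z, 𝔼 y, a x y * g z y * chi (ψ x * (y + sqDiff P (z : ℕ) (x : ℕ)))‖ ^ 2 ≤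
      𝔼 x', 𝔼 x, (if A x then ‖𝔼 z : Fin N, chi (ψ x * sqDiff P (z : ℕ) (x : ℕ)) *
        conj (chi (ψ x' * sqDiff P (z : ℕ) (x' : ℕ)))‖ else 0) := by
  have e1 : 𝔼 x, 𝔼 z, 𝔼 y, a x y * g z y * chi (ψ x * (y + sqDiff P (z : ℕ) (x : ℕ))) =
      𝔼 p : Fin N × ZMod P, g p.1 p.2 *
        𝔼 x, a x p.2 * chi (ψ x * (p.2 + sqDiff P (p.1 : ℕ) (x : ℕ))) := by
    rw [expect_prod', expect_comm]
    refine expect_congr rfl fun z _ => ?_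
    rw [expect_comm]
    refine expect_congr rfl fun y _ => ?_
    rw [mul_expect]
    exact expect_congr rfl fun x _ => by ring
  rw [e1]
  refine (norm_expect_mul_sq_le (fun p : Fin N × ZMod P => g p.1 p.2) (fun p => hg _ _) _).trans ?_
  have e3 : ((𝔼 p : Fin N × ZMod P,
        ‖𝔼 x, a x p.2 * chi (ψ x * (p.2 + sqDiff P (p.1 : ℕ) (x : ℕ)))‖ ^ 2 : ℝ) : ℂ)
      = 𝔼 x, 𝔼 x', 𝔼 y, a x y * conj (a x' y) * (chi (ψ x * y) * conj (chi (ψ x' * y))) *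
        𝔼 z : Fin N, chi (ψ x * sqDiff P (z : ℕ) (x : ℕ)) *
          conj (chi (ψ x' * sqDiff P (z : ℕ) (x' : ℕ))) := by
    rw [ofReal_expect]
    simp only [normSq_expect]
    rw [expect_comm]
    refine expect_congr rfl fun x _ => ?_
    rw [expect_comm]
    refine expect_congr rfl fun x' _ => ?_
    rw [expect_prod', expect_comm]
    refine expect_congr rfl fun y _ => ?_
    rw [mul_expect]
    refine expect_congr rfl fun z _ => ?_
    simp only [mul_add, chi_add, map_mul]
    ring
  rw [expect_comm] at e3
  rw [← Complex.norm_of_nonneg (expect_nonneg fun _ _ => sq_nonneg _ : (0:ℝ) ≤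
    𝔼 p : Fin N × ZMod P, ‖𝔼 x, a x p.2 * chi (ψ x * (p.2 + sqDiff P (p.1 : ℕ) (x : ℕ)))‖ ^ 2), e3]
  refine (norm_expect_le_expect _).trans (expect_mono fun x' => ?_)
  refine (norm_expect_le_expect _).trans (expect_mono fun x => ?_)
  split_ifs with hx
  · refine (norm_expect_le_expect _).trans (expect_le_of_le _ (norm_nonneg _) fun y => ?_)
    rw [norm_mul]
    refine mul_le_of_le_one_left (norm_nonneg _) ?_
    simp only [norm_mul, RCLike.norm_conj, norm_chi, mul_one]
    exact mul_le_one₀ (ha _ _) (norm_nonneg _) (ha _ _)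
  · simp [hA x _ hx]

lemma quadratic_phase_eq (ψ ψ' : ZMod P) (x x' z : ℕ) :
    chi (ψ * sqDiff P z x) * conj (chi (ψ' * sqDiff P z x')) =
      e ((z : ℤ) ^ 2 • ZMod.toAddCircle (ψ - ψ') +
        (z : ℤ) • ZMod.toAddCircle (2 * (x' : ZMod P) * ψ' - 2 * (x : ZMod P) * ψ)) *
        (chi (ψ * (x : ZMod P) ^ 2) * conj (chi (ψ' * (x' : ZMod P) ^ 2))) := by
  rw [← chi_neg, ← chi_neg, ← chi_add, ← chi_add, ← map_zsmul, ← map_zsmul, ← map_add]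
  change _ = chi _ * _
  rw [← chi_add]
  congr 1
  simp only [sqDiff, zsmul_eq_mul]
  push_cast
  ring

/-- The frequency ψ enters only through the coefficient of xz. Expanding the square in z and
averaging over x first isolates it in geometric averages of frequency (v - v')·2ψ. -/
lemma expect_norm_quadratic_sq_le (σ β ψ : ZMod P) :
    𝔼 x : Fin N, ‖𝔼 z : Fin N, e (((z : ℕ) : ℤ) ^ 2 • ZMod.toAddCircle σ +
      ((z : ℕ) : ℤ) • ZMod.toAddCircle (β - 2 * ((x : ℕ) : ZMod P) * ψ))‖ ^ 2 ≤
    𝔼 v' : Fin N, 𝔼 v : Fin N, ‖𝔼 x : Fin N, e (((x : ℕ) : ℤ) •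
      (((v : ℕ) - (v' : ℕ) : ℤ) • (2 • ZMod.toAddCircle ψ)))‖ := by
  rw [← Complex.norm_of_nonneg (expect_nonneg fun _ _ => sq_nonneg _ : (0:ℝ) ≤
    𝔼 x : Fin N, ‖𝔼 z : Fin N, e (((z : ℕ) : ℤ) ^ 2 • ZMod.toAddCircle σ +
      ((z : ℕ) : ℤ) • ZMod.toAddCircle (β - 2 * ((x : ℕ) : ZMod P) * ψ))‖ ^ 2), ofReal_expect]
  simp only [normSq_expect]
  rw [expect_comm]
  refine (norm_expect_le_expect _).trans (expect_mono fun v' => ?_)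
  rw [expect_comm]
  refine (norm_expect_le_expect _).trans (expect_mono fun v => le_of_eq ?_)
  have : ∀ x : Fin N, e (((v' : ℕ) : ℤ) ^ 2 • ZMod.toAddCircle σ +
      ((v' : ℕ) : ℤ) • ZMod.toAddCircle (β - 2 * ((x : ℕ) : ZMod P) * ψ)) *
      conj (e (((v : ℕ) : ℤ) ^ 2 • ZMod.toAddCircle σ +
      ((v : ℕ) : ℤ) • ZMod.toAddCircle (β - 2 * ((x : ℕ) : ZMod P) * ψ))) =
      e (((v' : ℕ) ^ 2 - (v : ℕ) ^ 2 : ℤ) • ZMod.toAddCircle σ +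
        ((v' : ℕ) - (v : ℕ) : ℤ) • ZMod.toAddCircle β) *
        e (((x : ℕ) : ℤ) • (((v : ℕ) - (v' : ℕ) : ℤ) • (2 • ZMod.toAddCircle ψ))) := by
    intro x
    rw [← e_neg, ← e_add, ← e_add]
    congr 1
    rw [show 2 * ((x : ℕ) : ZMod P) * ψ = (((x : ℕ) : ℤ)) • ((2 : ℕ) • ψ) by
      simp only [zsmul_eq_mul, nsmul_eq_mul]; push_cast; ring, map_sub, map_zsmul, map_nsmul]
    generalize ZMod.toAddCircle σ = A
    generalize ZMod.toAddCircle β = B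
    generalize ZMod.toAddCircle ψ = C
    module
  simp only [this]
  rw [← mul_expect, norm_mul, norm_e, one_mul]

/-- A quadratic phase of varying frequency correlates with `a(x, y) g(z, y)` only if many of the
frequencies lie on major arcs. -/
lemma major_arc_lemma : ∃ k : ℕ, ∀ {P N : ℕ} [NeZero P] {T : ℝ}, 100 ≤ T → T ^ k ≤ N →
    P = 8 * N ^ 2 → ∀ (a g : Fin N → ZMod P → ℂ) (ψ : Fin N → ZMod P) (A : Fin N → Prop)
    [DecidablePred A], (∀ x y, ‖a x y‖ ≤ 1) → (∀ z y, ‖g z y‖ ≤ 1) → (∀ x y, ¬ A x → a x y = 0) →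
    1 / T ≤ ‖𝔼 x, 𝔼 z, 𝔼 y, a x y * g z y * chi (ψ x * (y + sqDiff P (z : ℕ) (x : ℕ)))‖ →
    1 / T ^ k ≤ 𝔼 x, (if A x ∧ ψ x ∈ majSet P N (T ^ k) then (1 : ℝ) else 0) := by
  -- Weyl at T³ gives arcs of parameter T¹²³, hence at most T⁴⁹² of them. Pigeonholing leaves
  -- density T⁻⁴⁹⁵, squaring the threshold T⁻³ leads to T⁻⁵⁰¹, the geometric lemma gives T^(501·12),
  -- and one more power covers a factor 2.
  refine ⟨6013, ?_⟩
  intro P N _ T hT hTN hP a g ψ A _ ha hg hA h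
  have hT0 : 0 < T := by linarith
  have hT1 : 1 ≤ T := by linarith
  have hpow : ∀ {m n : ℕ}, m ≤ n → T ^ m ≤ T ^ n := fun h => pow_le_pow_right₀ hT1 h
  have hN1 : (1 : ℝ) ≤ N := le_trans (one_le_pow₀ hT1) hTN
  have hN : 1 ≤ N := by exact_mod_cast hN1
  have : Nonempty (Fin N) := ⟨⟨0, hN⟩⟩
  have hTN' : ∀ {m : ℕ}, m ≤ 6013 → T ^ m ≤ N := fun h => (hpow h).trans hTN
  set Z : Fin N → Fin N → ℝ := fun x x' => ‖𝔼 z : Fin N, chi (ψ x * sqDiff P (z : ℕ) (x : ℕ)) *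
    conj (chi (ψ x' * sqDiff P (z : ℕ) (x' : ℕ)))‖ with hZ
  have hZ1 : ∀ x x', Z x x' ≤ 1 := fun x x' => norm_expect_le_one _ fun z => by simp
  have s1 : (1 / T) ^ 2 ≤ 𝔼 x', 𝔼 x, (if A x then Z x x' else 0) := by
    exact (pow_le_pow_left₀ (by positivity) h 2).trans (sq_norm_expect_phase_le ψ ha hg hA)
  obtain ⟨x', hx'⟩ := exists_le_of_le_expect _ s1
  set c : ℝ := 1 / T ^ 3 with hc
  have hc0 : 0 < c := by positivity
  have hc2 : 2 * c ≤ (1 / T) ^ 2 := by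
    rw [hc, div_pow, one_pow, mul_one_div, div_le_div_iff₀ (by positivity) (by positivity)]
    nlinarith [pow_pos hT0 2]
  have s2 := le_expect_ite (f := fun x => if A x then Z x x' else 0)
    (fun x => by split_ifs; exacts [hZ1 _ _, zero_le_one]) hc0.le (hc2.trans hx')
  have hZe : ∀ x, Z x x' = ‖𝔼 z : Fin N, e (((z : ℕ) : ℤ) ^ 2 • ZMod.toAddCircle (ψ x - ψ x') +
      ((z : ℕ) : ℤ) • ZMod.toAddCircle (2 * ((x' : ℕ) : ZMod P) * ψ x' - 2 * ((x : ℕ) : ZMod P) * ψ x))‖ := by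
    intro x
    simp only [hZ, quadratic_phase_eq]
    rw [← expect_mul, norm_mul]
    simp
  have s3 : ∀ x, c ≤ (if A x then Z x x' else 0) → ψ x - ψ x' ∈ majSet P N (T ^ 123) := by
    intro x hx
    have hx2 : c ≤ Z x x' := by
      split_ifs at hx
      · exact hx
      · linarith
    rw [hZe, hc] at hx2
    have := isMaj_of_le_norm_expect_quadratic (T := T ^ 3) (hT.trans (le_self_pow₀ hT1 (by norm_num)))
      (by rw [← pow_mul]; exact hTN' (by norm_num)) _ _ hx2
    rw [← pow_mul] at this
    exact mem_majSet.2 this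
  have hcard := card_majSet_le (P := P) hN hP (K := T ^ 123) (hT.trans (le_self_pow₀ hT1 (by norm_num)))
  rw [← pow_mul] at hcard
  obtain ⟨σ, -, hσ⟩ := exists_large_fiber (majSet P N (T ^ 123)) (fun x => ψ x - ψ x')
    (fun x => c ≤ (if A x then Z x x' else 0)) s3 hc0 (by positivity) hcard s2
  set ψ₁ := ψ x' + σ with hψ₁
  have hρ : c / T ^ (123 * 4) = 1 / T ^ 495 := by rw [hc, div_div, ← pow_add]
  rw [hρ] at hσ
  have hX1 : ∀ x, c ≤ (if A x then Z x x' else 0) ∧ ψ x - ψ x' = σ → A x ∧ c ≤ Z x x' ∧ ψ x = ψ₁ := by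
    rintro x ⟨h1, h2⟩
    split_ifs at h1 with hAx
    · exact ⟨hAx, h1, by rw [hψ₁, ← h2]; ring⟩
    · linarith
  -- Knowing that ψ x - ψ x' is major does not yet locate ψ x. On the popular class ψ x equals the
  -- constant ψ₁, and the linear coefficient varies with x as -2xψ₁; averaging over x makes ψ₁
  -- itself visible.
  have s4 : 1 / T ^ 501 ≤ 𝔼 x : Fin N, ‖𝔼 z : Fin N, e (((z : ℕ) : ℤ) ^ 2 • ZMod.toAddCircle (ψ₁ - ψ x') +
      ((z : ℕ) : ℤ) • ZMod.toAddCircle (2 * ((x' : ℕ) : ZMod P) * ψ x' - 2 * ((x : ℕ) : ZMod P) * ψ₁))‖ ^ 2 := by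
    have h1 : 1 / T ^ 501 = 1 / T ^ 495 * c ^ 2 := by
      rw [hc, div_pow, one_pow, ← pow_mul, div_mul_div_comm, one_mul, ← pow_add]
    rw [h1]
    refine (mul_le_mul_of_nonneg_right hσ (sq_nonneg c)).trans ?_
    rw [expect_mul]
    refine expect_mono fun x => ?_
    by_cases hx : (c ≤ if A x then Z x x' else 0) ∧ ψ x - ψ x' = σ
    · obtain ⟨-, h2, h3⟩ := hX1 x hx
      rw [hZe, h3] at h2
      rw [if_pos hx, one_mul]
      exact pow_le_pow_left₀ hc0.le h2 2
    · rw [if_neg hx, zero_mul]; positivity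
  have s5 : 1 / T ^ 501 ≤ 𝔼 v' : Fin N, 𝔼 v : Fin N, ‖𝔼 x : Fin N, e (((x : ℕ) : ℤ) •
      (((v : ℕ) - (v' : ℕ) : ℤ) • (2 • ZMod.toAddCircle ψ₁)))‖ := by
    exact s4.trans (expect_norm_quadratic_sq_le _ _ _)
  have s6 := isMaj_of_le_expect_geom (T := T ^ 501) (hT.trans (le_self_pow₀ hT1 (by norm_num)))
    (by rw [← pow_mul]; exact hTN' (by norm_num)) le_rfl _ s5
  have s7 := s6.of_nsmul (by norm_num : 1 ≤ 2)
  have hmaj : ψ₁ ∈ majSet P N (T ^ 6013) := by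
    refine mem_majSet.2 (s7.mono ?_)
    rw [← pow_mul, show (6013 : ℕ) = 1 + 501 * 12 by norm_num, pow_add T 1, pow_one]
    push_cast
    gcongr
    linarith
  refine le_trans ?_ (hσ.trans (expect_mono fun x => ?_))
  · exact one_div_le_one_div_of_le (by positivity) (hpow (by norm_num))
  · refine ite_one_zero_le_ite fun h1 => ?_
    obtain ⟨h3, -, h4⟩ := hX1 x h1
    exact ⟨h3, h4 ▸ hmaj⟩

end MajorArc

/-! ### Dual functions and correlations of their derivatives -/

section Dual
variable {P N : ℕ} [NeZero P]

/-- The dual function of the cyclic counting operator in its third argument. -/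
noncomputable def dual (f₀ f₁ : Fin N → ZMod P → ℂ) (x : Fin N) (y : ZMod P) : ℂ :=
  𝔼 z : Fin N, conj (f₀ x (y - sqDiff P (z : ℕ) (x : ℕ)) * f₁ z (y - sqDiff P (z : ℕ) (x : ℕ)))

lemma norm_dual_le_one {P : ℕ} {f₀ f₁ : Fin N → ZMod P → ℂ} (h₀ : ∀ x y, ‖f₀ x y‖ ≤ 1)
    (h₁ : ∀ x y, ‖f₁ x y‖ ≤ 1) (x : Fin N) (y : ZMod P) : ‖dual f₀ f₁ x y‖ ≤ 1 :=
  norm_expect_le_one _ fun z => by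
    rw [RCLike.norm_conj, norm_mul]; exact mul_le_one₀ (h₀ _ _) (norm_nonneg _) (h₁ _ _)

/-- Extraction of frequencies and of weights supported where the Fourier coefficient is large. -/
lemma exists_weight_of_le_expect_fmax {I : Type*} [Fintype I] (G : I → ZMod P → ℂ)
    (hG : ∀ i y, ‖G i y‖ ≤ 1) {η : ℝ} (hη : 0 ≤ η) (h : 2 * η ≤ 𝔼 i, fmax (G i)) :
    ∃ (φ : I → ZMod P) (c : I → ℂ), (∀ i, ‖c i‖ ≤ 1) ∧
      (∀ i, c i ≠ 0 → η ≤ ‖fourier (G i) (φ i)‖ ^ 2) ∧ η ≤ ‖𝔼 i, c i * fourier (G i) (φ i)‖ := by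
  choose φ hφ using fun i => exists_fmax_eq (G i)
  refine ⟨φ, fun i => if η ≤ ‖fourier (G i) (φ i)‖ ^ 2 then conj (fourier (G i) (φ i)) else 0, ?_, ?_, ?_⟩
  · intro i
    dsimp only
    split_ifs
    · rw [RCLike.norm_conj]; exact norm_fourier_le_one (hG i) _
    · simp
  · intro i hi
    by_contra hcon
    simp [hcon] at hi
  · have h1 : 𝔼 i, (if η ≤ ‖fourier (G i) (φ i)‖ ^ 2 then conj (fourier (G i) (φ i)) else 0) *
        fourier (G i) (φ i) =
        ((𝔼 i, if η ≤ ‖fourier (G i) (φ i)‖ ^ 2 then ‖fourier (G i) (φ i)‖ ^ 2 else 0 : ℝ) : ℂ) := by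
      rw [ofReal_expect]
      refine expect_congr rfl fun i _ => ?_
      split_ifs
      · rw [mul_comm, Complex.mul_conj, Complex.normSq_eq_norm_sq]
      · simp
    rw [h1, Complex.norm_of_nonneg (expect_nonneg fun i _ => by split_ifs <;> positivity)]
    have h2 : 𝔼 i, fmax (G i) ≤ 𝔼 i, ((if η ≤ ‖fourier (G i) (φ i)‖ ^ 2 then
        ‖fourier (G i) (φ i)‖ ^ 2 else 0) + η) := by
      refine expect_mono fun i => ?_
      rw [hφ]
      split_ifs <;> linarith
    rw [expect_add_distrib] at h2
    have h3 : 𝔼 _i : I, η ≤ η := expect_le_of_le _ hη fun _ => le_rfl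
    linarith

/-- The major arc lemma, averaged over a family. -/
lemma major_arc_lemma_average : ∃ k : ℕ, ∀ {P N : ℕ} [NeZero P] {T : ℝ}, 100 ≤ T → T ^ k ≤ N →
    P = 8 * N ^ 2 → ∀ {Q : Type} [Fintype Q] (a g : Q → Fin N → ZMod P → ℂ) (ψ : Q → Fin N → ZMod P)
    (A : Q → Fin N → Prop) [∀ q, DecidablePred (A q)], (∀ q x y, ‖a q x y‖ ≤ 1) →
    (∀ q z y, ‖g q z y‖ ≤ 1) → (∀ q x y, ¬ A q x → a q x y = 0) →
    1 / T ≤ 𝔼 q, ‖𝔼 x, 𝔼 z, 𝔼 y, a q x y * g q z y *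
      chi (ψ q x * (y + sqDiff P (z : ℕ) (x : ℕ)))‖ →
    1 / T ^ k ≤ 𝔼 q, 𝔼 x, (if A q x ∧ ψ q x ∈ majSet P N (T ^ k) then (1 : ℝ) else 0) := by
  obtain ⟨k, hk⟩ := major_arc_lemma
  refine ⟨2 * k + 2, ?_⟩
  intro P N _ T hT hTN hP Q _ a g ψ A _ ha hg hA h
  have hT0 : 0 < T := by linarith
  have hT1 : 1 ≤ T := by linarith
  have hT2 : 100 ≤ T ^ 2 := hT.trans (le_self_pow₀ hT1 (by norm_num))
  have hpow : ∀ {m n : ℕ}, m ≤ n → T ^ m ≤ T ^ n := fun h => pow_le_pow_right₀ hT1 h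
  have h1 : 2 * (1 / T ^ 2) ≤ 1 / T := by
    rw [mul_one_div, div_le_div_iff₀ (by positivity) (by positivity)]; nlinarith
  have s1 := le_expect_ite (f := fun q => ‖𝔼 x, 𝔼 z, 𝔼 y, a q x y * g q z y *
      chi (ψ q x * (y + sqDiff P (z : ℕ) (x : ℕ)))‖) (fun q => norm_expect_le_one _ fun x =>
      norm_expect_le_one _ fun z => norm_expect_le_one _ fun y => by
        rw [norm_mul, norm_mul, norm_chi, mul_one]
        exact mul_le_one₀ (ha _ _ _) (norm_nonneg _) (hg _ _ _)) (by positivity) (h1.trans h)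
  have s2 : 1 / T ^ (2 * k + 2) = 1 / T ^ 2 * (1 / T ^ (2 * k)) := by
    rw [div_mul_div_comm, one_mul, ← pow_add, add_comm]
  rw [s2]
  refine (mul_le_mul_of_nonneg_right s1 (by positivity)).trans ?_
  rw [expect_mul]
  refine expect_mono fun q => ?_
  split_ifs with hq
  · rw [one_mul]
    have := hk hT2 (by rw [← pow_mul]; exact (hpow (by omega)).trans hTN) hP (a q) (g q) (ψ q) (A q) (ha q) (hg q) (hA q) hq
    rw [← pow_mul] at this
    refine this.trans (expect_mono fun x => ite_one_zero_le_ite fun hx => ⟨hx.1, ?_⟩)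
    exact mem_majSet.2 ((mem_majSet.1 hx.2).mono (hpow (by omega)))
  · rw [zero_mul]
    exact expect_nonneg fun x _ => by split_ifs <;> norm_num

/-- The alternating product of `u` over the corners of a rectangle. -/
noncomputable def quad {ι : Type*} (u : ι → ι → ℂ) (i i' j j' : ι) : ℂ :=
  u i j * conj (u i j') * conj (u i' j * conj (u i' j'))

lemma quad_mul {ι : Type*} (u v : ι → ι → ℂ) (i i' j j' : ι) :
    quad (fun i j => u i j * v i j) i i' j j' = quad u i i' j j' * quad v i i' j j' := by
  simp only [quad, map_mul]; ring

lemma norm_quad_le_one {ι : Type*} {u : ι → ι → ℂ} (hu : ∀ i j, ‖u i j‖ ≤ 1) (i i' j j' : ι) :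
    ‖quad u i i' j j'‖ ≤ 1 := by
  simp only [quad, norm_mul, RCLike.norm_conj]
  exact mul_le_one₀ (mul_le_one₀ (hu _ _) (norm_nonneg _) (hu _ _)) (by positivity)
    (mul_le_one₀ (hu _ _) (norm_nonneg _) (hu _ _))

lemma quad_chi {ι : Type*} (φ : ι → ι → ZMod P) (t : ZMod P) (i i' j j' : ι) :
    quad (fun i j => chi (φ i j * t)) i i' j j' =
      chi ((φ i j - φ i j' - φ i' j + φ i' j') * t) := by
  simp only [quad, ← chi_neg, ← chi_add]
  congr 1; ring

lemma expect_norm_sq_eq_quad {ι S : Type*} [Fintype ι] [Fintype S] (X : S → ι → ι → ℂ) :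
    ((𝔼 s, 𝔼 j, 𝔼 j', ‖𝔼 i, X s i j * conj (X s i j')‖ ^ 2 : ℝ) : ℂ) =
      𝔼 j, 𝔼 j', 𝔼 i, 𝔼 i', 𝔼 s, quad (X s) i i' j j' := by
  rw [ofReal_expect]
  simp only [ofReal_expect, normSq_expect]
  rw [expect_comm]; refine expect_congr rfl fun j _ => ?_
  rw [expect_comm]; refine expect_congr rfl fun j' _ => ?_
  rw [expect_comm]; refine expect_congr rfl fun i _ => ?_
  rw [expect_comm]; rfl

variable {ι : Type} [Fintype ι]

lemma der_der_zero {P : ℕ} (F : ZMod P → ℂ) (a b y : ZMod P) :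
    der (der F 0 a) 0 b y = F y * conj (F (y + a)) * conj (F (y + b)) * F (y + a + b) := by
  simp only [der, add_zero, map_mul, Complex.conj_conj]
  rw [add_right_comm y b a]; ring

/-- Of the four factors of the second derivative only the one at y + m i + m j involves both i and
j. It is opened as an average over z, and Cauchy–Schwarz in i and j removes the rest. The phases
combine into an alternating sum over a rectangle. -/
lemma norm_expect_der_der_pow_four_le {f₀ f₁ : Fin N → ZMod P → ℂ} (h₀ : ∀ x y, ‖f₀ x y‖ ≤ 1)
    (h₁ : ∀ x y, ‖f₁ x y‖ ≤ 1) (m : ι → ZMod P) (φ : Fin N → ι → ι → ZMod P)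
    (c : Fin N → ι → ι → ℂ) :
    ‖𝔼 x, 𝔼 i, 𝔼 j, c x i j * fourier (der (der (dual f₀ f₁ x) 0 (m i)) 0 (m j)) (φ x i j)‖ ^ 4 ≤
      𝔼 j, 𝔼 j', 𝔼 i, 𝔼 i', ‖𝔼 x, 𝔼 z, 𝔼 y,
        quad (fun i j => c x i j * conj (f₀ x (y + m i + m j))) i i' j j' *
        quad (fun i j => conj (f₁ z (y + m i + m j))) i i' j j' *
        chi ((φ x i j - φ x i j' - φ x i' j + φ x i' j') * (y + sqDiff P (z : ℕ) (x : ℕ)))‖ := by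
  set F := dual f₀ f₁ with hF
  have hF1 : ∀ x y, ‖F x y‖ ≤ 1 := norm_dual_le_one h₀ h₁
  set X : Fin N × Fin N × ZMod P → ι → ι → ℂ := fun s i j =>
    c s.1 i j * conj (f₀ s.1 (s.2.2 - sqDiff P (s.2.1 : ℕ) (s.1 : ℕ) + m i + m j)) *
      (conj (f₁ s.2.1 (s.2.2 - sqDiff P (s.2.1 : ℕ) (s.1 : ℕ) + m i + m j))) *
      chi (φ s.1 i j * s.2.2) with hX
  have e1 : 𝔼 x, 𝔼 i, 𝔼 j, c x i j * fourier (der (der (F x) 0 (m i)) 0 (m j)) (φ x i j) =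
      𝔼 s : Fin N × Fin N × ZMod P, 𝔼 i, 𝔼 j, conj (F s.1 (s.2.2 + m j)) *
        (F s.1 s.2.2 * conj (F s.1 (s.2.2 + m i))) * X s i j := by
    rw [expect_prod']
    refine expect_congr rfl fun x _ => ?_
    rw [expect_comm]
    symm
    rw [expect_comm]
    simp only [expect_comm (univ : Finset (Fin N × ZMod P)) (univ : Finset ι)]
    rw [expect_comm]
    refine expect_congr rfl fun j _ => expect_congr rfl fun i _ => ?_
    rw [expect_prod', expect_comm, fourier, mul_expect]
    refine expect_congr rfl fun y _ => ?_
    rw [der_der_zero]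
    have : F x (y + m i + m j) = 𝔼 z : Fin N, conj (f₀ x (y - sqDiff P (z : ℕ) (x : ℕ) + m i + m j)) *
        conj (f₁ z (y - sqDiff P (z : ℕ) (x : ℕ) + m i + m j)) := by
      rw [hF, dual]
      refine expect_congr rfl fun z _ => ?_
      rw [map_mul, sub_add_eq_add_sub, sub_add_eq_add_sub]
    rw [this, mul_expect, expect_mul, mul_expect]
    refine expect_congr rfl fun z _ => ?_
    simp only [hX]; ring
  rw [e1]
  refine (gowers_cauchySchwarz_two X _ _ (fun s j => ?_) (fun s i => ?_)).trans ?_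
  · rw [RCLike.norm_conj]; exact hF1 _ _
  · rw [norm_mul, RCLike.norm_conj]; exact mul_le_one₀ (hF1 _ _) (norm_nonneg _) (hF1 _ _)
  rw [← Complex.norm_of_nonneg (expect_nonneg fun _ _ => expect_nonneg fun _ _ =>
    expect_nonneg fun _ _ => sq_nonneg _ :
    (0:ℝ) ≤ 𝔼 s, 𝔼 j, 𝔼 j', ‖𝔼 i, X s i j * conj (X s i j')‖ ^ 2), expect_norm_sq_eq_quad]
  refine (norm_expect_le_expect _).trans (expect_mono fun j => ?_)
  refine (norm_expect_le_expect _).trans (expect_mono fun j' => ?_)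
  refine (norm_expect_le_expect _).trans (expect_mono fun i => ?_)
  refine (norm_expect_le_expect _).trans (expect_mono fun i' => le_of_eq (congrArg _ ?_))
  rw [expect_prod']
  refine expect_congr rfl fun x _ => ?_
  rw [expect_prod']
  refine expect_congr rfl fun z _ => ?_
  rw [← expect_translate _ (sqDiff P (z : ℕ) (x : ℕ))]
  refine expect_congr rfl fun y _ => ?_
  simp only [hX, add_sub_cancel_right]
  rw [quad_mul, quad_mul, quad_chi]

/-- In the difference variable the frequency enters through the single factor χ(ξ t); at ξ = φ₁ i +
φ₂ j this splits into a function of i times a function of j. -/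
lemma fourier_sq_eq (G : ZMod P → ℂ) (ξ : ZMod P) :
    ((‖fourier G ξ‖ ^ 2 : ℝ) : ℂ) =
      𝔼 s : ZMod P × ZMod P, G s.1 * conj (G (s.1 + s.2)) * conj (chi (ξ * s.2)) := by
  rw [fourier, normSq_expect, expect_prod']
  refine expect_congr rfl fun y _ => ?_
  rw [← expect_translate _ y]
  refine expect_congr rfl fun t _ => ?_
  rw [add_comm t y, mul_add, chi_add]
  simp only [map_mul]
  linear_combination (G y * conj (G (y + t)) * conj (chi (ξ * t))) * chi_mul_conj (ξ * y)

lemma expect_eq_fourier_zero (G : ZMod P → ℂ) : 𝔼 y, G y = fourier G 0 := by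
  simp [fourier]

lemma expect_comm_four {M : Type*} [AddCommMonoid M] [Module ℚ≥0 M] (f : ι → ι → ι → ι → M) :
    𝔼 j, 𝔼 j', 𝔼 i, 𝔼 i', f i i' j j' = 𝔼 i, 𝔼 i', 𝔼 j, 𝔼 j', f i i' j j' := by
  have := expect_comm (univ : Finset (ι × ι)) (univ : Finset (ι × ι))
    (fun p q => f q.1 q.2 p.1 p.2)
  simpa only [expect_prod'] using this

/-- Phases that split as a sum can be removed by the Cauchy–Schwarz inequality. -/
lemma expect_fourier_der_der_pow_four_le {F : ZMod P → ℂ} (hF : ∀ y, ‖F y‖ ≤ 1) (m : ι → ZMod P)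
    (φ₁ φ₂ : ι → ZMod P) :
    (𝔼 i, 𝔼 j, ‖fourier (der (der F 0 (m i)) 0 (m j)) (φ₁ i + φ₂ j)‖ ^ 2) ^ 4 ≤
      𝔼 i, 𝔼 i', 𝔼 j, 𝔼 j', ‖𝔼 y, der F (m i) (m i') (y + m j) *
        conj (der F (m i) (m i') (y + m j'))‖ ^ 2 := by
  -- These are the only factors involving both i and j. The rest, including the split phase, is a
  -- function of i times a function of j and is discarded.
  set X : ZMod P × ZMod P → ι → ι → ℂ := fun s i j =>
    F (s.1 + m i + m j) * conj (F (s.1 + s.2 + m i + m j)) with hX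
  have h0 : (0:ℝ) ≤ 𝔼 i, 𝔼 j, ‖fourier (der (der F 0 (m i)) 0 (m j)) (φ₁ i + φ₂ j)‖ ^ 2 :=
    expect_nonneg fun _ _ => expect_nonneg fun _ _ => sq_nonneg _
  have e1 : ((𝔼 i, 𝔼 j, ‖fourier (der (der F 0 (m i)) 0 (m j)) (φ₁ i + φ₂ j)‖ ^ 2 : ℝ) : ℂ) =
      𝔼 s : ZMod P × ZMod P, 𝔼 i, 𝔼 j,
        (conj (F (s.1 + m j)) * F (s.1 + s.2 + m j) * conj (chi (φ₂ j * s.2))) *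
        (F s.1 * conj (F (s.1 + s.2)) * (conj (F (s.1 + m i)) * F (s.1 + s.2 + m i)) *
          conj (chi (φ₁ i * s.2))) * X s i j := by
    simp only [ofReal_expect, fourier_sq_eq]
    symm
    rw [expect_comm]
    refine expect_congr rfl fun i _ => ?_
    rw [expect_comm]
    refine expect_congr rfl fun j _ => expect_congr rfl fun s _ => ?_
    rw [der_der_zero, der_der_zero, add_mul, chi_add]
    simp only [hX, map_mul, Complex.conj_conj]
    ring
  rw [← Complex.norm_of_nonneg h0, e1]
  refine (gowers_cauchySchwarz_two X _ _ (fun s j => ?_) (fun s i => ?_)).trans ?_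
  · simp only [norm_mul, RCLike.norm_conj, norm_chi, mul_one]
    exact mul_le_one₀ (hF _) (norm_nonneg _) (hF _)
  · simp only [norm_mul, RCLike.norm_conj, norm_chi, mul_one]
    exact mul_le_one₀ (mul_le_one₀ (hF _) (norm_nonneg _) (hF _)) (by positivity)
      (mul_le_one₀ (hF _) (norm_nonneg _) (hF _))
  refine le_of_eq ?_
  rw [← Complex.ofReal_inj, expect_norm_sq_eq_quad]
  rw [expect_comm_four]
  simp only [ofReal_expect]
  refine expect_congr rfl fun i _ => expect_congr rfl fun i' _ => expect_congr rfl fun j _ =>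
    expect_congr rfl fun j' _ => ?_
  rw [expect_eq_fourier_zero, fourier_sq_eq]
  refine expect_congr rfl fun s _ => ?_
  simp only [quad, hX, der, map_mul, Complex.conj_conj, zero_mul, chi_zero, map_one, mul_one]
  simp only [add_right_comm _ (m j), add_right_comm _ (m j')]
  ring

end Dual

/-! ### Degree lowering -/

section DegreeLowering
variable {P N : ℕ} [NeZero P]

lemma expect_regroup {ι M : Type*} [Fintype ι] [AddCommMonoid M] [Module ℚ≥0 M]
    (f : ι → ι → ι → ι → M) :
    𝔼 j, 𝔼 j', 𝔼 i, 𝔼 i', f i i' j j' =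
      𝔼 q : (ι × ι) × (ι × ι), f q.2.1 q.1.1 q.2.2 q.1.2 := by
  simp only [expect_prod']
  calc 𝔼 j, 𝔼 j', 𝔼 i, 𝔼 i', f i i' j j' = 𝔼 j, 𝔼 j', 𝔼 i', 𝔼 i, f i i' j j' :=
        expect_congr rfl fun j _ => expect_congr rfl fun j' _ => expect_comm _ _ _
    _ = 𝔼 j, 𝔼 i', 𝔼 j', 𝔼 i, f i i' j j' := expect_congr rfl fun j _ => expect_comm _ _ _
    _ = 𝔼 i', 𝔼 j, 𝔼 j', 𝔼 i, f i i' j j' := expect_comm _ _ _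
    _ = 𝔼 i', 𝔼 j', 𝔼 j, 𝔼 i, f i i' j j' := expect_congr rfl fun i' _ => expect_comm _ _ _
    _ = _ := expect_congr rfl fun i' _ => expect_congr rfl fun j' _ => expect_comm _ _ _

/-- If φ(x, i, j) is the frequency of a large coefficient, many alternating sums of φ over
rectangles lie on major arcs. Fixing the opposite corner and the arc expresses φ(x, i, j) as a
function of (x, i) plus a function of (x, j), which `expect_fourier_der_der_pow_four_le` removes. -/
lemma degree_lowering_two : ∃ k : ℕ, ∀ {P N : ℕ} [NeZero P] {T : ℝ}, 100 ≤ T → T ^ k ≤ N →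
    P = 8 * N ^ 2 → ∀ {ι : Type} [Fintype ι] (m : ι → ZMod P) {f₀ f₁ : Fin N → ZMod P → ℂ},
    (∀ x y, ‖f₀ x y‖ ≤ 1) → (∀ x y, ‖f₁ x y‖ ≤ 1) →
    1 / T ≤ 𝔼 x, 𝔼 i, 𝔼 j, fmax (der (der (dual f₀ f₁ x) 0 (m i)) 0 (m j)) →
    1 / T ^ k ≤ 𝔼 x, 𝔼 i, 𝔼 i', 𝔼 j, 𝔼 j', ‖𝔼 y, der (dual f₀ f₁ x) (m i) (m i') (y + m j) *
        conj (der (dual f₀ f₁ x) (m i) (m i') (y + m j'))‖ ^ 2 := by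
  obtain ⟨k, hk⟩ := major_arc_lemma_average
  refine ⟨(2 + (8 * k + (8 * k + 1) * 4)) * 4, ?_⟩
  intro P N _ T hT hTN hP ι _ m f₀ f₁ h₀ h₁ h
  classical
  have hT0 : 0 < T := by linarith
  have hT1 : 1 ≤ T := by linarith
  have hpow : ∀ {m n : ℕ}, m ≤ n → T ^ m ≤ T ^ n := fun h => pow_le_pow_right₀ hT1 h
  have hN1 : (1 : ℝ) ≤ N := le_trans (one_le_pow₀ hT1) hTN
  have hN : 1 ≤ N := by exact_mod_cast hN1
  have : Nonempty ι := by
    by_contra hne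
    rw [not_nonempty_iff] at hne
    simp at h
    linarith
  set F := dual f₀ f₁ with hF
  have hF1 : ∀ x y, ‖F x y‖ ≤ 1 := norm_dual_le_one h₀ h₁
  have h2 : 2 * (1 / T ^ 2) ≤ 1 / T := by
    rw [mul_one_div, div_le_div_iff₀ (by positivity) (by positivity)]; nlinarith
  obtain ⟨φ', c', hc1, hc2, hc3⟩ := exists_weight_of_le_expect_fmax
    (fun s : Fin N × ι × ι => der (der (F s.1) 0 (m s.2.1)) 0 (m s.2.2))
    (fun s => norm_der_le_one (norm_der_le_one (hF1 _) _ _) _ _) (η := 1 / T ^ 2) (by positivity)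
    (by simp only [expect_prod']; exact h2.trans h)
  set φ : Fin N → ι → ι → ZMod P := fun x i j => φ' (x, i, j) with hφ
  set c : Fin N → ι → ι → ℂ := fun x i j => c' (x, i, j) with hc
  simp only [expect_prod'] at hc3
  have s1 := (pow_le_pow_left₀ (by positivity) hc3 4).trans
    (norm_expect_der_der_pow_four_le h₀ h₁ m φ c)
  rw [div_pow, one_pow, ← pow_mul, expect_regroup (fun i i' j j' => ‖𝔼 x, 𝔼 z, 𝔼 y,
        quad (fun i j => c x i j * conj (f₀ x (y + m i + m j))) i i' j j' *
        quad (fun i j => conj (f₁ z (y + m i + m j))) i i' j j' *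
        chi ((φ x i j - φ x i j' - φ x i' j + φ x i' j') * (y + sqDiff P (z : ℕ) (x : ℕ)))‖)] at s1
  have s2 := hk (T := T ^ (2 * 4)) (hT.trans (le_self_pow₀ hT1 (by norm_num)))
    (by rw [← pow_mul]; exact (hpow (by omega)).trans hTN) hP
    (fun (q : (ι × ι) × (ι × ι)) x y =>
      quad (fun i j => c x i j * conj (f₀ x (y + m i + m j))) q.2.1 q.1.1 q.2.2 q.1.2)
    (fun q z y => quad (fun i j => conj (f₁ z (y + m i + m j))) q.2.1 q.1.1 q.2.2 q.1.2)
    (fun q x => φ x q.2.1 q.2.2 - φ x q.2.1 q.1.2 - φ x q.1.1 q.2.2 + φ x q.1.1 q.1.2)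
    (fun q x => c x q.2.1 q.2.2 ≠ 0)
    (fun q x y => norm_quad_le_one (fun i j => by
      rw [norm_mul, RCLike.norm_conj]; exact mul_le_one₀ (hc1 _) (norm_nonneg _) (h₀ _ _)) _ _ _ _)
    (fun q z y => norm_quad_le_one (fun i j => by rw [RCLike.norm_conj]; exact h₁ _ _) _ _ _ _)
    (fun q x y hx => by simp only [not_not] at hx; simp [quad, hx]) s1
  rw [← pow_mul] at s2
  rw [expect_comm] at s2
  simp only [expect_prod' (ι := ι × ι) (κ := ι × ι)] at s2
  set S := majSet P N (T ^ (2 * 4 * k)) with hS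
  -- For each x, choose the opposite corner (i', j') of the rectangle at which the remaining average
  -- is at least its mean.
  have s3 : ∀ x, ∃ q : ι × ι, 𝔼 q : ι × ι, 𝔼 r : ι × ι, (if c x r.1 r.2 ≠ 0 ∧
      φ x r.1 r.2 - φ x r.1 q.2 - φ x q.1 r.2 + φ x q.1 q.2 ∈ S then (1 : ℝ) else 0) ≤
      𝔼 r : ι × ι, (if c x r.1 r.2 ≠ 0 ∧
      φ x r.1 r.2 - φ x r.1 q.2 - φ x q.1 r.2 + φ x q.1 q.2 ∈ S then (1 : ℝ) else 0) := fun x =>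
    exists_le_of_le_expect _ le_rfl
  choose q hq using s3
  have s4 := s2.trans (expect_mono hq)
  rw [← expect_prod' (fun s : Fin N × (ι × ι) => if c s.1 s.2.1 s.2.2 ≠ 0 ∧
      φ s.1 s.2.1 s.2.2 - φ s.1 s.2.1 (q s.1).2 - φ s.1 (q s.1).1 s.2.2 + φ s.1 (q s.1).1 (q s.1).2 ∈ S
      then (1 : ℝ) else 0)] at s4
  have hcard : (#S : ℝ) ≤ T ^ ((8 * k + 1) * 4) := by
    have h3 := card_majSet_le (P := P) hN hP (K := T ^ (8 * k + 1)) (hT.trans (le_self_pow₀ hT1 (by omega)))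
    rw [← pow_mul] at h3
    refine le_trans ?_ h3
    exact_mod_cast card_le_card fun ξ hξ => mem_majSet.2 ((mem_majSet.1 hξ).mono (hpow (by omega)))
  obtain ⟨σ, -, hσ⟩ := exists_large_fiber S
    (fun s : Fin N × (ι × ι) => φ s.1 s.2.1 s.2.2 - φ s.1 s.2.1 (q s.1).2 - φ s.1 (q s.1).1 s.2.2 +
      φ s.1 (q s.1).1 (q s.1).2) _ (fun s hs => hs.2) (by positivity) (by positivity) hcard s4
  rw [div_div, ← pow_add] at hσ
  -- On the popular class the alternating sum is the constant σ, so φ(x, i, j) is replaced by a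
  -- separated expression. Nonvanishing of the weight guarantees that the coefficient there is still
  -- large.
  have s5 : 1 / T ^ (2 + (8 * k + (8 * k + 1) * 4)) ≤ 𝔼 x, 𝔼 i, 𝔼 j,
      ‖fourier (der (der (F x) 0 (m i)) 0 (m j))
        ((σ + φ x i (q x).2 - φ x (q x).1 (q x).2) + φ x (q x).1 j)‖ ^ 2 := by
    rw [pow_add, ← one_div_mul_one_div, mul_comm]
    refine (mul_le_mul_of_nonneg_right hσ (by positivity)).trans ?_
    rw [expect_mul]
    simp only [expect_prod']
    refine expect_mono fun x => expect_mono fun i => expect_mono fun j => ?_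
    split_ifs with hx
    · obtain ⟨⟨hx1, -⟩, hx2⟩ := hx
      rw [one_mul]
      have h4 := hc2 (x, i, j) hx1
      have h5 : φ' (x, i, j) = (σ + φ x i (q x).2 - φ x (q x).1 (q x).2) + φ x (q x).1 j := by
        rw [← hx2]; simp only [hφ]; ring
      rw [h5] at h4
      exact h4
    · rw [zero_mul]; positivity
  rw [pow_mul, ← one_div_pow]
  refine (pow_le_pow_left₀ (by positivity) s5 4).trans ?_
  refine (pow_expect_le _ (fun x => expect_nonneg fun _ _ => expect_nonneg fun _ _ => sq_nonneg _) 2).trans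
    (expect_mono fun x => ?_)
  exact expect_fourier_der_der_pow_four_le (hF1 x) m _ _

/-- A first derivative has only two factors: the one without p is removed by Cauchy–Schwarz, and the
other is opened as an average over z. -/
lemma norm_expect_der_sq_le {ι : Type} [Fintype ι] {f₀ f₁ : Fin N → ZMod P → ℂ}
    (h₀ : ∀ x y, ‖f₀ x y‖ ≤ 1) (h₁ : ∀ x y, ‖f₁ x y‖ ≤ 1) (n : ι → ZMod P)
    (φ : Fin N → ι → ZMod P) (c : Fin N → ι → ℂ) :
    ‖𝔼 x, 𝔼 p, c x p * fourier (der (dual f₀ f₁ x) (n p) 0) (φ x p)‖ ^ 2 ≤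
      𝔼 p, 𝔼 p', ‖𝔼 x, 𝔼 z, 𝔼 y,
        (c x p * conj (f₀ x (y + n p)) * conj (c x p' * conj (f₀ x (y + n p')))) *
        (conj (f₁ z (y + n p)) * f₁ z (y + n p')) *
        chi ((φ x p - φ x p') * (y + sqDiff P (z : ℕ) (x : ℕ)))‖ := by
  set F := dual f₀ f₁ with hF
  have hF1 : ∀ x y, ‖F x y‖ ≤ 1 := norm_dual_le_one h₀ h₁
  set X : Fin N × Fin N × ZMod P → ι → ℂ := fun s p =>
    c s.1 p * conj (f₀ s.1 (s.2.2 - sqDiff P (s.2.1 : ℕ) (s.1 : ℕ) + n p)) *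
      (conj (f₁ s.2.1 (s.2.2 - sqDiff P (s.2.1 : ℕ) (s.1 : ℕ) + n p))) *
      chi (φ s.1 p * s.2.2) with hX
  have e1 : 𝔼 x, 𝔼 p, c x p * fourier (der (F x) (n p) 0) (φ x p) =
      𝔼 s : Fin N × Fin N × ZMod P, conj (F s.1 s.2.2) * 𝔼 p, X s p := by
    rw [expect_prod']
    refine expect_congr rfl fun x _ => ?_
    simp only [mul_expect]
    symm
    rw [expect_comm]
    refine expect_congr rfl fun p _ => ?_
    rw [expect_prod', expect_comm, fourier, mul_expect]
    refine expect_congr rfl fun y _ => ?_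
    have : F x (y + n p) = 𝔼 z : Fin N, conj (f₀ x (y - sqDiff P (z : ℕ) (x : ℕ) + n p)) *
        conj (f₁ z (y - sqDiff P (z : ℕ) (x : ℕ) + n p)) := by
      rw [hF, dual]
      refine expect_congr rfl fun z _ => ?_
      rw [map_mul, sub_add_eq_add_sub]
    rw [der, this, expect_mul, expect_mul, mul_expect]
    refine expect_congr rfl fun z _ => ?_
    simp only [hX, add_zero]; ring
  rw [e1]
  refine (norm_expect_mul_sq_le _ (fun s => ?_) _).trans ?_
  · rw [RCLike.norm_conj]; exact hF1 _ _
  rw [← Complex.norm_of_nonneg (expect_nonneg fun _ _ => sq_nonneg _ :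
    (0:ℝ) ≤ 𝔼 s, ‖𝔼 p, X s p‖ ^ 2), ofReal_expect]
  simp only [normSq_expect]
  rw [expect_comm]
  refine (norm_expect_le_expect _).trans (expect_mono fun p => ?_)
  rw [expect_comm]
  refine (norm_expect_le_expect _).trans (expect_mono fun p' => le_of_eq (congrArg _ ?_))
  rw [expect_prod']
  refine expect_congr rfl fun x _ => ?_
  rw [expect_prod']
  refine expect_congr rfl fun z _ => ?_
  rw [← expect_translate _ (sqDiff P (z : ℕ) (x : ℕ))]
  refine expect_congr rfl fun y _ => ?_
  simp only [hX, add_sub_cancel_right]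
  rw [sub_mul, sub_eq_add_neg (φ x p * _), chi_add, chi_neg]
  simp only [map_mul, Complex.conj_conj]
  ring

/-- Here the differences φ(x, p) - φ(x, p') are major. With p' chosen for each x and the arc fixed
by pigeonhole, the frequency no longer depends on p. -/
lemma degree_lowering_one : ∃ k : ℕ, ∀ {P N : ℕ} [NeZero P] {T : ℝ}, 100 ≤ T → T ^ k ≤ N →
    P = 8 * N ^ 2 → ∀ {ι : Type} [Fintype ι] (n : ι → ZMod P) {f₀ f₁ : Fin N → ZMod P → ℂ},
    (∀ x y, ‖f₀ x y‖ ≤ 1) → (∀ x y, ‖f₁ x y‖ ≤ 1) →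
    1 / T ≤ 𝔼 x, 𝔼 p, fmax (der (dual f₀ f₁ x) (n p) 0) →
    ∃ ψ : Fin N → ZMod P, 1 / T ^ k ≤
      𝔼 x, 𝔼 p, ‖fourier (der (dual f₀ f₁ x) (n p) 0) (ψ x)‖ ^ 2 := by
  obtain ⟨k, hk⟩ := major_arc_lemma_average
  refine ⟨2 + (4 * k + (4 * k + 1) * 4), ?_⟩
  intro P N _ T hT hTN hP ι _ n f₀ f₁ h₀ h₁ h
  classical
  have hT0 : 0 < T := by linarith
  have hT1 : 1 ≤ T := by linarith
  have hpow : ∀ {m n : ℕ}, m ≤ n → T ^ m ≤ T ^ n := fun h => pow_le_pow_right₀ hT1 h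
  have hN1 : (1 : ℝ) ≤ N := le_trans (one_le_pow₀ hT1) hTN
  have hN : 1 ≤ N := by exact_mod_cast hN1
  have : Nonempty ι := by
    by_contra hne
    rw [not_nonempty_iff] at hne
    simp at h
    linarith
  set F := dual f₀ f₁ with hF
  have hF1 : ∀ x y, ‖F x y‖ ≤ 1 := norm_dual_le_one h₀ h₁
  have h2 : 2 * (1 / T ^ 2) ≤ 1 / T := by
    rw [mul_one_div, div_le_div_iff₀ (by positivity) (by positivity)]; nlinarith
  obtain ⟨φ', c', hc1, hc2, hc3⟩ := exists_weight_of_le_expect_fmax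
    (fun s : Fin N × ι => der (F s.1) (n s.2) 0)
    (fun s => norm_der_le_one (hF1 _) _ _) (η := 1 / T ^ 2) (by positivity)
    (by simp only [expect_prod']; exact h2.trans h)
  set φ : Fin N → ι → ZMod P := fun x i => φ' (x, i) with hφ
  set c : Fin N → ι → ℂ := fun x i => c' (x, i) with hc
  simp only [expect_prod'] at hc3
  have s1 := (pow_le_pow_left₀ (by positivity) hc3 2).trans
    (norm_expect_der_sq_le h₀ h₁ n φ c)
  rw [div_pow, one_pow, ← pow_mul, expect_comm, ← expect_prod' (fun q : ι × ι => ‖𝔼 x, 𝔼 z, 𝔼 y,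
        (c x q.2 * conj (f₀ x (y + n q.2)) * conj (c x q.1 * conj (f₀ x (y + n q.1)))) *
        (conj (f₁ z (y + n q.2)) * f₁ z (y + n q.1)) *
        chi ((φ x q.2 - φ x q.1) * (y + sqDiff P (z : ℕ) (x : ℕ)))‖)] at s1
  have s2 := hk (T := T ^ (2 * 2)) (hT.trans (le_self_pow₀ hT1 (by norm_num)))
    (by rw [← pow_mul]; exact (hpow (by omega)).trans hTN) hP
    (fun (q : ι × ι) x y =>
      c x q.2 * conj (f₀ x (y + n q.2)) * conj (c x q.1 * conj (f₀ x (y + n q.1))))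
    (fun q z y => conj (f₁ z (y + n q.2)) * f₁ z (y + n q.1))
    (fun q x => φ x q.2 - φ x q.1)
    (fun q x => c x q.2 ≠ 0)
    (fun q x y => by
      simp only [norm_mul, RCLike.norm_conj]
      exact mul_le_one₀ (mul_le_one₀ (hc1 _) (norm_nonneg _) (h₀ _ _)) (by positivity)
        (mul_le_one₀ (hc1 _) (norm_nonneg _) (h₀ _ _)))
    (fun q z y => by
      rw [norm_mul, RCLike.norm_conj]; exact mul_le_one₀ (h₁ _ _) (norm_nonneg _) (h₁ _ _))
    (fun q x y hx => by simp only [not_not] at hx; simp [hx]) s1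
  rw [← pow_mul] at s2
  rw [expect_comm] at s2
  simp only [expect_prod'] at s2
  set S := majSet P N (T ^ (2 * 2 * k)) with hS
  have s3 : ∀ x, ∃ q : ι, 𝔼 q : ι, 𝔼 r : ι, (if c x r ≠ 0 ∧ φ x r - φ x q ∈ S then (1 : ℝ) else 0) ≤
      𝔼 r : ι, (if c x r ≠ 0 ∧ φ x r - φ x q ∈ S then (1 : ℝ) else 0) := fun x =>
    exists_le_of_le_expect _ le_rfl
  choose q hq using s3
  have s4 := s2.trans (expect_mono hq)
  rw [← expect_prod' (fun s : Fin N × ι => if c s.1 s.2 ≠ 0 ∧ φ s.1 s.2 - φ s.1 (q s.1) ∈ S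
      then (1 : ℝ) else 0)] at s4
  have hcard : (#S : ℝ) ≤ T ^ ((4 * k + 1) * 4) := by
    have h3 := card_majSet_le (P := P) hN hP (K := T ^ (4 * k + 1)) (hT.trans (le_self_pow₀ hT1 (by omega)))
    rw [← pow_mul] at h3
    refine le_trans ?_ h3
    exact_mod_cast card_le_card fun ξ hξ => mem_majSet.2 ((mem_majSet.1 hξ).mono (hpow (by omega)))
  obtain ⟨σ, -, hσ⟩ := exists_large_fiber S
    (fun s : Fin N × ι => φ s.1 s.2 - φ s.1 (q s.1)) _ (fun s hs => hs.2) (by positivity)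
    (by positivity) hcard s4
  rw [div_div, ← pow_add] at hσ
  refine ⟨fun x => σ + φ x (q x), ?_⟩
  rw [pow_add, ← one_div_mul_one_div, mul_comm]
  refine (mul_le_mul_of_nonneg_right hσ (by positivity)).trans ?_
  rw [expect_mul]
  simp only [expect_prod']
  refine expect_mono fun x => expect_mono fun i => ?_
  split_ifs with hx
  · obtain ⟨⟨hx1, -⟩, hx2⟩ := hx
    rw [one_mul]
    have h4 := hc2 (x, i) hx1
    have h5 : φ' (x, i) = σ + φ x (q x) := by
      rw [← hx2]; simp only [hφ]; ring
    rw [h5] at h4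
    exact h4
  · rw [zero_mul]; positivity

/-- With no derivative left, opening F directly yields a quadratic phase of frequency φ(x). So φ(x)
itself is major for many x, and pigeonhole selects one value. -/
lemma degree_lowering_zero : ∃ k : ℕ, ∀ {P N : ℕ} [NeZero P] {T : ℝ}, 100 ≤ T → T ^ k ≤ N →
    P = 8 * N ^ 2 → ∀ {f₀ f₁ : Fin N → ZMod P → ℂ},
    (∀ x y, ‖f₀ x y‖ ≤ 1) → (∀ x y, ‖f₁ x y‖ ≤ 1) →
    1 / T ≤ 𝔼 x, fmax (dual f₀ f₁ x) →
    ∃ ξ ∈ majSet P N (T ^ k), 1 / T ^ k ≤ 𝔼 x, ‖fourier (dual f₀ f₁ x) ξ‖ ^ 2 := by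
  obtain ⟨k, hk⟩ := major_arc_lemma
  refine ⟨2 + (2 * k + (2 * k + 1) * 4), ?_⟩
  intro P N _ T hT hTN hP f₀ f₁ h₀ h₁ h
  classical
  have hT0 : 0 < T := by linarith
  have hT1 : 1 ≤ T := by linarith
  have hpow : ∀ {m n : ℕ}, m ≤ n → T ^ m ≤ T ^ n := fun h => pow_le_pow_right₀ hT1 h
  have hN1 : (1 : ℝ) ≤ N := le_trans (one_le_pow₀ hT1) hTN
  have hN : 1 ≤ N := by exact_mod_cast hN1
  set F := dual f₀ f₁ with hF
  have hF1 : ∀ x y, ‖F x y‖ ≤ 1 := norm_dual_le_one h₀ h₁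
  have h2 : 2 * (1 / T ^ 2) ≤ 1 / T := by
    rw [mul_one_div, div_le_div_iff₀ (by positivity) (by positivity)]; nlinarith
  obtain ⟨φ, c, hc1, hc2, hc3⟩ := exists_weight_of_le_expect_fmax F hF1 (η := 1 / T ^ 2)
    (by positivity) (h2.trans h)
  have e1 : 𝔼 x, c x * fourier (F x) (φ x) = 𝔼 x, 𝔼 z : Fin N, 𝔼 y, (c x * conj (f₀ x y)) *
      conj (f₁ z y) * chi (φ x * (y + sqDiff P (z : ℕ) (x : ℕ))) := by
    refine expect_congr rfl fun x _ => ?_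
    simp only [fourier, hF, dual, mul_expect, expect_mul]
    rw [expect_comm]
    refine expect_congr rfl fun z _ => ?_
    rw [← expect_translate _ (sqDiff P (z : ℕ) (x : ℕ))]
    refine expect_congr rfl fun y _ => ?_
    rw [add_sub_cancel_right, map_mul]; ring
  rw [e1] at hc3
  have s2 := hk (T := T ^ 2) (hT.trans (le_self_pow₀ hT1 (by norm_num)))
    (by rw [← pow_mul]; exact (hpow (by omega)).trans hTN) hP (fun x y => c x * conj (f₀ x y))
    (fun z y => conj (f₁ z y)) φ (fun x => c x ≠ 0)
    (fun x y => by
      rw [norm_mul, RCLike.norm_conj]; exact mul_le_one₀ (hc1 _) (norm_nonneg _) (h₀ _ _))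
    (fun z y => by rw [RCLike.norm_conj]; exact h₁ _ _)
    (fun x y hx => by simp only [not_not] at hx; simp [hx]) hc3
  rw [← pow_mul] at s2
  set S := majSet P N (T ^ (2 * k)) with hS
  have hcard : (#S : ℝ) ≤ T ^ ((2 * k + 1) * 4) := by
    have h3 := card_majSet_le (P := P) hN hP (K := T ^ (2 * k + 1)) (hT.trans (le_self_pow₀ hT1 (by omega)))
    rw [← pow_mul] at h3
    refine le_trans ?_ h3
    exact_mod_cast card_le_card fun ξ hξ => mem_majSet.2 ((mem_majSet.1 hξ).mono (hpow (by omega)))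
  obtain ⟨ξ, hξ, hσ⟩ := exists_large_fiber S φ _ (fun s hs => hs.2) (by positivity)
    (by positivity) hcard s2
  rw [div_div, ← pow_add] at hσ
  refine ⟨ξ, mem_majSet.2 ((mem_majSet.1 hξ).mono (hpow (by omega))), ?_⟩
  rw [pow_add, ← one_div_mul_one_div, mul_comm]
  refine (mul_le_mul_of_nonneg_right hσ (by positivity)).trans ?_
  rw [expect_mul]
  refine expect_mono fun x => ?_
  split_ifs with hx
  · obtain ⟨⟨hx1, -⟩, hx2⟩ := hx
    rw [one_mul, ← hx2]
    exact hc2 x hx1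
  · rw [zero_mul]; positivity

end DegreeLowering

/-! ### From a large dual function to one major arc frequency -/

section Combine
variable {P N M : ℕ} [NeZero P]

/-- PET induction and concatenation, with polynomial dependence on the parameters. -/
lemma exists_le_expect_fmax_der_der : ∃ k : ℕ, ∀ {P N : ℕ} [NeZero P] {T : ℝ}, 100 ≤ T → T ^ k ≤ N →
    P = 8 * N ^ 2 → ∀ {f₀ f₁ F : Fin N → ZMod P → ℂ}, (∀ x y, ‖f₀ x y‖ ≤ 1) →
    (∀ x y, ‖f₁ x y‖ ≤ 1) → (∀ x y, ‖F x y‖ ≤ 1) → 1 / T ≤ ‖cyclicCount f₀ f₁ F‖ →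
    ∃ M : ℕ, 1 ≤ M ∧ (N : ℝ) ≤ T ^ k * M ∧ 1 / T ^ k ≤ 𝔼 x, 𝔼 i, 𝔼 j,
      fmax (der (der (F x) 0 (shiftParam P N M i)) 0 (shiftParam P N M j)) := by
  refine ⟨6300, ?_⟩
  intro P N _ T hT hTN hP f₀ f₁ F h₀ h₁ hF h
  have hT0 : 0 < T := by linarith
  have hT1 : 1 ≤ T := by linarith
  have hpow : ∀ {m n : ℕ}, m ≤ n → T ^ m ≤ T ^ n := fun h => pow_le_pow_right₀ hT1 h
  have hstep : ∀ (c : ℝ) (n m : ℕ), c ≤ 100 → m = n + 1 → c * T ^ n ≤ T ^ m := fun c n m hc hm => by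
    rw [hm, pow_succ, mul_comm (T ^ n)]; gcongr; linarith
  have hN1 : (1 : ℝ) ≤ N := le_trans (one_le_pow₀ hT1) hTN
  have hN : 1 ≤ N := by exact_mod_cast hN1
  -- The error 11/L must be smaller than (T⁻⁵)¹²⁸ = T⁻⁶⁴⁰. Taking M about N/L² then makes 12M/N
  -- negligible and keeps N/M at most T¹⁴⁰³.
  set L : ℕ := ⌈T ^ 700⌉₊ with hL
  have hL1 : T ^ 700 ≤ L := Nat.le_ceil _
  have hL2 : (L : ℝ) ≤ T ^ 701 := by
    have h1 : (L : ℝ) ≤ T ^ 700 + 1 := (Nat.ceil_lt_add_one (by positivity)).le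
    have h2 : (1 : ℝ) ≤ T ^ 700 := one_le_pow₀ hT1
    have := hstep 2 700 701 (by norm_num) rfl
    linarith
  have hLr : (100 : ℝ) ≤ L := (hT.trans (le_self_pow₀ hT1 (by norm_num))).trans hL1
  have hL3 : 2 ≤ L := by
    have : (2 : ℝ) ≤ L := by linarith
    exact_mod_cast this
  have hLsq : (L : ℝ) ^ 2 ≤ T ^ 1402 := by
    rw [show (1402 : ℕ) = 701 * 2 by norm_num, pow_mul]; gcongr
  have hL0 : (0 : ℝ) < L := by linarith
  have hLN : L ^ 2 ≤ N := by
    have : (L : ℝ) ^ 2 ≤ N := hLsq.trans ((hpow (by norm_num)).trans hTN)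
    exact_mod_cast this
  set M := N / L ^ 2 with hM
  have hM1 : 1 ≤ M := Nat.div_pos hLN (by positivity)
  have hML : M * L ^ 2 ≤ N := Nat.div_mul_le_self _ _
  have hM0 : (0 : ℝ) < M := by exact_mod_cast hM1
  have hNM : (N : ℝ) ≤ T ^ 1403 * M := by
    have h1 : N < L ^ 2 * (M + 1) := Nat.lt_mul_div_succ N (by positivity)
    have h2 : N ≤ 2 * (L ^ 2 * M) := by nlinarith [Nat.one_le_pow 2 L (by omega)]
    have h3 : (N : ℝ) ≤ 2 * (L ^ 2 * M) := by exact_mod_cast h2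
    have := hstep 2 1402 1403 (by norm_num) rfl
    calc (N : ℝ) ≤ 2 * (T ^ 1402 * M) := h3.trans (by gcongr)
      _ = 2 * T ^ 1402 * M := by ring
      _ ≤ T ^ 1403 * M := by gcongr
  refine ⟨M, hM1, hNM.trans (mul_le_mul_of_nonneg_right (hpow (by norm_num)) hM0.le), ?_⟩
  have hN0 : (0 : ℝ) < N := by linarith
  have hε : 1 / T ^ 5 + 12 * M / N ≤ ‖cyclicCount f₀ f₁ F‖ ^ 4 := by
    have h1 : (12 * M / N : ℝ) ≤ 12 / T ^ 700 := by
      rw [div_le_div_iff₀ hN0 (by positivity)]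
      have h3 : (M * L ^ 2 : ℝ) ≤ N := by exact_mod_cast hML
      have h4 : T ^ 700 ≤ (L : ℝ) ^ 2 := hL1.trans (le_self_pow₀ (by linarith) (by norm_num))
      nlinarith [mul_le_mul_of_nonneg_left h4 hM0.le]
    have h2 : (12 / T ^ 700 : ℝ) ≤ 12 / T ^ 5 :=
      div_le_div_of_nonneg_left (by norm_num) (by positivity) (hpow (by norm_num))
    have h3 : 1 / T ^ 5 + 12 / T ^ 5 ≤ 1 / T ^ 4 := by
      rw [← add_div, div_le_div_iff₀ (by positivity) (by positivity)]
      have := hstep 13 4 5 (by norm_num) rfl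
      linarith
    have h4 : 1 / T ^ 4 ≤ ‖cyclicCount f₀ f₁ F‖ ^ 4 := by
      rw [← one_div_pow]; exact pow_le_pow_left₀ (by positivity) h 4
    linarith
  have s1 := le_expect_fmax_der_der hN hP hM1 hL3 hML h₀ h₁ hF (by positivity) hε
  set X := 𝔼 x, 𝔼 i, 𝔼 j,
      fmax (der (der (F x) 0 (shiftParam P N M i)) 0 (shiftParam P N M j)) with hX
  have hX0 : 0 ≤ X := expect_nonneg fun _ _ => expect_nonneg fun _ _ => expect_nonneg fun _ _ =>
    fmax_nonneg _
  have s2 : (11 / L : ℝ) ≤ 11 / T ^ 641 :=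
    div_le_div_of_nonneg_left (by norm_num) (by positivity) ((hpow (by norm_num)).trans hL1)
  have s3 : 1 / T ^ 641 + 11 / T ^ 641 ≤ (1 / T ^ 5) ^ 128 := by
    rw [one_div_pow, ← pow_mul, ← add_div, div_le_div_iff₀ (by positivity) (by positivity)]
    have := hstep 12 640 641 (by norm_num) rfl
    norm_num at this ⊢
    linarith
  have s4 : (N / M : ℝ) ^ 4 ≤ T ^ 5612 := by
    have : (N / M : ℝ) ≤ T ^ 1403 := by rw [div_le_iff₀ hM0]; exact hNM
    rw [show (5612 : ℕ) = 1403 * 4 by norm_num, pow_mul]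
    gcongr
  have s5 : 1 / T ^ 641 ≤ 100 * T ^ 5613 * X := by
    have h1 : 4096 * (N / M : ℝ) ^ 4 * X ≤ 100 * T ^ 5613 * X := by
      have := hstep 100 5612 5613 le_rfl rfl
      have h2 : 4096 * (N / M : ℝ) ^ 4 ≤ 4096 * T ^ 5612 := by gcongr
      refine mul_le_mul_of_nonneg_right (h2.trans ?_) hX0
      linarith [pow_pos hT0 5612]
    linarith
  refine le_trans ?_ (inv_pow_le_of_mul_le hT s5)
  exact one_div_le_one_div_of_le (by positivity) (hpow (by norm_num))

/-- For fixed k the parameter is bilinear in k and a difference c - c', so the average over c and c'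
is the square of a geometric average. -/
lemma norm_expect_chi_shiftParam_le (σ : ZMod P) :
    ‖𝔼 i, chi (σ * shiftParam P N M i)‖ ≤ 𝔼 k : Fin (4 * N), ‖𝔼 c : Fin M,
      e (((c : ℕ) : ℤ) • ((((k : ℕ) : ℤ) - 2 * N) • (2 • ZMod.toAddCircle σ)))‖ := by
  rw [expect_prod']
  refine (norm_expect_le_expect _).trans (expect_mono fun k => ?_)
  have e1 : 𝔼 j : Fin M × Fin M, chi (σ * shiftParam P N M (k, j)) = ((‖𝔼 c : Fin M,
      e (((c : ℕ) : ℤ) • ((((k : ℕ) : ℤ) - 2 * N) • (2 • ZMod.toAddCircle σ)))‖ ^ 2 : ℝ) : ℂ) := by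
    rw [normSq_expect, expect_prod']
    refine expect_congr rfl fun c _ => expect_congr rfl fun c' _ => ?_
    rw [← e_neg, ← e_add, shiftParam, chi_mul_intCast]
    congr 1
    dsimp only
    module
  rw [e1, Complex.norm_of_nonneg (sq_nonneg _), sq]
  exact mul_le_of_le_one_left (norm_nonneg _) (norm_expect_le_one _ fun c => by rw [norm_e])

/-- Character averages along `shiftParam` are small off the major arcs. -/
lemma norm_expect_chi_shiftParam_sq_le {T : ℝ} (hT : 100 ≤ T) (hTN : T ^ 19 ≤ N) (hM : 1 ≤ M)
    (hNM : (N : ℝ) ≤ T * M) {σ : ZMod P} (hσ : σ ∉ majSet P N (T ^ 19)) :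
    ‖𝔼 i, chi (σ * shiftParam P N M i)‖ ^ 2 ≤ 1 / T := by
  by_contra! hcon
  refine hσ (mem_majSet.2 ?_)
  have hT0 : 0 < T := by linarith
  have hT1 : 1 ≤ T := by linarith
  have hN1 : (1 : ℝ) ≤ N := le_trans (one_le_pow₀ hT1) hTN
  have hN : 1 ≤ N := by exact_mod_cast hN1
  have hM0 : (0 : ℝ) < M := by exact_mod_cast hM
  set β := 2 • ZMod.toAddCircle σ with hβ
  set a : Fin (4 * N) → ℝ := fun k => ‖𝔼 c : Fin M,
      e (((c : ℕ) : ℤ) • ((((k : ℕ) : ℤ) - 2 * N) • β))‖ with ha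
  have ha1 : ∀ k, a k ≤ 1 := fun k => norm_expect_le_one _ fun c => by rw [norm_e]
  have s1 : 1 / T ≤ 𝔼 k, a k := by
    refine le_trans ?_ (norm_expect_chi_shiftParam_le σ)
    refine hcon.le.trans ?_
    rw [sq]
    refine mul_le_of_le_one_left (norm_nonneg _) (norm_expect_le_one _ fun c => by rw [norm_chi])
  have s2 := le_expect_ite ha1 (c := 1 / (2 * T)) (by positivity)
    (le_trans (le_of_eq (by field_simp)) s1)
  rw [expect_boole_eq, Fintype.card_fin] at s2
  -- Each n = k - 2N with a large geometric average satisfies ‖nβ‖ ≤ 2T/M, and N ≤ TM turns this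
  -- into T³/(4N), the form needed on an interval of length 4N.
  set S : Finset ℤ := ({k : Fin (4 * N) | 1 / (2 * T) ≤ a k} : Finset _).image
    (fun k : Fin (4 * N) => ((k : ℕ) : ℤ) - 2 * N) with hS
  have hcardS : #S = #{k : Fin (4 * N) | 1 / (2 * T) ≤ a k} := by
    refine card_image_of_injective _ fun k k' h => ?_
    ext; simpa using h
  rw [← hcardS, div_le_div_iff₀ (by positivity) (by positivity)] at s2
  have hT3 : 2 * T ≤ T ^ 3 := by nlinarith [pow_pos hT0 2, pow_two T, pow_succ T 2]
  have s3 := isMaj_of_many (N := 4 * N) (T := T ^ 3) (a := -2 * N) (S := S) (β := β)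
    (hT.trans (le_self_pow₀ hT1 (by norm_num)))
    (by
      rw [← pow_mul]; push_cast
      refine (pow_le_pow_right₀ hT1 (by norm_num : 3 * 4 ≤ 19)).trans ?_
      linarith)
    (by
      intro n hn
      rw [hS, mem_image] at hn
      obtain ⟨k, -, rfl⟩ := hn
      rw [mem_Ico]
      have := k.2
      constructor <;> push_cast <;> omega)
    (by
      have : 2 * T * (#S : ℝ) ≤ T ^ 3 * #S := by gcongr
      linarith)
    (by
      intro n hn
      rw [hS, mem_image] at hn
      obtain ⟨k, hk, rfl⟩ := hn
      have h1 := norm_le_of_le_norm_expect_geom hM (by positivity) _ (mem_filter.1 hk).2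
      refine h1.trans ?_
      push_cast
      rw [div_le_div_iff₀ (by positivity) (by positivity)]
      have h2 : 8 * T ^ 2 ≤ T ^ 3 := by nlinarith [pow_pos hT0 2, pow_succ T 2]
      have h3 : T ^ 3 * (1 / (2 * T) * M) = T ^ 2 * M / 2 := by field_simp
      rw [h3]
      have h4 : 8 * N ≤ T ^ 2 * M := by nlinarith
      linarith)
  have s4 := (s3.of_le hN (by omega : 1 ≤ 4 * N) le_rfl (by push_cast; linarith)).of_nsmul
    (by norm_num : 1 ≤ 2)
  refine s4.mono ?_
  rw [← pow_mul, one_pow, one_mul, show (19 : ℕ) = 3 * 6 + 1 by norm_num, pow_succ T (3 * 6), mul_comm]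
  gcongr
  push_cast
  linarith

/-- Off the major arcs the shifts `shiftParam` have small character averages; on them each average
is at most 1, and there are at most (T¹⁹)⁴ = T⁷⁶ frequencies. -/
lemma expect_correlation_le {T : ℝ} (hT : 100 ≤ T) (hTN : T ^ 19 ≤ N) (hP : P = 8 * N ^ 2) (hM : 1 ≤ M)
    (hNM : (N : ℝ) ≤ T * M) {u v : ZMod P → ℂ} (hu : ∀ y, ‖u y‖ ≤ 1) (hv : ∀ y, ‖v y‖ ≤ 1)
    {s : ℝ} (hs : ∀ ξ, ‖fourier u ξ‖ ^ 2 ≤ s) (hs' : ∀ ξ, ‖fourier v ξ‖ ^ 2 ≤ s) :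
    𝔼 j, 𝔼 j', ‖𝔼 y, u (y + shiftParam P N M j) * conj (v (y + shiftParam P N M j'))‖ ^ 2 ≤
      1 / T + T ^ 76 * s := by
  have hT0 : 0 < T := by linarith
  have hT1 : 1 ≤ T := by linarith
  have hN1 : (1 : ℝ) ≤ N := le_trans (one_le_pow₀ hT1) hTN
  have hN : 1 ≤ N := by exact_mod_cast hN1
  refine (expect_expect_norm_sq_le_of_small hu hv (shiftParam P N M) hs hs' (majSet P N (T ^ 19))
    fun σ hσ => norm_expect_chi_shiftParam_sq_le hT hTN hM hNM hσ).trans ?_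
  rw [max_eq_left (by positivity), mul_comm]
  have hs0 : 0 ≤ s := (sq_nonneg _).trans (hs 0)
  gcongr
  refine (sum_le_card_nsmul _ _ 1 fun σ _ => norm_sq_le_one (norm_expect_le_one _ fun i => by
    rw [norm_chi])).trans ?_
  rw [nsmul_eq_mul, mul_one, show (76 : ℕ) = 19 * 4 by norm_num, pow_mul]
  exact card_majSet_le hN hP (hT.trans (le_self_pow₀ hT1 (by norm_num)))

/-- This is why a large L² norm of the dual function already makes a count large, with the dual
function itself in the third slot. -/
lemma cyclicCount_dual (f₀ f₁ : Fin N → ZMod P → ℂ) :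
    cyclicCount f₀ f₁ (dual f₀ f₁) = ((𝔼 x, 𝔼 y, ‖dual f₀ f₁ x y‖ ^ 2 : ℝ) : ℂ) := by
  simp only [cyclicCount, ofReal_expect]
  refine expect_congr rfl fun x _ => ?_
  have e1 : ∀ z : Fin N, 𝔼 y, f₀ x y * f₁ z y * dual f₀ f₁ x (y + sqDiff P (z : ℕ) (x : ℕ)) =
      𝔼 y, f₀ x (y - sqDiff P (z : ℕ) (x : ℕ)) * f₁ z (y - sqDiff P (z : ℕ) (x : ℕ)) *
        dual f₀ f₁ x y := fun z => by
    rw [← expect_translate (fun y => f₀ x (y - _) * _ * _) (sqDiff P (z : ℕ) (x : ℕ))]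
    simp only [add_sub_cancel_right]
  simp only [e1]
  rw [expect_comm]
  refine expect_congr rfl fun y _ => ?_
  rw [← expect_mul, ← Complex.normSq_eq_norm_sq, ← Complex.mul_conj, mul_comm]
  congr 1
  rw [dual, conj_expect]
  simp only [Complex.conj_conj]

lemma der_sub_zero {P : ℕ} (F : ZMod P → ℂ) (a b y : ZMod P) : der F (a - b) 0 (y + b) = der F a b y := by
  simp only [der, add_zero]
  congr 2
  ring

lemma fmax_der (F : ZMod P → ℂ) (a b : ZMod P) : fmax (der F (a - b) 0) = fmax (der F a b) := by
  rw [← fmax_translate _ b]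
  simp only [der_sub_zero]

/-- Modulating the second factor hides the frequency, so correlation bounds for two different
functions u and v apply. -/
lemma norm_fourier_der (F : ZMod P → ℂ) (a b ξ : ZMod P) :
    ‖fourier (der F (a - b) 0) ξ‖ =
      ‖𝔼 y, F (y + a) * conj (F (y + b) * conj (chi (ξ * (y + b))))‖ := by
  rw [fourier, ← expect_translate _ b]
  congr 1
  refine expect_congr rfl fun y _ => ?_
  rw [der_sub_zero, der, map_mul, Complex.conj_conj]; ring

/-- As r ≥ n + 1, the error 1/T^r is at most a hundredth of the left side and can be dropped. -/
lemma inv_pow_le_of_le_add {T X : ℝ} {n r : ℕ} (hT : 100 ≤ T) (hnr : n + 1 ≤ r)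
    (h : 1 / T ^ n ≤ 1 / T ^ r + (T ^ r) ^ 76 * X) : 1 / T ^ (r + r * 76 + 1) ≤ X := by
  have hT0 : 0 < T := by linarith
  refine inv_pow_le_of_mul_le hT ?_
  have h1 : 101 * (1 / T ^ r) ≤ 100 * (1 / T ^ n) := by
    have h2 : 1 / T ^ r ≤ 1 / T ^ (n + 1) :=
      one_div_le_one_div_of_le (by positivity) (pow_le_pow_right₀ (by linarith) hnr)
    have h3 : 1 / T ^ (n + 1) * T = 1 / T ^ n := by rw [pow_succ]; field_simp
    have h4 : 0 < 1 / T ^ (n + 1) := by positivity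
    nlinarith
  rw [← pow_mul] at h
  linarith

/-- The inner average over j and j' is a self-correlation of a first derivative along spread-out
shifts, so `expect_correlation_le` bounds it by the largest Fourier coefficient of that derivative.
-/
lemma le_expect_fmax_der_of_correlation {T : ℝ} {n r : ℕ} (hT : 100 ≤ T) (hTN : T ^ (r * 19) ≤ N)
    (hP : P = 8 * N ^ 2) (hM : 1 ≤ M) (hNM : (N : ℝ) ≤ T ^ r * M) (hnr : n + 1 ≤ r)
    {F : Fin N → ZMod P → ℂ} (hF : ∀ x y, ‖F x y‖ ≤ 1)
    (h : 1 / T ^ n ≤ 𝔼 x, 𝔼 i, 𝔼 i', 𝔼 j, 𝔼 j', ‖𝔼 y,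
      der (F x) (shiftParam P N M i) (shiftParam P N M i') (y + shiftParam P N M j) *
        conj (der (F x) (shiftParam P N M i) (shiftParam P N M i') (y + shiftParam P N M j'))‖ ^ 2) :
    1 / T ^ (r + r * 76 + 1) ≤ 𝔼 x, 𝔼 p : _ × _,
      fmax (der (F x) (shiftParam P N M p.1 - shiftParam P N M p.2) 0) := by
  have hT0 : 0 < T := by linarith
  have hT1 : 1 ≤ T := by linarith
  refine inv_pow_le_of_le_add hT hnr (h.trans ?_)
  refine (expect_mono fun x => expect_mono fun i => expect_mono fun i' =>
    expect_correlation_le (hT.trans (le_self_pow₀ hT1 (by omega : r ≠ 0)))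
      (by rwa [← pow_mul]) hP hM hNM (norm_der_le_one (hF x) _ _) (norm_der_le_one (hF x) _ _)
      (le_fmax _) (le_fmax _)).trans ?_
  simp only [expect_add_distrib, ← mul_expect]
  refine add_le_add ?_ (le_of_eq (congrArg _ (expect_congr rfl fun x _ => ?_)))
  · exact expect_le_of_le _ (by positivity) fun _ => expect_le_of_le _ (by positivity) fun _ =>
      expect_le_of_le _ (by positivity) fun _ => le_rfl
  · simp only [fmax_der]
    exact (expect_prod fun i i' => fmax (der (F x) (shiftParam P N M i) (shiftParam P N M i'))).symm

/-- Since ψ does not depend on p, the average over p is a correlation of F with a modulation of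
itself, whose Fourier coefficients are those of F shifted by ψ x. -/
lemma le_expect_fmax_of_correlation {T : ℝ} {n r : ℕ} (hT : 100 ≤ T) (hTN : T ^ (r * 19) ≤ N)
    (hP : P = 8 * N ^ 2) (hM : 1 ≤ M) (hNM : (N : ℝ) ≤ T ^ r * M) (hnr : n + 1 ≤ r)
    {F : Fin N → ZMod P → ℂ} (hF : ∀ x y, ‖F x y‖ ≤ 1) (ψ : Fin N → ZMod P)
    (h : 1 / T ^ n ≤ 𝔼 x, 𝔼 p : _ × _,
      ‖fourier (der (F x) (shiftParam P N M p.1 - shiftParam P N M p.2) 0) (ψ x)‖ ^ 2) :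
    1 / T ^ (r + r * 76 + 1) ≤ 𝔼 x, fmax (F x) := by
  have hT0 : 0 < T := by linarith
  have hT1 : 1 ≤ T := by linarith
  refine inv_pow_le_of_le_add hT hnr (h.trans ?_)
  have h1 : ∀ x, 𝔼 p : _ × _,
      ‖fourier (der (F x) (shiftParam P N M p.1 - shiftParam P N M p.2) 0) (ψ x)‖ ^ 2 ≤
      1 / T ^ r + (T ^ r) ^ 76 * fmax (F x) := by
    intro x
    rw [expect_prod']
    simp only [norm_fourier_der]
    refine expect_correlation_le (u := F x) (v := fun y => F x y * conj (chi (ψ x * y)))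
      (hT.trans (le_self_pow₀ hT1 (by omega : r ≠ 0)))
      (by rwa [← pow_mul]) hP hM hNM (hF x) (fun y => ?_) (le_fmax _) fun ξ => ?_
    · rw [norm_mul, RCLike.norm_conj, norm_chi, mul_one]; exact hF x y
    · have : fourier (fun y => F x y * conj (chi (ψ x * y))) ξ = fourier (F x) (ξ - ψ x) := by
        refine expect_congr rfl fun y _ => ?_
        dsimp only
        rw [← chi_neg, mul_assoc, ← chi_add]; congr 2; ring
      rw [this]
      exact le_fmax _ _
  refine (expect_mono h1).trans ?_
  simp only [expect_add_distrib, ← mul_expect]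
  gcongr
  exact expect_le_of_le _ (by positivity) fun _ => le_rfl

/-- If the dual function is large in `L²`, then it correlates with a character whose frequency
lies on a major arc and does not depend on `x`. -/
lemma exists_major_frequency : ∃ k : ℕ, ∀ {P N : ℕ} [NeZero P] {T : ℝ}, 100 ≤ T → T ^ k ≤ N →
    P = 8 * N ^ 2 → ∀ {f₀ f₁ : Fin N → ZMod P → ℂ},
    (∀ x y, ‖f₀ x y‖ ≤ 1) → (∀ x y, ‖f₁ x y‖ ≤ 1) →
    1 / T ≤ 𝔼 x, 𝔼 y, ‖dual f₀ f₁ x y‖ ^ 2 →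
    ∃ ξ ∈ majSet P N (T ^ k), 1 / T ^ k ≤ 𝔼 x, ‖fourier (dual f₀ f₁ x) ξ‖ ^ 2 := by
  obtain ⟨a, ha⟩ := exists_le_expect_fmax_der_der
  obtain ⟨b, hb⟩ := degree_lowering_two
  obtain ⟨c, hc⟩ := degree_lowering_one
  obtain ⟨d, hd⟩ := degree_lowering_zero
  -- At each lowering r must exceed the incoming exponent, so that the error 1/T^r is negligible,
  -- and exceed a, so that N ≤ T^r M. The outgoing exponent is r + 76r + 1.
  obtain ⟨r₁, hr₁⟩ : ∃ r, r = (a + 1) * b + a + 1 := ⟨_, rfl⟩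
  obtain ⟨r₂, hr₂⟩ : ∃ r, r = r₁ + r₁ * 76 + 1 := ⟨_, rfl⟩
  obtain ⟨r₃, hr₃⟩ : ∃ r, r = r₂ * c + a + 1 := ⟨_, rfl⟩
  obtain ⟨r₄, hr₄⟩ : ∃ r, r = r₃ + r₃ * 76 + 1 := ⟨_, rfl⟩
  refine ⟨a + (a + 1) * b + r₁ * 19 + r₂ * c + r₃ * 19 + r₄ * d, ?_⟩
  intro P N _ T hT hTN hP f₀ f₁ h₀ h₁ h
  have hT0 : 0 < T := by linarith
  have hT1 : 1 ≤ T := by linarith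
  have hpow : ∀ {m n : ℕ}, m ≤ n → T ^ m ≤ T ^ n := fun h => pow_le_pow_right₀ hT1 h
  have hinv : ∀ {m n : ℕ}, m ≤ n → 1 / T ^ n ≤ 1 / T ^ m := fun h =>
    one_div_le_one_div_of_le (by positivity) (hpow h)
  have h100 : ∀ {n : ℕ}, n ≠ 0 → 100 ≤ T ^ n := fun h => hT.trans (le_self_pow₀ hT1 h)
  have hN1 : (1 : ℝ) ≤ N := le_trans (one_le_pow₀ hT1) hTN
  have hN : 1 ≤ N := by exact_mod_cast hN1
  have hle : ∀ {m : ℕ}, m ≤ a + (a + 1) * b + r₁ * 19 + r₂ * c + r₃ * 19 + r₄ * d → T ^ m ≤ N :=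
    fun h => (hpow h).trans hTN
  set F := dual f₀ f₁ with hF
  have hF1 : ∀ x y, ‖F x y‖ ≤ 1 := norm_dual_le_one h₀ h₁
  have h0 : (0:ℝ) ≤ 𝔼 x, 𝔼 y, ‖F x y‖ ^ 2 := expect_nonneg fun _ _ => expect_nonneg fun _ _ => sq_nonneg _
  obtain ⟨M, hM, hNM, s1⟩ := ha hT (hle (by omega)) hP h₀ h₁ hF1
    (by rw [cyclicCount_dual, Complex.norm_of_nonneg h0]; exact h)
  set m := shiftParam P N M with hm
  have hNM' : ∀ {n : ℕ}, a ≤ n → (N : ℝ) ≤ T ^ n * M := fun h =>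
    hNM.trans (mul_le_mul_of_nonneg_right (hpow h) (by positivity))
  have s2 := hb (T := T ^ (a + 1)) (h100 (by omega)) (by rw [← pow_mul]; exact hle (by omega)) hP m h₀ h₁
    ((hinv (by omega)).trans s1)
  rw [← pow_mul] at s2
  have s3 : 1 / T ^ r₂ ≤ 𝔼 x, 𝔼 p : _ × _, fmax (der (F x) (m p.1 - m p.2) 0) := by
    rw [hr₂]
    exact le_expect_fmax_der_of_correlation hT (hle (by omega)) hP hM (hNM' (by omega))
      (n := (a + 1) * b) (by omega) hF1 s2
  obtain ⟨ψ, s4⟩ := hc (T := T ^ r₂) (h100 (by omega)) (by rw [← pow_mul]; exact hle (by omega)) hP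
    (fun p : (Fin (4 * N) × Fin M × Fin M) × (Fin (4 * N) × Fin M × Fin M) => m p.1 - m p.2) h₀ h₁ s3
  rw [← pow_mul] at s4
  have s5 : 1 / T ^ r₄ ≤ 𝔼 x, fmax (F x) := by
    rw [hr₄]
    exact le_expect_fmax_of_correlation hT (hle (by omega)) hP hM (hNM' (by omega))
      (n := r₂ * c) (by omega) hF1 ψ s4
  obtain ⟨ξ, hξ, s6⟩ := hd (T := T ^ r₄) (h100 (by omega)) (by rw [← pow_mul]; exact hle (by omega)) hP
    h₀ h₁ s5
  rw [← pow_mul] at s6 hξ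
  exact ⟨ξ, mem_majSet.2 ((mem_majSet.1 hξ).mono (hpow (by omega))), (hinv (by omega)).trans s6⟩

end Combine

/-! ### The inverse theorem in the cyclic model -/

section CyclicInverse
variable {P N M : ℕ} [NeZero P]

/-- The dual function of the cyclic counting operator in its second argument, conjugated. -/
noncomputable def colAvg (f₀ f₂ : Fin N → ZMod P → ℂ) (z : ℤ) (y : ZMod P) : ℂ :=
  𝔼 x : Fin N, f₀ x y * f₂ x (y + sqDiff P z (x : ℕ))

/-- A weighted average of the quadratic phases of frequency `ξ`. -/
noncomputable def phaseAvg (g : Fin N → ZMod P → ℂ) (ξ : ZMod P) (z : ℤ) (y : ZMod P) : ℂ :=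
  𝔼 x : Fin N, g x y * chi (ξ * (y + sqDiff P z (x : ℕ)))

lemma norm_colAvg_le_one {P : ℕ} {f₀ f₂ : Fin N → ZMod P → ℂ} (h₀ : ∀ x y, ‖f₀ x y‖ ≤ 1)
    (h₂ : ∀ x y, ‖f₂ x y‖ ≤ 1) (z : ℤ) (y : ZMod P) : ‖colAvg f₀ f₂ z y‖ ≤ 1 :=
  norm_expect_le_one _ fun x => by rw [norm_mul]; exact mul_le_one₀ (h₀ _ _) (norm_nonneg _) (h₂ _ _)

lemma norm_phaseAvg_le_one {g : Fin N → ZMod P → ℂ} (hg : ∀ x y, ‖g x y‖ ≤ 1) (ξ : ZMod P) (z : ℤ)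
    (y : ZMod P) : ‖phaseAvg g ξ z y‖ ≤ 1 :=
  norm_expect_le_one _ fun x => by rw [norm_mul, norm_chi, mul_one]; exact hg _ _

lemma cyclicCount_eq_colAvg (f₀ f₁ f₂ : Fin N → ZMod P → ℂ) :
    cyclicCount f₀ f₁ f₂ = 𝔼 p : Fin N × ZMod P, f₁ p.1 p.2 * colAvg f₀ f₂ (p.1 : ℕ) p.2 := by
  rw [cyclicCount, expect_prod', expect_comm]
  refine expect_congr rfl fun z _ => ?_
  rw [expect_comm]
  refine expect_congr rfl fun y _ => ?_
  rw [colAvg, mul_expect]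
  exact expect_congr rfl fun x _ => by ring

lemma cyclicCount_eq_dual (f₀ f₁ f₂ : Fin N → ZMod P → ℂ) :
    cyclicCount f₀ f₁ f₂ = 𝔼 p : Fin N × ZMod P, f₂ p.1 p.2 * conj (dual f₀ f₁ p.1 p.2) := by
  rw [cyclicCount, expect_prod']
  refine expect_congr rfl fun x _ => ?_
  simp only [dual, conj_expect, Complex.conj_conj, mul_expect]
  symm
  rw [expect_comm]
  refine expect_congr rfl fun z _ => ?_
  rw [← expect_translate _ (sqDiff P (z : ℕ) (x : ℕ))]
  refine expect_congr rfl fun y _ => ?_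
  rw [add_sub_cancel_right]; ring

/-- One Cauchy–Schwarz replaces f₁ by the conjugate of `colAvg`, a second removes f₂. The dual
function thus obtained still contains f₂ through `colAvg`. -/
lemma norm_cyclicCount_pow_four_le_dual {f₀ f₁ f₂ : Fin N → ZMod P → ℂ} (h₁ : ∀ x y, ‖f₁ x y‖ ≤ 1)
    (h₂ : ∀ x y, ‖f₂ x y‖ ≤ 1) :
    ‖cyclicCount f₀ f₁ f₂‖ ^ 4 ≤
      𝔼 x, 𝔼 y, ‖dual f₀ (fun z : Fin N => fun y => conj (colAvg f₀ f₂ (z : ℕ) y)) x y‖ ^ 2 := by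
  set D : Fin N → ZMod P → ℂ := fun z y => conj (colAvg f₀ f₂ (z : ℕ) y) with hD
  have s1 : ‖cyclicCount f₀ f₁ f₂‖ ^ 2 ≤ ‖cyclicCount f₀ D f₂‖ := by
    rw [cyclicCount_eq_colAvg f₀ f₁]
    refine (norm_expect_mul_sq_le _ (fun p => h₁ _ _) _).trans (le_of_eq ?_)
    rw [← Complex.norm_of_nonneg (expect_nonneg fun _ _ => sq_nonneg _ : (0:ℝ) ≤
      𝔼 p : Fin N × ZMod P, ‖colAvg f₀ f₂ (p.1 : ℕ) p.2‖ ^ 2), cyclicCount_eq_colAvg, ofReal_expect]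
    congr 1
    refine expect_congr rfl fun p _ => ?_
    rw [hD, ← Complex.normSq_eq_norm_sq, ← Complex.mul_conj, mul_comm]
  have s2 : ‖cyclicCount f₀ D f₂‖ ^ 2 ≤ 𝔼 x, 𝔼 y, ‖dual f₀ D x y‖ ^ 2 := by
    rw [cyclicCount_eq_dual]
    refine (norm_expect_mul_sq_le _ (fun p => h₂ _ _) _).trans (le_of_eq ?_)
    rw [expect_prod']
    simp only [RCLike.norm_conj]
  calc ‖cyclicCount f₀ f₁ f₂‖ ^ 4 = (‖cyclicCount f₀ f₁ f₂‖ ^ 2) ^ 2 := by ring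
    _ ≤ ‖cyclicCount f₀ D f₂‖ ^ 2 := by gcongr
    _ ≤ _ := s2

/-- Expand one factor of the squared Fourier coefficient of the dual function; the other factor
depends only on x and joins f₀ in the weight g. Averaging over x inside leaves `colAvg` against
major arc phases. -/
lemma exists_correlation_phaseAvg : ∃ k : ℕ, ∀ {P N : ℕ} [NeZero P] {T : ℝ}, 100 ≤ T → T ^ k ≤ N →
    P = 8 * N ^ 2 → ∀ {f₀ f₁ f₂ : Fin N → ZMod P → ℂ}, (∀ x y, ‖f₀ x y‖ ≤ 1) →
    (∀ x y, ‖f₁ x y‖ ≤ 1) → (∀ x y, ‖f₂ x y‖ ≤ 1) → 1 / T ≤ ‖cyclicCount f₀ f₁ f₂‖ →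
    ∃ ξ ∈ majSet P N (T ^ k), ∃ g : Fin N → ZMod P → ℂ, (∀ x y, ‖g x y‖ ≤ 1) ∧
      1 / T ^ k ≤ ‖𝔼 z : Fin N, 𝔼 y, colAvg f₀ f₂ (z : ℕ) y * phaseAvg g ξ (z : ℕ) y‖ := by
  obtain ⟨k, hk⟩ := exists_major_frequency
  refine ⟨4 * k, ?_⟩
  intro P N _ T hT hTN hP f₀ f₁ f₂ h₀ h₁ h₂ h
  have hT1 : 1 ≤ T := by linarith
  set D : Fin N → ZMod P → ℂ := fun z y => conj (colAvg f₀ f₂ (z : ℕ) y) with hD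
  have hD1 : ∀ z y, ‖D z y‖ ≤ 1 := fun z y => by
    rw [hD]; simp only [RCLike.norm_conj]; exact norm_colAvg_le_one h₀ h₂ _ _
  obtain ⟨ξ, hξ, s1⟩ := hk (T := T ^ 4) (hT.trans (le_self_pow₀ hT1 (by norm_num)))
    (by rw [← pow_mul]; exact hTN) hP h₀ hD1 (by
      rw [← one_div_pow]
      exact (pow_le_pow_left₀ (by positivity) h 4).trans (norm_cyclicCount_pow_four_le_dual h₁ h₂))
  rw [← pow_mul] at hξ s1
  set d : Fin N → ℂ := fun x => conj (fourier (dual f₀ D x) ξ) with hd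
  refine ⟨ξ, hξ, fun x y => d x * conj (f₀ x y), fun x y => ?_, s1.trans (le_of_eq ?_)⟩
  · simp only [hd, norm_mul, RCLike.norm_conj]
    exact mul_le_one₀ (norm_fourier_le_one (norm_dual_le_one h₀ hD1 x) ξ) (norm_nonneg _) (h₀ _ _)
  · rw [← Complex.norm_of_nonneg (expect_nonneg fun _ _ => sq_nonneg _ : (0:ℝ) ≤
      𝔼 x, ‖fourier (dual f₀ D x) ξ‖ ^ 2), ofReal_expect]
    congr 1
    have e1 : ∀ x, ((‖fourier (dual f₀ D x) ξ‖ ^ 2 : ℝ) : ℂ) = 𝔼 z : Fin N, 𝔼 y,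
        d x * conj (f₀ x y) * colAvg f₀ f₂ (z : ℕ) y * chi (ξ * (y + sqDiff P (z : ℕ) (x : ℕ))) := by
      intro x
      rw [← Complex.normSq_eq_norm_sq, ← Complex.mul_conj, mul_comm]
      change d x * _ = _
      simp only [fourier, dual, mul_expect, expect_mul]
      rw [expect_comm]
      refine expect_congr rfl fun z _ => ?_
      rw [← expect_translate _ (sqDiff P (z : ℕ) (x : ℕ))]
      refine expect_congr rfl fun y _ => ?_
      rw [add_sub_cancel_right, map_mul, hD]
      simp only [Complex.conj_conj]; ring
    simp only [e1]
    rw [expect_comm]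
    refine expect_congr rfl fun z _ => ?_
    rw [expect_comm]
    refine expect_congr rfl fun y _ => ?_
    rw [phaseAvg, mul_expect]
    exact expect_congr rfl fun x _ => by ring

/-- Shifting z by qt changes the phase by an integer of size at most 3MN times qξ, and ‖qξ‖ ≤ K/N².
The constant 20 exceeds 2π·3. -/
lemma norm_phaseAvg_shift_sub_le {g : Fin N → ZMod P → ℂ} (hg : ∀ x y, ‖g x y‖ ≤ 1) {ξ : ZMod P}
    {q : ℕ} {K : ℝ} (hq : (q : ℝ) ≤ K) (hξ : ‖q • ZMod.toAddCircle ξ‖ ≤ K / N ^ 2)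
    (hKM : K * M ≤ N) (z : Fin N) (t : Fin M) (y : ZMod P) :
    ‖phaseAvg g ξ ((z : ℕ) + (q * t : ℕ)) y - phaseAvg g ξ (z : ℕ) y‖ ≤ 20 * (K * M / N) := by
  have hN0 : (0 : ℝ) < N := by exact_mod_cast z.pos
  have hK0 : 0 ≤ K := (Nat.cast_nonneg q).trans hq
  rw [phaseAvg, phaseAvg, ← expect_sub_distrib]
  refine (norm_expect_le_expect _).trans (expect_le_of_le _ (by positivity) fun x => ?_)
  rw [← mul_sub, norm_mul]
  refine (mul_le_of_le_one_left (norm_nonneg _) (hg _ _)).trans ?_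
  refine (norm_e_sub_e_le _ _).trans ?_
  rw [← map_sub]
  have e1 : ξ * (y + sqDiff P ((z : ℕ) + (q * t : ℕ)) (x : ℕ)) - ξ * (y + sqDiff P (z : ℕ) (x : ℕ)) =
      ((t * (2 * ((z : ℕ) - (x : ℕ)) + q * t) : ℤ)) • (q • ξ) := by
    simp only [sqDiff, zsmul_eq_mul, nsmul_eq_mul]
    push_cast
    ring
  rw [e1, map_zsmul, map_nsmul]
  have h1 : |((t * (2 * ((z : ℕ) - (x : ℕ)) + q * t) : ℤ) : ℝ)| ≤ M * (3 * N) := by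
    push_cast
    have ht : ((t : ℕ) : ℝ) ≤ M := by exact_mod_cast t.2.le
    have hx : ((x : ℕ) : ℝ) ≤ N := by exact_mod_cast x.2.le
    have hz : ((z : ℕ) : ℝ) ≤ N := by exact_mod_cast z.2.le
    have hx0 : (0 : ℝ) ≤ ((x : ℕ) : ℝ) := by positivity
    have hz0 : (0 : ℝ) ≤ ((z : ℕ) : ℝ) := by positivity
    have hqt : (q : ℝ) * ((t : ℕ) : ℝ) ≤ N := (mul_le_mul hq ht (by positivity) hK0).trans hKM
    have hqt0 : (0 : ℝ) ≤ (q : ℝ) * ((t : ℕ) : ℝ) := by positivity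
    rw [abs_mul, Nat.abs_cast]
    refine mul_le_mul ht ?_ (abs_nonneg _) (by positivity)
    rw [abs_le]
    constructor <;> linarith
  have h2 := norm_zsmul_circle_le (t * (2 * ((z : ℕ) - (x : ℕ)) + q * t) : ℤ) (q • ZMod.toAddCircle ξ)
  have h3 : ‖((t * (2 * ((z : ℕ) - (x : ℕ)) + q * t) : ℤ)) • (q • ZMod.toAddCircle ξ)‖ ≤
      M * (3 * N) * (K / N ^ 2) :=
    h2.trans (mul_le_mul h1 hξ (norm_nonneg _) (by positivity))
  have h4 : M * (3 * N) * (K / N ^ 2) = 3 * (K * M / N) := by field_simp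
  rw [h4] at h3
  have h5 : (0 : ℝ) ≤ K * M / N := by positivity
  have h6 := Real.pi_lt_d2
  nlinarith [Real.pi_pos, norm_nonneg (((t * (2 * ((z : ℕ) - (x : ℕ)) + q * t) : ℤ)) •
    (q • ZMod.toAddCircle ξ))]

/-- Averaging the shift over t acts on `colAvg` alone, since the phases are almost invariant; the
phases and then f₀ are bounded by 1. The constant is 22 = 2 + 20, from moving the window and from
freezing the phases. -/
lemma norm_expect_colAvg_mul_phaseAvg_le {f₀ f₂ g : Fin N → ZMod P → ℂ} (h₀ : ∀ x y, ‖f₀ x y‖ ≤ 1)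
    (h₂ : ∀ x y, ‖f₂ x y‖ ≤ 1) (hg : ∀ x y, ‖g x y‖ ≤ 1) {ξ : ZMod P}
    {q : ℕ} {K : ℝ} (hq : (q : ℝ) ≤ K) (hξ : ‖q • ZMod.toAddCircle ξ‖ ≤ K / N ^ 2)
    (hM : 1 ≤ M) (hKM : K * M ≤ N) :
    ‖𝔼 z : Fin N, 𝔼 y, colAvg f₀ f₂ (z : ℕ) y * phaseAvg g ξ (z : ℕ) y‖ ≤ 22 * (K * M / N) +
      𝔼 z : Fin N, 𝔼 x : Fin N, 𝔼 y, ‖𝔼 t : Fin M, f₂ x (y + sqDiff P ((z : ℕ) + (q * t : ℕ)) (x : ℕ))‖ := by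
  have : Nonempty (Fin M) := ⟨⟨0, hM⟩⟩
  have hK0 : 0 ≤ K := (Nat.cast_nonneg q).trans hq
  set E := colAvg f₀ f₂ with hE
  set H := phaseAvg g ξ with hH
  have hE1 : ∀ z y, ‖E z y‖ ≤ 1 := norm_colAvg_le_one h₀ h₂
  have hH1 : ∀ z y, ‖H z y‖ ≤ 1 := norm_phaseAvg_le_one hg ξ
  have s1 : ∀ t : Fin M, ‖𝔼 z : Fin N, 𝔼 y, E (z : ℕ) y * H (z : ℕ) y -
      𝔼 z : Fin N, 𝔼 y, E ((z : ℕ) + (q * t : ℕ)) y * H (z : ℕ) y‖ ≤ 22 * (K * M / N) := by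
    intro t
    have a1 := norm_expect_sub_expect_shift_le (N := N) (fun z => 𝔼 y, E z y * H z y)
      (fun z => norm_expect_le_one _ fun y => by
        rw [norm_mul]; exact mul_le_one₀ (hE1 _ _) (norm_nonneg _) (hH1 _ _)) (q * t)
    have a2 : ‖𝔼 z : Fin N, 𝔼 y, E ((z : ℕ) + (q * t : ℕ)) y * H ((z : ℕ) + (q * t : ℕ)) y -
        𝔼 z : Fin N, 𝔼 y, E ((z : ℕ) + (q * t : ℕ)) y * H (z : ℕ) y‖ ≤ 20 * (K * M / N) := by
      simp only [← expect_sub_distrib]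
      refine (norm_expect_le_expect _).trans (expect_le_of_le _ (by positivity) fun z => ?_)
      refine (norm_expect_le_expect _).trans (expect_le_of_le _ (by positivity) fun y => ?_)
      rw [← mul_sub, norm_mul]
      exact (mul_le_of_le_one_left (norm_nonneg _) (hE1 _ _)).trans
        (norm_phaseAvg_shift_sub_le hg hq hξ hKM z t y)
    have a3 := norm_add_le_of_le a1 a2
    rw [sub_add_sub_cancel] at a3
    refine a3.trans ?_
    have ht : ((t : ℕ) : ℝ) ≤ M := by exact_mod_cast t.2.le
    have a4 : (2 * (q * t : ℕ) / N : ℝ) ≤ 2 * (K * M) / N := by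
      push_cast
      gcongr
    have : 2 * (K * M) / N = 2 * (K * M / N : ℝ) := by ring
    linarith
  have s2 : ‖𝔼 z : Fin N, 𝔼 y, E (z : ℕ) y * H (z : ℕ) y -
      𝔼 t : Fin M, 𝔼 z : Fin N, 𝔼 y, E ((z : ℕ) + (q * t : ℕ)) y * H (z : ℕ) y‖ ≤ 22 * (K * M / N) := by
    have : 𝔼 z : Fin N, 𝔼 y, E (z : ℕ) y * H (z : ℕ) y =
      𝔼 _t : Fin M, 𝔼 z : Fin N, 𝔼 y, E (z : ℕ) y * H (z : ℕ) y := by rw [Fintype.expect_const]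
    rw [this, ← expect_sub_distrib]
    exact (norm_expect_le_expect _).trans (expect_le_of_le _ (by positivity) s1)
  have s3 : ‖𝔼 t : Fin M, 𝔼 z : Fin N, 𝔼 y, E ((z : ℕ) + (q * t : ℕ)) y * H (z : ℕ) y‖ ≤
      𝔼 z : Fin N, 𝔼 x : Fin N, 𝔼 y, ‖𝔼 t : Fin M, f₂ x (y + sqDiff P ((z : ℕ) + (q * t : ℕ)) (x : ℕ))‖ := by
    rw [expect_comm]
    refine (norm_expect_le_expect _).trans (expect_mono fun z => ?_)
    rw [expect_comm]
    simp only [← expect_mul]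
    rw [expect_comm (univ : Finset (Fin N)) (univ : Finset (ZMod P))]
    refine (norm_expect_le_expect _).trans (expect_mono fun y => ?_)
    rw [norm_mul]
    refine (mul_le_of_le_one_right (norm_nonneg _) (hH1 _ _)).trans ?_
    simp only [hE, colAvg]
    rw [expect_comm]
    simp only [← mul_expect]
    refine (norm_expect_le_expect _).trans (expect_mono fun x => ?_)
    rw [norm_mul]
    exact mul_le_of_le_one_left (norm_nonneg _) (h₀ _ _)
  have := norm_le_norm_add_norm_sub' (𝔼 z : Fin N, 𝔼 y, E (z : ℕ) y * H (z : ℕ) y)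
    (𝔼 t : Fin M, 𝔼 z : Fin N, 𝔼 y, E ((z : ℕ) + (q * t : ℕ)) y * H (z : ℕ) y)
  linarith

/-- On the Fourier side the mean square over y weighs each coefficient of f₂ by a quadratic
exponential average over t. Minor arc frequencies contribute at most 1/U in total, so the few major
ones carry the rest. -/
lemma exists_large_fourier_of_progression {U : ℝ} (hU : 100 ≤ U) (hUM : U ^ 26 ≤ M)
    (hN : 1 ≤ N) (hNM : (N : ℝ) ≤ U * M)
    (hP : P = 8 * N ^ 2) {f₂ : Fin N → ZMod P → ℂ} (h₂ : ∀ x y, ‖f₂ x y‖ ≤ 1) {q : ℕ} (hq1 : 1 ≤ q)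
    (hq : (q : ℝ) ≤ U) (z : ℤ)
    (h : 2 / U ≤ 𝔼 x : Fin N, 𝔼 y, ‖𝔼 t : Fin M, f₂ x (y + sqDiff P (z + (q * t : ℕ)) (x : ℕ))‖ ^ 2) :
    ∃ ζ ∈ majSet P N (U ^ 45), 1 / U ^ 181 ≤ 𝔼 x, ‖fourier (f₂ x) ζ‖ := by
  have hU0 : 0 < U := by linarith
  have hU1 : 1 ≤ U := by linarith
  have hM1 : (1 : ℝ) ≤ M := le_trans (one_le_pow₀ hU1) hUM
  have hM : 1 ≤ M := by exact_mod_cast hM1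
  set S := majSet P N (U ^ 45) with hS
  -- Up to a unimodular constant this is a quadratic exponential average with leading coefficient
  -- q²ζ. Weyl gives parameter U⁴¹; removing q² ≤ U² and passing from scale M to N ≤ UM gives U⁴⁵.
  have hκ : ∀ (x : Fin N) (ζ : ZMod P), ζ ∉ S →
      ‖𝔼 t : Fin M, chi (ζ * sqDiff P (z + (q * t : ℕ)) (x : ℕ))‖ ^ 2 ≤ 1 / U := by
    intro x ζ hζ
    by_contra! hcon
    refine hζ (mem_majSet.2 ?_)
    have e1 : ∀ t : Fin M, chi (ζ * sqDiff P (z + (q * t : ℕ)) (x : ℕ)) =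
        e (((t : ℕ) : ℤ) ^ 2 • ((q ^ 2) • ZMod.toAddCircle ζ) +
          ((t : ℕ) : ℤ) • ((2 * q * (z - (x : ℕ)) : ℤ) • ZMod.toAddCircle ζ)) *
        e (((z - (x : ℕ)) ^ 2 : ℤ) • ZMod.toAddCircle ζ) := by
      intro t
      rw [← e_add, sqDiff, chi_mul_intCast]
      congr 1
      push_cast
      module
    have h1 : 1 / U ≤ ‖𝔼 t : Fin M, e (((t : ℕ) : ℤ) ^ 2 • ((q ^ 2) • ZMod.toAddCircle ζ) +
          ((t : ℕ) : ℤ) • ((2 * q * (z - (x : ℕ)) : ℤ) • ZMod.toAddCircle ζ))‖ := by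
      simp only [e1] at hcon
      rw [← expect_mul, norm_mul, norm_e, mul_one, sq] at hcon
      exact hcon.le.trans (mul_le_of_le_one_left (norm_nonneg _)
        (norm_expect_le_one _ fun t => by rw [norm_e]))
    have h2 := (isMaj_of_le_norm_expect_quadratic hU hUM _ _ h1).of_nsmul (Nat.one_le_pow 2 q hq1)
    refine (h2.of_le hN hM hU1 hNM).mono ?_
    push_cast
    calc U ^ 2 * ((q : ℝ) ^ 2 * U ^ 41) ≤ U ^ 2 * (U ^ 2 * U ^ 41) := by gcongr
      _ = U ^ 45 := by ring
  have hbd : ∀ x, 𝔼 y, ‖𝔼 t : Fin M, f₂ x (y + sqDiff P (z + (q * t : ℕ)) (x : ℕ))‖ ^ 2 ≤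
      1 / U + ∑ ζ ∈ S, ‖fourier (f₂ x) ζ‖ := by
    intro x
    rw [expect_norm_expect_translate_sq]
    have h3 : ∀ ζ, ‖fourier (f₂ x) ζ‖ ^ 2 *
        ‖𝔼 t : Fin M, chi (ζ * sqDiff P (z + (q * t : ℕ)) (x : ℕ))‖ ^ 2 ≤
        ‖fourier (f₂ x) ζ‖ ^ 2 * (1 / U) + if ζ ∈ S then ‖fourier (f₂ x) ζ‖ else 0 := by
      intro ζ
      have h4 := norm_fourier_le_one (h₂ x) ζ
      split_ifs with hζ
      · have h5 : ‖𝔼 t : Fin M, chi (ζ * sqDiff P (z + (q * t : ℕ)) (x : ℕ))‖ ^ 2 ≤ 1 :=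
          norm_sq_le_one (norm_expect_le_one _ fun t => by rw [norm_chi])
        have h6 : ‖fourier (f₂ x) ζ‖ ^ 2 *
          ‖𝔼 t : Fin M, chi (ζ * sqDiff P (z + (q * t : ℕ)) (x : ℕ))‖ ^ 2 ≤ ‖fourier (f₂ x) ζ‖ :=
          (mul_le_of_le_one_right (sq_nonneg _) h5).trans
            (by rw [sq]; exact mul_le_of_le_one_left (norm_nonneg _) h4)
        have : 0 ≤ ‖fourier (f₂ x) ζ‖ ^ 2 * (1 / U) := by positivity
        linarith
      · rw [add_zero]
        exact mul_le_mul_of_nonneg_left (hκ x ζ hζ) (sq_nonneg _)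
    refine (sum_le_sum fun ζ _ => h3 ζ).trans ?_
    rw [sum_add_distrib, ← sum_mul, sum_ite_mem, univ_inter]
    gcongr
    exact mul_le_of_le_one_left (by positivity) (sum_norm_fourier_sq_le_one (h₂ x))
  have s1 : 1 / U ≤ ∑ ζ ∈ S, 𝔼 x, ‖fourier (f₂ x) ζ‖ := by
    have h3 := h.trans (expect_mono hbd)
    rw [expect_add_distrib, expect_sum_comm] at h3
    have h4 : 𝔼 _x : Fin N, 1 / U ≤ 1 / U := expect_le_of_le _ (by positivity) fun _ => le_rfl
    have : 2 / U = 1 / U + 1 / U := by ring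
    linarith
  -- At most U¹⁸⁰ major frequencies share a total of at least 1/U, whence the exponent 181.
  by_contra! hcon
  have hcard := card_majSet_le (P := P) hN hP (K := U ^ 45) (hU.trans (le_self_pow₀ hU1 (by norm_num)))
  have hne : S.Nonempty := by
    by_contra hemp
    rw [not_nonempty_iff_eq_empty] at hemp
    rw [hemp, sum_empty] at s1
    have : 0 < 1 / U := by positivity
    linarith
  have h6 : ∑ ζ ∈ S, 𝔼 x, ‖fourier (f₂ x) ζ‖ < ∑ ζ ∈ S, 1 / U ^ 181 :=
    sum_lt_sum_of_nonempty hne hcon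
  rw [sum_const, nsmul_eq_mul] at h6
  have h7 : (#S : ℝ) * (1 / U ^ 181) ≤ (U ^ 45) ^ 4 * (1 / U ^ 181) := by gcongr
  have h8 : (U ^ 45) ^ 4 * (1 / U ^ 181) = 1 / U := by
    rw [← pow_mul, mul_one_div, div_eq_div_iff (by positivity) (by positivity), one_mul, ← pow_succ]
  linarith

/-- The inverse theorem for the cyclic counting operator. -/
lemma exists_large_fourier : ∃ k : ℕ, ∀ {P N : ℕ} [NeZero P] {T : ℝ}, 100 ≤ T → T ^ k ≤ N →
    P = 8 * N ^ 2 → ∀ {f₀ f₁ f₂ : Fin N → ZMod P → ℂ}, (∀ x y, ‖f₀ x y‖ ≤ 1) →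
    (∀ x y, ‖f₁ x y‖ ≤ 1) → (∀ x y, ‖f₂ x y‖ ≤ 1) → 1 / T ≤ ‖cyclicCount f₀ f₁ f₂‖ →
    ∃ ζ ∈ majSet P N (T ^ k), 1 / T ^ k ≤ 𝔼 x, ‖fourier (f₂ x) ζ‖ := by
  obtain ⟨k, hk⟩ := exists_correlation_phaseAvg
  obtain ⟨r, hr⟩ : ∃ r, r = 2 * k + 3 := ⟨_, rfl⟩
  refine ⟨r * 181, ?_⟩
  intro P N _ T hT hTN hP f₀ f₁ f₂ h₀ h₁ h₂ h
  have hT0 : 0 < T := by linarith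
  have hT1 : 1 ≤ T := by linarith
  have hpow : ∀ {m n : ℕ}, m ≤ n → T ^ m ≤ T ^ n := fun h => pow_le_pow_right₀ hT1 h
  have hN1 : (1 : ℝ) ≤ N := le_trans (one_le_pow₀ hT1) hTN
  have hN : 1 ≤ N := by exact_mod_cast hN1
  have : Nonempty (Fin N) := ⟨⟨0, hN⟩⟩
  have hle : ∀ {m : ℕ}, m ≤ r * 181 → T ^ m ≤ N := fun h => (hpow h).trans hTN
  obtain ⟨ξ, hξ, g, hg, s1⟩ := hk hT (hle (by omega)) hP h₀ h₁ h₂ h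
  obtain ⟨q, hq1, hqK, hqξ⟩ := mem_majSet.1 hξ
  -- This length makes the shift error 22 T^k M/N at most 22/T^(k+1), well below the lower bound
  -- 1/T^k, while N/M stays at most T^r.
  set M : ℕ := ⌊N / T ^ (2 * k + 1)⌋₊ with hMdef
  have hM1 : (M : ℝ) ≤ N / T ^ (2 * k + 1) := Nat.floor_le (by positivity)
  have hM2 : N / T ^ (2 * k + 1) < M + 1 := Nat.lt_floor_add_one _
  have hbig : T ^ (r * 27) ≤ N / T ^ (2 * k + 1) := by
    rw [le_div_iff₀ (by positivity), ← pow_add]; exact hle (by omega)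
  have hU1 : (1 : ℝ) ≤ T ^ (r * 26) := one_le_pow₀ hT1
  have hUM : T ^ (r * 26) ≤ M := by
    have : 2 * T ^ (r * 26) ≤ T ^ (r * 27) := by
      rw [show r * 27 = r * 26 + r by ring, pow_add, mul_comm]
      have := hT.trans (le_self_pow₀ hT1 (by omega : r ≠ 0))
      exact mul_le_mul_of_nonneg_left (by linarith) (by positivity)
    linarith
  have hMr : (1 : ℝ) ≤ M := hU1.trans hUM
  have hM : 1 ≤ M := by exact_mod_cast hMr
  have hN0 : (0 : ℝ) < N := by linarith
  have hNM : (N : ℝ) ≤ T ^ r * M := by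
    have h1 : (N : ℝ) < (M + 1) * T ^ (2 * k + 1) := by rwa [div_lt_iff₀ (by positivity)] at hM2
    have h2 : (M + 1) * T ^ (2 * k + 1) ≤ (2 * M) * T ^ (2 * k + 1) := by gcongr; linarith
    have h3 : 2 * T ^ (2 * k + 1) ≤ T ^ r := by
      rw [hr, show 2 * k + 3 = (2 * k + 1) + 2 by ring, pow_add T (2 * k + 1), mul_comm]
      exact mul_le_mul_of_nonneg_left (by nlinarith) (by positivity)
    nlinarith
  have hKMN : T ^ k * M / N ≤ 1 / T ^ (k + 1) := by
    rw [div_le_div_iff₀ hN0 (by positivity), one_mul]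
    rw [le_div_iff₀ (by positivity)] at hM1
    calc T ^ k * M * T ^ (k + 1) = M * T ^ (2 * k + 1) := by ring
      _ ≤ N := hM1
  have hKM : T ^ k * M ≤ N := by
    rw [div_le_iff₀ hN0] at hKMN
    refine hKMN.trans (mul_le_of_le_one_left hN0.le ?_)
    rw [div_le_one (by positivity)]
    exact one_le_pow₀ hT1
  have s2 := s1.trans (norm_expect_colAvg_mul_phaseAvg_le h₀ h₂ hg hqK hqξ hM hKM)
  have s3 : 1 / T ^ (k + 1) ≤ 𝔼 z : Fin N, 𝔼 x : Fin N, 𝔼 y,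
      ‖𝔼 t : Fin M, f₂ x (y + sqDiff P ((z : ℕ) + (q * t : ℕ)) (x : ℕ))‖ := by
    have h3 : 1 / T ^ (k + 1) * T = 1 / T ^ k := by rw [pow_succ]; field_simp
    have h4 : 0 < 1 / T ^ (k + 1) := by positivity
    nlinarith
  obtain ⟨z, hz⟩ := exists_le_of_le_expect _ s3
  have s4 : 1 / T ^ (2 * k + 2) ≤ 𝔼 x : Fin N, 𝔼 y,
      ‖𝔼 t : Fin M, f₂ x (y + sqDiff P ((z : ℕ) + (q * t : ℕ)) (x : ℕ))‖ ^ 2 := by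
    rw [show 2 * k + 2 = (k + 1) * 2 by ring, pow_mul, ← one_div_pow]
    refine (pow_le_pow_left₀ (by positivity) hz 2).trans ?_
    refine (sq_expect_le _).trans (expect_mono fun x => sq_expect_le _)
  have s5 : 2 / T ^ r ≤ 1 / T ^ (2 * k + 2) := by
    rw [hr, div_le_div_iff₀ (by positivity) (by positivity), one_mul, pow_succ T (2 * k + 2), mul_comm]
    gcongr
    linarith
  obtain ⟨ζ, hζ, s6⟩ := exists_large_fourier_of_progression (U := T ^ r)
    (hT.trans (le_self_pow₀ hT1 (by omega))) (by rw [← pow_mul]; exact hUM) hN hNM hP h₂ hq1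
    (hqK.trans (hpow (by omega))) _ (s5.trans s4)
  rw [← pow_mul] at hζ s6
  exact ⟨ζ, mem_majSet.2 ((mem_majSet.1 hζ).mono (hpow (by omega))), s6⟩

end CyclicInverse

/-! ### Transference between the integers and ℤ/P -/

section Reduction
variable {P N : ℕ}

lemma mem_interval {n : ℕ} {a : ℤ} : a ∈ interval n ↔ 1 ≤ a ∧ a ≤ n := by
  rw [interval, mem_Icc]

lemma card_interval (n : ℕ) : #(interval n) = n := by
  rw [interval, Int.card_Icc]; omega

lemma sum_Ico_eq_sum_fin (f : ℤ → ℂ) : ∑ u ∈ Ico (0 : ℤ) N, f u = ∑ u : Fin N, f (u : ℕ) := by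
  symm
  refine sum_bij (fun u _ => ((u : ℕ) : ℤ)) ?_ ?_ ?_ fun _ _ => rfl
  · intro u _; rw [mem_Ico]; have := u.2; omega
  · intro u _ v _ h; ext; exact_mod_cast h
  · intro n hn
    rw [mem_Ico] at hn
    exact ⟨⟨n.toNat, by omega⟩, mem_univ _, by simp [hn.1]⟩

/-- The Fejér kernel counts the representations of `d` as a difference. -/
lemma fejer_eq_card (hN : 1 ≤ N) (d : ℤ) :
    fejer N d = #{u ∈ Ico (0 : ℤ) N | u + d ∈ Ico (0 : ℤ) N} / (N : ℝ) ^ 2 := by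
  have hN0 : (0 : ℝ) < N := by exact_mod_cast hN
  have h1 : ({u ∈ Ico (0 : ℤ) N | u + d ∈ Ico (0 : ℤ) N} : Finset ℤ) =
      Ico (max 0 (-d)) (min (N : ℤ) (N - d)) := by
    ext u
    simp only [mem_filter, mem_Ico, max_le_iff, lt_min_iff]
    omega
  rw [h1, Int.card_Ico, fejer]
  have h2 : ((min (N : ℤ) (N - d) - max 0 (-d)).toNat : ℝ) = max (N - |(d : ℝ)|) 0 := by
    have h3 : min (N : ℤ) (N - d) - max 0 (-d) = N - |d| := by
      rcases abs_cases d with ⟨h, h'⟩ | ⟨h, h'⟩ <;> omega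
    rw [h3]
    have h4 : (((N - |d|).toNat : ℤ) : ℝ) = ((max (N - |d|) 0 : ℤ) : ℝ) := by
      rw [Int.toNat_eq_max]
    push_cast at h4
    exact_mod_cast h4
  rw [h2]
  have h5 : max (1 - |(d : ℝ)| / N) 0 = max (N - |(d : ℝ)|) 0 / N := by
    rw [← max_div_div_right hN0.le, zero_div, sub_div, div_self hN0.ne']
  rw [h5]
  field_simp

/-- The weight of d is the probability that two independent uniform points u and v satisfy v - u =
d. -/
lemma tsum_fejer_mul (hN : 1 ≤ N) (G : ℤ → ℂ) :
    ∑' d : ℤ, (fejer N d : ℂ) * G d = 𝔼 u : Fin N, 𝔼 v : Fin N, G ((v : ℕ) - (u : ℕ)) := by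
  have hN0 : (N : ℂ) ≠ 0 := by exact_mod_cast (by omega : N ≠ 0)
  set R := Ioo (-(N : ℤ)) N with hR
  have h1 : ∑' d : ℤ, (fejer N d : ℂ) * G d = ∑ d ∈ R, (fejer N d : ℂ) * G d := by
    refine tsum_eq_sum fun d hd => ?_
    rw [fejer_eq_card hN, filter_false_of_mem]
    · simp
    · intro u hu
      rw [hR, mem_Ioo] at hd
      rw [mem_Ico] at hu ⊢
      omega
  have h2 : ∀ d, (fejer N d : ℂ) * G d =
      (∑ u ∈ Ico (0 : ℤ) N, if u + d ∈ Ico (0 : ℤ) N then G d else 0) / (N : ℂ) ^ 2 := by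
    intro d
    rw [fejer_eq_card hN, ← sum_filter, sum_const, nsmul_eq_mul]
    push_cast
    ring
  have h3 : ∀ u ∈ Ico (0 : ℤ) N, (∑ d ∈ R, if u + d ∈ Ico (0 : ℤ) N then G d else 0) =
      ∑ v ∈ Ico (0 : ℤ) N, G (v - u) := by
    intro u hu
    rw [← sum_filter]
    refine sum_nbij' (fun d => u + d) (fun v => v - u) ?_ ?_ ?_ ?_ ?_
    · intro d hd; exact (mem_filter.1 hd).2
    · intro v hv
      rw [mem_Ico] at hu hv
      rw [mem_filter, hR, mem_Ioo, mem_Ico]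
      omega
    · intro d _; ring
    · intro v _; ring
    · intro d _; congr 1; ring
  rw [h1, sum_congr rfl fun d _ => h2 d, ← sum_div, sum_comm, sum_congr rfl h3,
    sum_Ico_eq_sum_fin (fun u => ∑ v ∈ Ico (0 : ℤ) N, G (v - u))]
  simp only [sum_Ico_eq_sum_fin, Fintype.expect_eq_sum_div_card, Fintype.card_fin]
  rw [← sum_div, div_div, sq]

lemma countingOp_eq (hN : 1 ≤ N) (f₀ f₁ f₂ : ℤ × ℤ → ℂ) :
    countingOp N f₀ f₁ f₂ = 𝔼 x ∈ interval N, 𝔼 u : Fin N, 𝔼 v : Fin N, 𝔼 y ∈ interval (N ^ 2),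
      f₀ (x, y) * f₁ (x + ((v : ℕ) - (u : ℕ)), y) * f₂ (x, y + ((v : ℕ) - (u : ℕ)) ^ 2) := by
  rw [countingOp]
  refine expect_congr rfl fun x _ => ?_
  have h1 : ∀ y, ∑' d : ℤ, (fejer N d : ℂ) * f₀ (x, y) * f₁ (x + d, y) * f₂ (x, y + d ^ 2) =
      𝔼 u : Fin N, 𝔼 v : Fin N, f₀ (x, y) * f₁ (x + ((v : ℕ) - (u : ℕ)), y) *
        f₂ (x, y + ((v : ℕ) - (u : ℕ)) ^ 2) := fun y => by
    rw [← tsum_fejer_mul hN fun d => f₀ (x, y) * f₁ (x + d, y) * f₂ (x, y + d ^ 2)]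
    exact tsum_congr fun d => by ring
  simp only [h1]
  rw [expect_comm]
  refine expect_congr rfl fun u _ => ?_
  rw [expect_comm]

/-- This forces δ ≤ 1, so that powers of δ decrease in the exponent. -/
lemma norm_countingOp_le_one (hN : 1 ≤ N) {f₀ f₁ f₂ : ℤ × ℤ → ℂ} (h₀ : OneBounded f₀)
    (h₁ : OneBounded f₁) (h₂ : OneBounded f₂) : ‖countingOp N f₀ f₁ f₂‖ ≤ 1 := by
  have hle : ∀ {α : Type} (s : Finset α) (f : α → ℂ), (∀ i, ‖f i‖ ≤ 1) → ‖𝔼 i ∈ s, f i‖ ≤ 1 := by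
    intro α s f hf
    rcases s.eq_empty_or_nonempty with rfl | hs
    · simp
    · exact (RCLike.norm_expect_le (K := ℂ)).trans (expect_le hs fun i _ => hf i)
  rw [countingOp_eq hN]
  refine hle _ _ fun x => hle _ _ fun u => hle _ _ fun v => hle _ _ fun y => ?_
  rw [norm_mul, norm_mul]
  exact mul_le_one₀ (mul_le_one₀ (h₀ _) (norm_nonneg _) (h₁ _)) (norm_nonneg _) (h₂ _)

lemma sum_interval_reindex (h : ℤ → ℂ) (u : Fin N) :
    ∑ x ∈ interval N, h x =
      ∑ t ∈ Ico (-(N : ℤ)) N, if ((u : ℕ) : ℤ) - t ∈ interval N then h ((u : ℕ) - t) else 0 := by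
  rw [← sum_filter]
  have hu := u.2
  refine sum_nbij' (fun x => ((u : ℕ) : ℤ) - x) (fun t => ((u : ℕ) : ℤ) - t) ?_ ?_ ?_ ?_ ?_
  · intro x hx
    rw [mem_interval] at hx
    rw [mem_filter, mem_interval, mem_Ico]
    omega
  · intro t ht; exact (mem_filter.1 ht).2
  · intro x _; ring
  · intro t _; ring
  · intro x _; congr 1; ring

/-- Reindex by t = u - x, which takes at most 2N values against the normalisation N; hence the loss
of 2. Fixing t puts x = u - t, and then x + (v - u) = v - t depends on v alone. -/
lemma exists_large_shift (hN : 1 ≤ N) {δ : ℝ} (h : ℤ → Fin N → ℂ)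
    (hδ : δ ≤ ‖𝔼 x ∈ interval N, 𝔼 u : Fin N, h x u‖) :
    ∃ t : ℤ, δ / 2 ≤
      ‖𝔼 u : Fin N, if ((u : ℕ) : ℤ) - t ∈ interval N then h ((u : ℕ) - t) u else 0‖ := by
  have hN0 : (0 : ℝ) < N := by exact_mod_cast hN
  have hN0' : (N : ℂ) ≠ 0 := by exact_mod_cast hN0.ne'
  set A : ℤ → ℂ := fun t =>
    𝔼 u : Fin N, if ((u : ℕ) : ℤ) - t ∈ interval N then h ((u : ℕ) - t) u else 0 with hA
  have h1 : 𝔼 x ∈ interval N, 𝔼 u : Fin N, h x u = (∑ t ∈ Ico (-(N : ℤ)) N, A t) / N := by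
    rw [expect_comm]
    simp only [expect_eq_sum_div_card (interval N), card_interval]
    rw [← expect_div]
    congr 1
    rw [← expect_sum_comm]
    exact expect_congr rfl fun u _ => sum_interval_reindex (fun x => h x u) u
  rw [h1, norm_div, Complex.norm_natCast, le_div_iff₀ hN0] at hδ
  have h2 : ∑ _t ∈ Ico (-(N : ℤ)) N, δ / 2 ≤ ∑ t ∈ Ico (-(N : ℤ)) N, ‖A t‖ := by
    refine le_trans (le_of_eq ?_) (hδ.trans (norm_sum_le _ _))
    rw [sum_const, Int.card_Ico, nsmul_eq_mul, show ((N : ℤ) - -(N : ℤ)).toNat = 2 * N by omega]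
    push_cast
    ring
  obtain ⟨t, -, ht⟩ := exists_le_of_sum_le (nonempty_Ico.2 (by omega)) h2
  exact ⟨t, ht⟩

variable [NeZero P]

/-- The function on `ℤ/P` that equals `f` on `{1, …, L}` and vanishes elsewhere. -/
noncomputable def cut (f : ℤ → ℂ) (L : ℕ) (y : ZMod P) : ℂ :=
  if (y.val : ℤ) ∈ interval L then f y.val else 0

lemma norm_cut_le_one {P : ℕ} {f : ℤ → ℂ} (hf : ∀ n, ‖f n‖ ≤ 1) (L : ℕ) (y : ZMod P) : ‖cut f L y‖ ≤ 1 := by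
  rw [cut]; split_ifs
  · exact hf _
  · simp

lemma val_intCast_of_mem {L : ℕ} (hL : L < P) {n : ℤ} (hn : n ∈ interval L) :
    ((n : ZMod P).val : ℤ) = n := by
  rw [mem_interval] at hn
  rw [ZMod.val_intCast]
  exact Int.emod_eq_of_lt (by omega) (by omega)

lemma cut_intCast {L : ℕ} (hL : L < P) (f : ℤ → ℂ) {n : ℤ} (hn : n ∈ interval L) :
    cut f L (n : ZMod P) = f n := by
  rw [cut, val_intCast_of_mem hL hn, if_pos hn]

lemma sum_eq_sum_interval {L : ℕ} (hL : L < P) (G : ZMod P → ℂ)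
    (hG : ∀ y : ZMod P, (y.val : ℤ) ∉ interval L → G y = 0) :
    ∑ y, G y = ∑ n ∈ interval L, G (n : ZMod P) := by
  have h1 : ∑ y, G y = ∑ y ∈ ({y : ZMod P | (y.val : ℤ) ∈ interval L} : Finset _), G y := by
    symm
    refine sum_subset (subset_univ _) fun y _ hy => hG y fun h => hy (by simpa using h)
  rw [h1]
  refine sum_nbij' (fun y => (y.val : ℤ)) (fun n => (n : ZMod P)) ?_ ?_ ?_ ?_ ?_
  · intro y hy; simpa using hy
  · intro n hn
    simp only [mem_filter, mem_univ, true_and]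
    rw [val_intCast_of_mem hL hn]; exact hn
  · intro y _; simp
  · intro n hn; exact val_intCast_of_mem hL hn
  · intro y _; simp

/-- Transference of the counting operator to the cyclic model. -/
lemma exists_cyclicCount_ge (hN : 1 ≤ N) (hP : P = 8 * N ^ 2) {f₀ f₁ f₂ : ℤ × ℤ → ℂ} {δ : ℝ}
    (h : δ ≤ ‖countingOp N f₀ f₁ f₂‖) :
    ∃ t : ℤ, δ / 16 ≤ ‖cyclicCount (P := P)
      (fun x : Fin N => cut (fun n => f₀ ((x : ℕ) - t, n)) (N ^ 2))
      (fun z : Fin N => cut (fun n => f₁ ((z : ℕ) - t, n)) (N ^ 2))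
      (fun x : Fin N => cut (fun n => if ((x : ℕ) : ℤ) - t ∈ interval N then f₂ ((x : ℕ) - t, n) else 0)
        (2 * N ^ 2))‖ := by
  have hN0 : (0 : ℝ) < N := by exact_mod_cast hN
  have hN2 : 1 ≤ N ^ 2 := Nat.one_le_pow _ _ hN
  rw [countingOp_eq hN] at h
  -- The loss 16 is the 2 from fixing t times the 8 = P/N² from spreading y over ℤ/P.
  obtain ⟨t, ht⟩ := exists_large_shift hN _ h
  refine ⟨t, ?_⟩
  have e1 : ∀ x z : Fin N, 𝔼 y : ZMod P, cut (fun n => f₀ ((x : ℕ) - t, n)) (N ^ 2) y *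
      cut (fun n => f₁ ((z : ℕ) - t, n)) (N ^ 2) y *
      cut (fun n => if ((x : ℕ) : ℤ) - t ∈ interval N then f₂ ((x : ℕ) - t, n) else 0)
        (2 * N ^ 2) (y + sqDiff P (z : ℕ) (x : ℕ)) =
      (1 / 8) * 𝔼 y ∈ interval (N ^ 2), if ((x : ℕ) : ℤ) - t ∈ interval N then
        f₀ ((x : ℕ) - t, y) * f₁ ((x : ℕ) - t + ((z : ℕ) - (x : ℕ)), y) *
          f₂ ((x : ℕ) - t, y + ((z : ℕ) - (x : ℕ)) ^ 2) else 0 := by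
    intro x z
    rw [Fintype.expect_eq_sum_div_card, ZMod.card, sum_eq_sum_interval (L := N ^ 2) (by omega),
      expect_eq_sum_div_card, card_interval, show (P : ℂ) = 8 * (N : ℂ) ^ 2 by exact_mod_cast hP]
    · push_cast
      have : ∀ S : ℂ, S / (8 * (N : ℂ) ^ 2) = 1 / 8 * (S / (N : ℂ) ^ 2) := fun S => by ring
      rw [this]
      congr 2
      refine sum_congr rfl fun n hn => ?_
      have hx := x.2; have hz := z.2
      -- Both y and (z - x)² are at most N², so the argument of f₂ stays in {1, …, 2N²}, below P,
      -- and residues can be read as integers.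
      have hn' : n + ((z : ℕ) - (x : ℕ) : ℤ) ^ 2 ∈ interval (2 * N ^ 2) := by
        rw [mem_interval] at hn ⊢
        have : ((z : ℕ) - (x : ℕ) : ℤ) ^ 2 ≤ (N : ℤ) ^ 2 := by
          rw [sq_le_sq, abs_le]
          rw [abs_of_nonneg (by positivity : (0 : ℤ) ≤ N)]
          omega
        have := sq_nonneg ((z : ℕ) - (x : ℕ) : ℤ)
        push_cast at hn ⊢
        constructor <;> linarith [hn.1, hn.2]
      rw [cut_intCast (by omega) _ hn, cut_intCast (by omega) _ hn, sqDiff, ← Int.cast_add,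
        cut_intCast (by omega) _ hn']
      split_ifs
      · rw [show ((x : ℕ) : ℤ) - t + ((z : ℕ) - (x : ℕ)) = (z : ℕ) - t by ring]
      · rw [mul_zero]
    · intro y hy
      rw [cut, if_neg hy, zero_mul, zero_mul]
  have e2 : cyclicCount (P := P)
      (fun x : Fin N => cut (fun n => f₀ ((x : ℕ) - t, n)) (N ^ 2))
      (fun z : Fin N => cut (fun n => f₁ ((z : ℕ) - t, n)) (N ^ 2))
      (fun x : Fin N => cut (fun n => if ((x : ℕ) : ℤ) - t ∈ interval N then f₂ ((x : ℕ) - t, n) else 0)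
        (2 * N ^ 2)) = 1 / 8 * 𝔼 u : Fin N, if ((u : ℕ) : ℤ) - t ∈ interval N then
      𝔼 v : Fin N, 𝔼 y ∈ interval (N ^ 2), f₀ ((u : ℕ) - t, y) *
        f₁ ((u : ℕ) - t + ((v : ℕ) - (u : ℕ)), y) * f₂ ((u : ℕ) - t, y + ((v : ℕ) - (u : ℕ)) ^ 2)
        else 0 := by
    simp only [cyclicCount, e1]
    rw [mul_expect]
    refine expect_congr rfl fun u _ => ?_
    rw [← mul_expect]
    split_ifs <;> simp
  rw [e2, norm_mul]
  have : ‖(1 / 8 : ℂ)‖ = 1 / 8 := by norm_num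
  rw [this]
  linarith

/-- The cyclic average divides by P ≥ 2N², and the points x - t kept by the cutoff are distinct
elements of `interval N`; both effects only decrease the left side. -/
lemma expect_norm_fourier_cut_le (hN : 1 ≤ N) (hP : P = 8 * N ^ 2) (f₂ : ℤ × ℤ → ℂ) (t : ℤ)
    (ζ : ZMod P) :
    𝔼 x : Fin N, ‖fourier (cut (fun n => if ((x : ℕ) : ℤ) - t ∈ interval N then
      f₂ ((x : ℕ) - t, n) else 0) (2 * N ^ 2)) ζ‖ ≤
    𝔼 x ∈ interval N, ‖𝔼 y ∈ interval (2 * N ^ 2), f₂ (x, y) * e (y • ZMod.toAddCircle ζ)‖ := by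
  have hN0 : (0 : ℝ) < N := by exact_mod_cast hN
  have hN2 : 1 ≤ N ^ 2 := Nat.one_le_pow _ _ hN
  set g : ℤ → ℝ := fun x =>
    ‖𝔼 y ∈ interval (2 * N ^ 2), f₂ (x, y) * e (y • ZMod.toAddCircle ζ)‖ with hg
  have e1 : ∀ x : Fin N, ‖fourier (cut (fun n => if ((x : ℕ) : ℤ) - t ∈ interval N then
      f₂ ((x : ℕ) - t, n) else 0) (2 * N ^ 2)) ζ‖ ≤
      if ((x : ℕ) : ℤ) - t ∈ interval N then g ((x : ℕ) - t) else 0 := by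
    intro x
    rw [fourier, Fintype.expect_eq_sum_div_card, ZMod.card,
      sum_eq_sum_interval (L := 2 * N ^ 2) (by omega)]
    · have e2 : ∀ n ∈ interval (2 * N ^ 2), cut (fun n => if ((x : ℕ) : ℤ) - t ∈ interval N then
          f₂ ((x : ℕ) - t, n) else 0) (2 * N ^ 2) (n : ZMod P) * chi (ζ * (n : ZMod P)) =
          if ((x : ℕ) : ℤ) - t ∈ interval N then
            f₂ ((x : ℕ) - t, n) * e (n • ZMod.toAddCircle ζ) else 0 := by
        intro n hn
        rw [cut_intCast (by omega) _ hn, chi_mul_intCast]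
        split_ifs
        · rfl
        · rw [zero_mul]
      rw [sum_congr rfl e2]
      split_ifs
      · simp only [hg]
        rw [expect_eq_sum_div_card, card_interval, norm_div, norm_div]
        refine div_le_div_of_nonneg_left (norm_nonneg _) ?_ ?_
        · rw [Complex.norm_natCast]; positivity
        · rw [Complex.norm_natCast, Complex.norm_natCast]
          exact_mod_cast (by omega : 2 * N ^ 2 ≤ P)
      · simp
    · intro y hy
      rw [cut, if_neg hy, zero_mul]
  refine (expect_mono e1).trans ?_
  rw [Fintype.expect_eq_sum_div_card, expect_eq_sum_div_card, Fintype.card_fin, card_interval]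
  gcongr
  rw [← sum_filter]
  have hinj : Function.Injective fun x : Fin N => ((x : ℕ) : ℤ) - t := fun x x' h => by
    ext; simpa using h
  rw [← sum_image (f := g) (g := fun x : Fin N => ((x : ℕ) : ℤ) - t) fun x _ x' _ h => hinj h]
  refine sum_le_sum_of_subset_of_nonneg ?_ fun _ _ _ => norm_nonneg _
  intro n hn
  rw [mem_image] at hn
  obtain ⟨x, hx, rfl⟩ := hn
  exact (mem_filter.1 hx).2

end Reduction
end NonlinearRoth

/-! ### Choice of constants -/

theorem theorem5p2 :
    ∃ C : ℝ, 0 < C ∧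
      ∀ (N : ℕ) (δ : ℝ) (f₀ f₁ f₂ : ℤ × ℤ → ℂ), 1 ≤ N → 0 < δ →
        NonlinearRoth.OneBounded f₀ → NonlinearRoth.OneBounded f₁ →
        NonlinearRoth.OneBounded f₂ →
        δ ≤ ‖NonlinearRoth.countingOp N f₀ f₁ f₂‖ →
        (N : ℝ) ≤ C * δ ^ (-C) ∨
        ∃ (α : UnitAddCircle) (q : ℕ), 1 ≤ q ∧ (q : ℝ) ≤ C * δ ^ (-C) ∧
          ‖q • α‖ ≤ C * δ ^ (-C) / (N : ℝ) ^ 2 ∧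
          C⁻¹ * δ ^ C ≤ 𝔼 x ∈ NonlinearRoth.interval N,
            ‖𝔼 y ∈ NonlinearRoth.interval (2 * N ^ 2),
              f₂ (x, y) * NonlinearRoth.e (y • α)‖ := by
  obtain ⟨k, hk⟩ := NonlinearRoth.exists_large_fourier
  -- All bounds are powers T^k = 1600^k δ^(-k). Since δ ≤ 1, it suffices that C dominates both the
  -- factor 1600^k and the exponent k.
  refine ⟨1600 ^ k + k, by positivity, ?_⟩
  intro N δ f₀ f₁ f₂ hN hδ h₀ h₁ h₂ h
  set C : ℝ := 1600 ^ k + k with hC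
  have hC0 : 0 < C := by positivity
  have hC1 : (1600 : ℝ) ^ k ≤ C := le_add_of_nonneg_right (by positivity)
  have hC2 : (k : ℝ) ≤ C := le_add_of_nonneg_left (by positivity)
  have hδ1 : δ ≤ 1 := h.trans (NonlinearRoth.norm_countingOp_le_one hN h₀ h₁ h₂)
  have hpow : δ ^ C ≤ δ ^ k := by
    rw [← Real.rpow_natCast]
    exact Real.rpow_le_rpow_of_exponent_ge hδ hδ1 hC2
  have hδC : 0 < δ ^ C := Real.rpow_pos_of_pos hδ C
  -- With 1600 = 16·100, both 1/T ≤ δ/16, matching the transference loss, and T ≥ 100 hold.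
  obtain ⟨T, hT⟩ : ∃ T, T = 1600 / δ := ⟨_, rfl⟩
  have hT100 : 100 ≤ T := by
    rw [hT, le_div_iff₀ hδ]; linarith
  have hTk : T ^ k ≤ C * δ ^ (-C) := by
    rw [hT, div_pow, Real.rpow_neg hδ.le, ← div_eq_mul_inv]
    exact div_le_div₀ hC0.le hC1 hδC hpow
  rcases lt_or_ge (N : ℝ) (T ^ k) with hNT | hNT
  · exact Or.inl (hNT.le.trans hTk)
  right
  obtain ⟨P, hP⟩ : ∃ P, P = 8 * N ^ 2 := ⟨_, rfl⟩
  have : NeZero P := ⟨by rw [hP]; positivity⟩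
  obtain ⟨t, ht⟩ := NonlinearRoth.exists_cyclicCount_ge hN hP h
  obtain ⟨ζ, hζ, s1⟩ := hk hT100 hNT hP
    (fun x => NonlinearRoth.norm_cut_le_one (fun n => h₀ _) _) (fun x => NonlinearRoth.norm_cut_le_one (fun n => h₁ _) _)
    (fun x => NonlinearRoth.norm_cut_le_one (fun n => by split_ifs; exacts [h₂ _, by simp]) _)
    (le_trans (by rw [hT, one_div_div]; linarith) ht)
  obtain ⟨q, hq1, hq2, hq3⟩ := NonlinearRoth.mem_majSet.1 hζ
  refine ⟨ZMod.toAddCircle ζ, q, hq1, hq2.trans hTk, hq3.trans (by gcongr), ?_⟩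
  refine le_trans ?_ (s1.trans (NonlinearRoth.expect_norm_fourier_cut_le hN hP f₂ t ζ))
  rw [hT, div_pow, one_div_div, div_eq_inv_mul]
  gcongr
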